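/- A DeMorgan circuit $C$ on $n$ inputs is a straight-line program whose nodes are the input variables $x_1,\dots,x_n$ followed by gates, each gate being a binary AND, a binary OR, or a NOT of earlier nodes, with one node designated as the output. Its size is the number of its binary gates (NOT gates are not counted). Let $\mathrm{XOR}_n(x)=x_1\oplus\dots\oplus x_n$. Theorem (XOR checker). For each $b\in\{0,1\}$ there are a deterministic Turing machine $M$ and a polynomial $p$ such that the following holds for every $n$ and every DeMorgan circuit $C$ on $n$ inputs with exactly $3(n-1)$ binary gates that does not compute the function $\mathrm{XOR}_n\oplus b$: given a description of $C$ (with all numbers in unary), $M$ halts after at most $p(n+N)$ steps, where $N$ is the number of NOT gates of $C$, and outputs an $x\in\{0,1\}^n$ with $C(x)\neq \mathrm{XOR}_n(x)\oplus b$. In particular the running time is polynomial in $n$ on circuits whose number of NOT gates is polynomially bounded in $n$, such as circuits in which no NOT gate reads a NOT gate and no node is read by two NOT gates. -/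

import Mathlib

/-! Boolean circuits over the basis AND, OR, NOT, given as straight-line programs, and
deterministic Turing machines (Mathlib's `Turing.FinTM2`) with a step count. -/

namespace DeMorgan

/-- A gate of a circuit. The numbers are the positions of the nodes that the gate reads. -/
inductive Gate where
  | and (i j : ℕ)
  | or (i j : ℕ)
  | not (i : ℕ)
  deriving DecidableEq

namespace Gate

/-- All the nodes that the gate reads have position less than `m`. -/
def ReadsBelow (m : ℕ) : Gate → Prop
  | .and i j => i < m ∧ j < m
  | .or i j => i < m ∧ j < m
  | .not i => i < m

/-- AND and OR gates are binary, NOT gates are not. -/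
def isBinary : Gate → Bool
  | .and _ _ => true
  | .or _ _ => true
  | .not _ => false

/-- The value of a gate, given the list of the values of all earlier nodes. -/
def eval (vs : List Bool) : Gate → Bool
  | .and i j => vs.getD i false && vs.getD j false
  | .or i j => vs.getD i false || vs.getD j false
  | .not i => !vs.getD i false

end Gate

/-- A DeMorgan circuit on `n` inputs. The nodes `0, …, n - 1` are the input variables, the node
`n + k` is the `k`-th gate, and it reads earlier nodes only. Any node may be the output, and
nodes may be read any number of times. -/
structure Circuit (n : ℕ) where
  gates : List Gate
  out : ℕ
  gates_wf : ∀ (k : ℕ) (hk : k < gates.length), gates[k].ReadsBelow (n + k)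
  out_lt : out < n + gates.length

namespace Circuit

variable {n : ℕ}

/-- The size of a circuit: the number of its binary gates. -/
def size (C : Circuit n) : ℕ := C.gates.countP Gate.isBinary

/-- The number of NOT gates, which the size does not count. -/
def notCount (C : Circuit n) : ℕ := C.gates.countP (fun g => !g.isBinary)

/-- The values of all nodes on the input `x`, in order. -/
def values (C : Circuit n) (x : Fin n → Bool) : List Bool :=
  C.gates.foldl (fun vs g => vs ++ [g.eval vs]) (List.ofFn x)

/-- The output of the circuit on the input `x`. -/
def eval (C : Circuit n) (x : Fin n → Bool) : Bool := (C.values x).getD C.out false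

/-- The circuit computes the Boolean function `f`. -/
def Computes (C : Circuit n) (f : (Fin n → Bool) → Bool) : Prop := ∀ x, C.eval x = f x

end Circuit

/-- `xorFn n b` is the sum of the `n` input bits and of `b` modulo 2, that is, the function
`XOR_n` for `b = false` and its negation for `b = true`. -/
def xorFn (n : ℕ) (b : Bool) (x : Fin n → Bool) : Bool :=
  decide (Odd ((∑ i, (x i).toNat) + b.toNat))

/-- The alphabet in which circuits are written down. -/
inductive Symbol where
  | one | sep | and | or | not | out
  deriving DecidableEq

/-- A number in unary, followed by a separator. -/
def encodeNum (m : ℕ) : List Symbol := List.replicate m Symbol.one ++ [Symbol.sep]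

/-- The description of a gate. -/
def Gate.encode : Gate → List Symbol
  | .and i j => Symbol.and :: (encodeNum i ++ encodeNum j)
  | .or i j => Symbol.or :: (encodeNum i ++ encodeNum j)
  | .not i => Symbol.not :: encodeNum i

/-- The description of a circuit: the number of inputs in unary, all gates, the output node.
Its length is polynomially bounded in the number of nodes. -/
def Circuit.encode {n : ℕ} (C : Circuit n) : List Symbol :=
  encodeNum n ++ C.gates.flatMap Gate.encode ++ (Symbol.out :: encodeNum C.out)

/-- The deterministic Turing machine `M`, started on the word `l`, halts after at most `t` steps
with the word `l'` as its output. -/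
def OutputsInTime {Γ₀ Γ₁ : Type} (M : Turing.TM2ComputableAux Γ₀ Γ₁)
    (l : List Γ₀) (l' : List Γ₁) (t : ℕ) : Prop :=
  Nonempty (Turing.TM2OutputsInTime M.tm (l.map M.inputAlphabet.symm)
    (some (l'.map M.outputAlphabet.symm)) t)

end DeMorgan

/-! The proof makes the gate-elimination lower bound 3(n-1) for parity constructive. Under a partial
assignment (a restriction) every node simplifies to a constant or to a literal, and only the gates
still reachable from the output, the live ones, are counted. A live gate `g` that reads two free
variables `i` and `j` is killed by some value `c` of `i`. If the circuit is correct, then `i` has a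
second reader, and the constant gate is read by a further gate that does not become constant; so the
restriction `i = c` eliminates at least three live gates. Whenever this reasoning breaks down, some
variable has no influence on the output at a point near the restriction completed by zeros. Flipping
that variable changes the parity but not the output, so the circuit errs within three bits of that
point (`Good`). Consequently, with `m` free variables and fewer than 3(m-1) live gates, the greedy
path of such restrictions meets a failure (`exists_good_of_card_lt`). For at most 3(m-1) live gates
and `m ≥ 2` the same holds if some free variable has at most one reader (`exists_good_of_single`).
At the critical size an error is known to exist somewhere, and every elimination may be assumed to
remove exactly three gates. Comparing the eliminations at `i` and at `j` leaves three possibilities: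
a failure is at hand; or fixing one variable leads to one of the two cases above; or `i` and `j` act
only through two common readers that feed one gate, whose value does not change when both bits are
flipped. In the last case output and parity are invariant under this flip, so an error can be moved
to the half cube `x i = c`, and the induction continues (`found_of_errs`). It therefore suffices to
try the greedy path, at most one deviation, the greedy path again, and three changed bits:
polynomially many candidates. The greedy choice is computed by an abstract evaluation that
propagates a single proposal (variable, killing value) upwards through the circuit (`rep_absRes`).
The running time rests on a small stack language compiled to `Turing.FinTM2` and on closure
properties of polynomial time on binary trees (`PolyTrees`, `PolyTime`). -/

namespace DeMorgan

/-! ### Structured programs on stacks and their compilation to `Turing.FinTM2` -/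

/-- Structured programs acting on stacks, indexed by `K`, of letters in `A`. -/
inductive Prog (K A : Type) where
  | skip : Prog K A
  | push (k : K) (a : A) : Prog K A
  | seq (p q : Prog K A) : Prog K A
  /-- Pop a letter and branch on it. -/
  | case (k : K) (f : Option A → Prog K A) : Prog K A
  /-- Pop letters until the stack is empty, and run the body for each of them. -/
  | loop (k : K) (f : A → Prog K A) : Prog K A

namespace Prog

open Function

variable {K A : Type}

/-- `Exec p s t s'`: started on the stacks `s`, the program `p` stops after `t` steps with the
stacks `s'`. -/
inductive Exec [DecidableEq K] :
    Prog K A → (K → List A) → ℕ → (K → List A) → Prop where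
  | skip (s) : Exec skip s 1 s
  | push (k a s) : Exec (push k a) s 1 (update s k (a :: s k))
  | seq {p q s t s' t' s''} : Exec p s t s' → Exec q s' t' s'' →
      Exec (seq p q) s (t + t') s''
  | case {k f s t s'} : Exec (f (s k).head?) (update s k (s k).tail) t s' →
      Exec (case k f) s (1 + t) s'
  | loop_nil {k f s} : s k = [] → Exec (loop k f) s 1 s
  | loop_cons {k f s a l t s' t' s''} : s k = a :: l → Exec (f a) (update s k l) t s' →
      Exec (loop k f) s' t' s'' → Exec (loop k f) s (1 + (t + t')) s''

/-- The control points of a program. -/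
@[reducible] def Lab : Prog K A → Type
  | skip => Unit
  | push _ _ => Unit
  | seq p q => Lab p ⊕ Lab q
  | case _ f => Option (Σ o, Lab (f o))
  | loop _ f => Option (Σ a, Lab (f a))

/-- The first control point of a program. -/
def entry : (p : Prog K A) → Lab p
  | skip => ()
  | push _ _ => ()
  | seq p _ => Sum.inl (entry p)
  | case _ _ => none
  | loop _ _ => none

/-- A program has finitely many control points. -/
@[reducible] noncomputable def fintypeLab [Fintype A] : (p : Prog K A) → Fintype (Lab p)
  | skip => inferInstanceAs (Fintype Unit)
  | push _ _ => inferInstanceAs (Fintype Unit)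
  | seq p q => @instFintypeSum _ _ (fintypeLab p) (fintypeLab q)
  | case _ f =>
    letI := fun o => fintypeLab (f o)
    inferInstanceAs (Fintype (Option (Σ o, Lab (f o))))
  | loop _ f =>
    letI := fun a => fintypeLab (f a)
    inferInstanceAs (Fintype (Option (Σ a, Lab (f a))))

/-- The alphabets of the compiled machine: it has one more stack, for its output. -/
@[reducible] def Alph (K A : Type) : Option K → Type
  | none => Bool
  | some _ => A

open Turing.TM2 in
/-- The machine code of a program. -/
def body {Λ : Type} : (p : Prog K A) → (Lab p → Λ) → Λ → Lab p → Stmt (Alph K A) Λ (Option A)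
  | skip, _, exit, _ => Stmt.goto fun _ => exit
  | push k a, _, exit, _ => Stmt.push (some k) (fun _ => a) (Stmt.goto fun _ => exit)
  | seq p q, emb, exit, l =>
      Sum.elim (body p (fun l => emb (Sum.inl l)) (emb (Sum.inr (entry q))))
        (body q (fun l => emb (Sum.inr l)) exit) l
  | case k f, emb, exit, l =>
      Option.elim l
        (Stmt.pop (some k) (fun _ o => o) (Stmt.goto fun o => emb (some ⟨o, entry (f o)⟩)))
        (fun l => body (f l.1) (fun l' => emb (some ⟨l.1, l'⟩)) exit l.2)
  | loop k f, emb, exit, l =>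
      Option.elim l
        (Stmt.pop (some k) (fun _ o => o)
          (Stmt.goto fun o => Option.elim o exit fun a => emb (some ⟨a, entry (f a)⟩)))
        (fun l => body (f l.1) (fun l' => emb (some ⟨l.1, l'⟩)) (emb none) l.2)

/-- The stacks of the compiled machine. -/
def liftStk (s : K → List A) (w : List Bool) : (k : Option K) → List (Alph K A k)
  | none => w
  | some k => s k

variable [DecidableEq K]

theorem update_liftStk_some (s : K → List A) (w : List Bool) (k : K) (v : List A) :
    update (liftStk s w) (some k) v = liftStk (update s k v) w := by
  funext k'
  rcases k' with _ | k'
  · exact update_of_ne (by simp) _ _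
  · by_cases h : k' = k
    · subst h
      exact (update_self (some k') _ _).trans (update_self k' v s).symm
    · refine (update_of_ne (by simpa using h) _ _).trans ?_
      exact (update_of_ne (β := fun _ => List A) h v s).symm

theorem update_liftStk_none (s : K → List A) (w v : List Bool) :
    update (liftStk s w) none v = liftStk s v := by
  funext k'
  rcases k' with _ | k'
  · exact update_self (none : Option K) _ _
  · exact update_of_ne (by simp) _ _

/-- `t` steps of a machine lead from the configuration `c` to `c'`. -/
def Steps {Λ : Type} (M : Λ → Turing.TM2.Stmt (Alph K A) Λ (Option A)) (t : ℕ)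
    (c c' : Turing.TM2.Cfg (Alph K A) Λ (Option A)) : Prop :=
  (flip bind (Turing.TM2.step M))^[t] (some c) = some c'

theorem Steps.trans {Λ : Type} {M : Λ → Turing.TM2.Stmt (Alph K A) Λ (Option A)} {t t' : ℕ}
    {c c' c''} (h : Steps M t c c') (h' : Steps M t' c' c'') : Steps M (t + t') c c'' := by
  unfold Steps at *
  rw [Nat.add_comm, iterate_add_apply, h, h']

theorem Steps.one {Λ : Type} {M : Λ → Turing.TM2.Stmt (Alph K A) Λ (Option A)}
    {c c'} (h : Turing.TM2.step M c = some c') : Steps M 1 c c' := h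

theorem step_pop {L : Type} {Γ : L → Type} {Λ σ : Type} [DecidableEq L]
    {M : Λ → Turing.TM2.Stmt Γ Λ σ} {l : Λ} {k : L} {f : σ → Option (Γ k) → σ}
    {q : Turing.TM2.Stmt Γ Λ σ} {v : σ} {S : ∀ k, List (Γ k)} {w : List (Γ k)}
    (h : M l = .pop k f q) (hS : S k = w) :
    Turing.TM2.step M ⟨some l, v, S⟩ =
      some (Turing.TM2.stepAux q (f v w.head?) (update S k w.tail)) := by
  subst hS
  rw [Turing.TM2.step, h, Turing.TM2.stepAux]

/-- The embedding of labels and the exit are arbitrary so that the induction applies to subprograms;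
the body of a loop exits to the head of that loop. The internal state is read only in the step that
pops into it, so its initial value does not matter. -/
theorem Exec.steps {p : Prog K A} {s s' : K → List A} {t : ℕ} (h : Exec p s t s') :
    ∀ {Λ : Type} (M : Λ → Turing.TM2.Stmt (Alph K A) Λ (Option A)) (emb : Lab p → Λ) (exit : Λ)
      (_ : ∀ l, M (emb l) = body p emb exit l) (v : Option A) (w : List Bool),
      ∃ v', Steps M t ⟨some (emb (entry p)), v, liftStk s w⟩ ⟨some exit, v', liftStk s' w⟩ := by
  induction h with
  | skip s =>
    intro Λ M emb exit hM v w
    refine ⟨v, Steps.one ?_⟩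
    simp only [Turing.TM2.step, hM]
    rfl
  | push k a s =>
    intro Λ M emb exit hM v w
    refine ⟨v, Steps.one ?_⟩
    simp only [Turing.TM2.step, hM, ← update_liftStk_some]
    rfl
  | @seq p q s t s' t' s'' hp hq ihp ihq =>
    intro Λ M emb exit hM v w
    obtain ⟨v₁, h₁⟩ := ihp M (fun l => emb (Sum.inl l)) (emb (Sum.inr (entry q)))
      (fun l => hM (Sum.inl l)) v w
    obtain ⟨v₂, h₂⟩ := ihq M (fun l => emb (Sum.inr l)) exit (fun l => hM (Sum.inr l)) v₁ w
    exact ⟨v₂, h₁.trans h₂⟩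
  | @case k f s t s' h ih =>
    intro Λ M emb exit hM v w
    obtain ⟨v₁, h₁⟩ := ih M (fun l => emb (some ⟨_, l⟩)) exit (fun l => hM (some ⟨_, l⟩))
      (s k).head? w
    refine ⟨v₁, Steps.trans (Steps.one ((step_pop (hM none) rfl).trans ?_)) h₁⟩
    rw [update_liftStk_some]
    rfl
  | @loop_nil k f s hk =>
    intro Λ M emb exit hM v w
    refine ⟨none, Steps.one ((step_pop (hM none) (w := []) hk).trans ?_)⟩
    have e : update s k [] = s := by rw [← hk, update_eq_self]
    rw [update_liftStk_some, List.tail_nil, e]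
    rfl
  | @loop_cons k f s a l t s' t' s'' hk h₁ h₂ ih₁ ih₂ =>
    intro Λ M emb exit hM v w
    obtain ⟨v₁, h₁⟩ := ih₁ M (fun l => emb (some ⟨_, l⟩)) (emb none) (fun l => hM (some ⟨_, l⟩))
      (some a) w
    obtain ⟨v₂, h₂⟩ := ih₂ M emb exit hM v₁ w
    refine ⟨v₂, Steps.trans (Steps.one ((step_pop (hM none) (w := a :: l) hk).trans ?_))
      (h₁.trans h₂)⟩
    rw [update_liftStk_some]
    rfl

/-- The stacks that are all empty except for `k`, which holds `w`. -/
def single (k : K) (w : List A) : K → List A := update (fun _ => []) k w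

theorem single_self (k : K) (w : List A) : single k w k = w := by simp [single]

theorem single_of_ne {k k' : K} (h : k' ≠ k) (w : List A) : single k w k' = [] := by
  simp [single, h]

/-- The machine that runs a program, and then moves the stack `o` to the output stack. -/
noncomputable def machine [Fintype K] [Fintype A] (p : Prog K A) (i o : K) (bit : A → Bool) :
    Turing.FinTM2 where
  K := Option K
  k₀ := some i
  k₁ := none
  Γ := Alph K A
  Λ := Lab p ⊕ Unit
  main := Sum.inl (entry p)
  ΛFin := @instFintypeSum _ _ (fintypeLab p) _
  σ := Option A
  initialState := none
  Γk₀Fin := inferInstanceAs (Fintype A)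
  m := Sum.elim (body p Sum.inl (Sum.inr ()))
    (fun _ => .pop (some o) (fun _ a => a)
      (.branch Option.isSome
        (.push none (fun a => (a.map bit).getD false) (.goto fun _ => Sum.inr ())) .halt))

/-- Moving letters from stack to stack reverses the word. The additional step is the pop that finds
the stack empty and halts. -/
theorem steps_output {Λ : Type} {M : Λ → Turing.TM2.Stmt (Alph K A) Λ (Option A)} {l : Λ} {o : K}
    {bit : A → Bool}
    (hM : M l = .pop (some o) (fun _ a => a) (.branch Option.isSome
        (.push none (fun a => (a.map bit).getD false) (.goto fun _ => l)) .halt))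
    (u : List A) : ∀ (v : Option A) (w : List Bool),
      Steps M (u.length + 1) ⟨some l, v, liftStk (single o u) w⟩
        ⟨none, none, liftStk (single o []) ((u.map bit).reverse ++ w)⟩ := by
  induction u with
  | nil =>
    intro v w
    refine Steps.one ((step_pop hM (w := []) (single_self o _)).trans ?_)
    rw [update_liftStk_some]
    simp [single]
  | cons a u ih =>
    intro v w
    have := ih (some a) (bit a :: w)
    rw [List.length_cons, Nat.add_comm (u.length + 1)]
    refine Steps.trans (Steps.one (c' := ⟨some l, some a, liftStk (single o u)
      (bit a :: w)⟩) ((step_pop hM (w := a :: u)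
      (single_self o _)).trans ?_))
      (by simpa using this)
    rw [update_liftStk_some]
    simp only [List.head?_cons, List.tail_cons, Turing.TM2.stepAux, Option.isSome_some, cond_true]
    rw [update_liftStk_none]
    simp [single, liftStk]

/-- The compiled machine, with its input and output alphabets. -/
noncomputable def toComputableAux [Fintype K] [Fintype A] (p : Prog K A) (i o : K)
    (bit : A → Bool) : Turing.TM2ComputableAux A Bool where
  tm := machine p i o bit
  inputAlphabet := Equiv.refl A
  outputAlphabet := Equiv.refl Bool

/-- The left side is the stack assignment of `Turing.initList`, unfolded; the decidability instance
is arbitrary so that it matches whichever one the machine carries. -/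
theorem stk_single_some (inst : DecidableEq (Option K)) (i : K) (w : List A) :
    (fun k : Option K => @dite (List (Alph K A k)) (k = some i) (inst k (some i))
      (fun h => by rw [h]; exact w.map id) fun _ => []) = liftStk (single i w) [] := by
  funext k
  rcases k with _ | k
  · exact dif_neg (by simp)
  · by_cases h : k = i
    · subst h
      exact (dif_pos rfl).trans ((List.map_id w).trans
        (single_self k w).symm)
    · exact (dif_neg (by simpa using h)).trans
        (single_of_ne h w).symm

theorem stk_single_none (inst : DecidableEq (Option K)) (o : K) (w : List Bool) :
    (fun k : Option K => @dite (List (Alph K A k)) (k = none) (inst k none)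
      (fun h => by rw [h]; exact w.map id) fun _ => []) = liftStk (single o []) (w ++ []) := by
  funext k
  rcases k with _ | k
  · exact (dif_pos rfl).trans ((List.map_id w).trans (List.append_nil w).symm)
  · refine (dif_neg (by simp)).trans ?_
    simp [liftStk, single]

theorem outputsInTime_of_exec [Fintype K] {p : Prog K Symbol} {i o : K} [Fintype Symbol]
    {bit : Symbol → Bool} {w u : List Symbol} {t T : ℕ}
    (h : Exec p (single i w) t (single o u)) (hT : t + (u.length + 1) ≤ T) :
    OutputsInTime (toComputableAux p i o bit) w (u.map bit).reverse T := by
  obtain ⟨v, hv⟩ := h.steps (machine p i o bit).m Sum.inl (Sum.inr ()) (fun l => rfl) none []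
  have key := hv.trans (steps_output rfl u v [])
  refine ⟨⟨⟨_, ?_⟩, hT⟩⟩
  have e₁ : Turing.initList (toComputableAux p i o bit).tm
      (List.map (toComputableAux p i o bit).inputAlphabet.symm w) =
      (⟨some (Sum.inl (entry p)), none, liftStk (single i w) []⟩ :
        Turing.TM2.Cfg (Alph K Symbol) (Lab p ⊕ Unit) (Option Symbol)) := by
    refine Turing.TM2.Cfg.mk.injEq .. |>.mpr ⟨rfl, rfl, ?_⟩
    exact stk_single_some _ i w
  have e₂ : Turing.haltList (toComputableAux p i o bit).tm
      (List.map (toComputableAux p i o bit).outputAlphabet.symm (u.map bit).reverse) =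
      (⟨none, none, liftStk (single o []) ((u.map bit).reverse ++ [])⟩ :
        Turing.TM2.Cfg (Alph K Symbol) (Lab p ⊕ Unit) (Option Symbol)) := by
    refine Turing.TM2.Cfg.mk.injEq .. |>.mpr ⟨rfl, rfl, ?_⟩
    exact stk_single_none _ o _
  rw [e₁, Option.map_some, e₂]
  exact key

end Prog

end DeMorgan

/-! ### Stack subroutines with time bounds -/

namespace DeMorgan

namespace Prog

open Function

section Basic

variable {K L : Type}

/-- Rename the stacks of a program. -/
def map (e : K → L) : Prog K Symbol → Prog L Symbol
  | skip => skip
  | push k a => push (e k) a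
  | seq p q => seq (map e p) (map e q)
  | case k f => case (e k) fun o => map e (f o)
  | loop k f => loop (e k) fun a => map e (f a)

variable [DecidableEq K] [DecidableEq L]

/-- Stacks outside the range of `e` are left alone and may hold anything, which is what calling a
program as a subroutine requires. -/
theorem Exec.map {p : Prog K Symbol} {s s' : K → List Symbol} {t : ℕ} (h : Exec p s t s')
    {e : K → L} (he : Injective e) : ∀ S : L → List Symbol, (∀ k, S (e k) = s k) →
      ∃ S', Exec (p.map e) S t S' ∧ (∀ k, S' (e k) = s' k) ∧
        ∀ l, (∀ k, e k ≠ l) → S' l = S l := by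
  have upd : ∀ (S : L → List Symbol) (s : K → List Symbol) (k : K) (w : List Symbol),
      (∀ k, S (e k) = s k) → ∀ k', update S (e k) w (e k') = update s k w k' := by
    intro S s k w hS k'
    by_cases h : k' = k
    · subst h; simp
    · simp [h, he.ne h, hS]
  induction h with
  | skip s => exact fun S hS => ⟨S, .skip S, hS, fun _ _ => rfl⟩
  | push k a s =>
    intro S hS
    refine ⟨_, .push (e k) a S, fun k' => ?_, fun l hl => update_of_ne (hl k).symm _ _⟩
    rw [hS k, upd S s k _ hS]
  | seq _ _ ihp ihq =>
    intro S hS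
    obtain ⟨S₁, h₁, h₂, h₃⟩ := ihp S hS
    obtain ⟨S₂, h₄, h₅, h₆⟩ := ihq S₁ h₂
    exact ⟨S₂, .seq h₁ h₄, h₅, fun l hl => (h₆ l hl).trans (h₃ l hl)⟩
  | @case k f s t s' h ih =>
    intro S hS
    obtain ⟨S₁, h₁, h₂, h₃⟩ := ih (update S (e k) (S (e k)).tail)
      (by rw [hS k]; exact upd S s k _ hS)
    refine ⟨S₁, .case ?_, h₂, fun l hl => (h₃ l hl).trans (update_of_ne (hl k).symm _ _)⟩
    rw [hS k] at h₁ ⊢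
    exact h₁
  | @loop_nil k f s hk => exact fun S hS => ⟨S, .loop_nil ((hS k).trans hk), hS, fun _ _ => rfl⟩
  | @loop_cons k f s a l t s' t' s'' hk h₁ h₂ ih₁ ih₂ =>
    intro S hS
    obtain ⟨S₁, h₁, h₂, h₃⟩ := ih₁ (update S (e k) l) (upd S s k _ hS)
    obtain ⟨S₂, h₄, h₅, h₆⟩ := ih₂ S₁ h₂
    exact ⟨S₂, .loop_cons ((hS k).trans hk) h₁ h₄, h₅, fun l hl =>
      (h₆ l hl).trans ((h₃ l hl).trans (update_of_ne (hl k).symm _ _))⟩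

/-- The program leads from the stacks `s` to `s'` in at most `T` steps. -/
def Runs (p : Prog K Symbol) (s s' : K → List Symbol) (T : ℕ) : Prop := ∃ t ≤ T, Exec p s t s'

theorem Runs.mono {p : Prog K Symbol} {s s' : K → List Symbol} {T T' : ℕ} (h : Runs p s s' T)
    (hT : T ≤ T') : Runs p s s' T' :=
  let ⟨t, ht, h⟩ := h
  ⟨t, ht.trans hT, h⟩

theorem Runs.seq {p q : Prog K Symbol} {s s' s'' : K → List Symbol} {T T' : ℕ}
    (h : Runs p s s' T) (h' : Runs q s' s'' T') : Runs (.seq p q) s s'' (T + T') :=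
  let ⟨_, ht, h⟩ := h
  let ⟨_, ht', h'⟩ := h'
  ⟨_, add_le_add ht ht', .seq h h'⟩

theorem Runs.of_eq {p : Prog K Symbol} {s s' s'' : K → List Symbol} {T : ℕ} (h : Runs p s s' T)
    (e : s' = s'') : Runs p s s'' T := e ▸ h

theorem Runs.congr_left {p : Prog K Symbol} {s s' s'' : K → List Symbol} {T : ℕ}
    (h : Runs p s s' T) (e : s = s'') : Runs p s'' s' T := e ▸ h

theorem runs_skip (s : K → List Symbol) : Runs skip s s 1 := ⟨1, le_rfl, .skip s⟩

theorem runs_push (k : K) (a : Symbol) (s : K → List Symbol) :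
    Runs (push k a) s (update s k (a :: s k)) 1 := ⟨1, le_rfl, .push k a s⟩

theorem Runs.case {k : K} {f : Option Symbol → Prog K Symbol} {s s' : K → List Symbol} {T : ℕ}
    (w : List Symbol) (hw : s k = w) (h : Runs (f w.head?) (update s k w.tail) s' T) :
    Runs (.case k f) s s' (1 + T) := by
  subst hw
  obtain ⟨t, ht, h⟩ := h
  exact ⟨_, by omega, .case h⟩

theorem Runs.loop_nil {k : K} {f : Symbol → Prog K Symbol} {s : K → List Symbol} (h : s k = []) :
    Runs (.loop k f) s s 1 := ⟨1, le_rfl, .loop_nil h⟩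

theorem Runs.loop_cons {k : K} {f : Symbol → Prog K Symbol} {s s' s'' : K → List Symbol}
    {a : Symbol} {l : List Symbol} {T T' : ℕ} (h : s k = a :: l)
    (h₁ : Runs (f a) (update s k l) s' T) (h₂ : Runs (.loop k f) s' s'' T') :
    Runs (.loop k f) s s'' (1 + (T + T')) := by
  obtain ⟨t, ht, h₁⟩ := h₁
  obtain ⟨t', ht', h₂⟩ := h₂
  exact ⟨_, by omega, .loop_cons h h₁ h₂⟩

/-- Run a program on some of the stacks of a larger machine. -/
theorem Runs.call {p : Prog K Symbol} {i o : K} {w w' : List Symbol} {T : ℕ}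
    (h : Runs p (single i w) (single o w') T) {e : K → L} (he : Injective e)
    {S : L → List Symbol} (hi : S (e i) = w) (hS : ∀ k, k ≠ i → S (e k) = []) :
    Runs (p.map e) S (update (update S (e i) []) (e o) w') T := by
  obtain ⟨t, ht, h⟩ := h
  obtain ⟨S', h₁, h₂, h₃⟩ := h.map he S (fun k => by
    by_cases hk : k = i
    · subst hk; rw [hi, single_self]
    · rw [hS k hk, single_of_ne hk])
  refine ⟨t, ht, ?_⟩
  convert h₁ using 1
  funext l
  by_cases hl : ∃ k, e k = l
  · obtain ⟨k, rfl⟩ := hl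
    rw [h₂]
    by_cases hk : k = o
    · subst hk; simp [single_self]
    · rw [single_of_ne hk, update_of_ne (he.ne hk)]
      by_cases hk : k = i
      · subst hk; simp
      · rw [update_of_ne (he.ne hk), hS k hk]
  · push Not at hl
    rw [h₃ l hl, update_of_ne (hl o).symm, update_of_ne (hl i).symm]

omit [DecidableEq L] in
theorem update_update_single (a b : K) (w w' : List Symbol) :
    update (update (single a w) a []) b w' = single b w' := by
  funext k
  by_cases hb : k = b
  · subst hb; simp [single]
  · by_cases ha : k = a
    · subst ha; simp [single, hb]
    · simp [single, hb]

theorem Runs.call_single {p : Prog K Symbol} {i o : K} {w w' : List Symbol} {T : ℕ}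
    (h : Runs p (single i w) (single o w') T) {e : K → L} (he : Injective e) :
    Runs (p.map e) (single (e i) w) (single (e o) w') T :=
  (h.call he (single_self _ _) fun _ hk => single_of_ne (he.ne hk) _).of_eq
    (update_update_single _ _ _ _)

/-- Move a stack onto another one, reversing it. -/
def moveRev (a b : K) : Prog K Symbol := loop a fun x => push b x

theorem runs_moveRev {a b : K} (hab : a ≠ b) (S : K → List Symbol) (w : List Symbol)
    (hw : S a = w) :
    Runs (moveRev a b) S (update (update S a []) b (w.reverse ++ S b)) (2 * w.length + 1) := by
  induction w generalizing S with
  | nil =>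
    have e : update S a [] = S := by rw [← hw, update_eq_self]
    exact (Runs.loop_nil hw).of_eq (by simp [e])
  | cons x w ih =>
    refine ((Runs.loop_cons hw (runs_push b x _) (ih _ ?_)).of_eq ?_).mono
      (by simp only [List.length_cons]; omega)
    · simp [hab]
    · funext k
      by_cases hb : k = b
      · subst hb; simp [hab.symm]
      · by_cases ha : k = a <;> simp [ha, hb, hab]

/-- Move a stack onto another one. -/
def transfer (a x b : K) : Prog K Symbol := seq (moveRev a x) (moveRev x b)

theorem runs_transfer {a x b : K} (hax : a ≠ x) (hxb : x ≠ b) (hab : a ≠ b) {S : K → List Symbol}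
    (w : List Symbol) (hw : S a = w) (hx : S x = []) :
    Runs (transfer a x b) S (update (update S a []) b (w ++ S b)) (4 * w.length + 2) := by
  refine (((runs_moveRev hax S w hw).seq (runs_moveRev hxb _ w.reverse ?_)).of_eq ?_).mono
    (by simp only [List.length_reverse]; omega)
  · simp [hx]
  · funext k
    by_cases hb : k = b
    · subst hb; simp [hxb.symm, hab.symm]
    · by_cases hk : k = x
      · subst hk; simp [hax.symm, hb, hx]
      · by_cases ha : k = a <;> simp [ha, hb, hk, hax, hab]

theorem runs_transfer_single {a x b : K} (hax : a ≠ x) (hxb : x ≠ b) (hab : a ≠ b)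
    (w : List Symbol) : Runs (transfer a x b) (single a w) (single b w) (4 * w.length + 2) := by
  refine (runs_transfer hax hxb hab w (single_self _ _) (single_of_ne hax.symm _)).of_eq ?_
  rw [update_update_single, single_of_ne hab.symm, List.append_nil]

/-- Empty a stack. -/
def clear (a : K) : Prog K Symbol := loop a fun _ => skip

theorem runs_clear (a : K) (S : K → List Symbol) (w : List Symbol) (hw : S a = w) :
    Runs (clear a) S (update S a []) (2 * w.length + 1) := by
  induction w generalizing S with
  | nil =>
    refine (Runs.loop_nil hw).of_eq ?_
    rw [← hw, update_eq_self]
  | cons x w ih =>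
    exact ((Runs.loop_cons hw (runs_skip _) (ih _ (update_self _ _ _))).of_eq (by simp)).mono
      (by simp only [List.length_cons]; omega)

/-- Copy a stack onto two others, reversing it. -/
def dupRev (a b c : K) : Prog K Symbol := loop a fun x => seq (push b x) (push c x)

theorem runs_dupRev {a b c : K} (hab : a ≠ b) (hac : a ≠ c) (hbc : b ≠ c) (S : K → List Symbol)
    (w : List Symbol) (hw : S a = w) :
    Runs (dupRev a b c) S (update (update (update S a []) b (w.reverse ++ S b)) c
      (w.reverse ++ S c)) (3 * w.length + 1) := by
  induction w generalizing S with
  | nil =>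
    have e : update S a [] = S := by rw [← hw, update_eq_self]
    exact (Runs.loop_nil hw).of_eq (by simp [e])
  | cons x w ih =>
    refine ((Runs.loop_cons hw ((runs_push b x _).seq (runs_push c x _)) (ih _ ?_)).of_eq ?_).mono
      (by simp only [List.length_cons]; omega)
    · simp [hab, hac]
    · funext k
      by_cases hc : k = c
      · subst hc; simp [hac.symm, hbc.symm]
      · by_cases hb : k = b
        · subst hb; simp [hab.symm, hc]
        · by_cases ha : k = a <;> simp [ha, hb, hc, hab, hac]

/-- Push a word. -/
def pushWord (a : K) : List Symbol → Prog K Symbol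
  | [] => skip
  | x :: w => seq (pushWord a w) (push a x)

theorem runs_pushWord (a : K) (S : K → List Symbol) (w : List Symbol) :
    Runs (pushWord a w) S (update S a (w ++ S a)) (w.length + 1) := by
  induction w with
  | nil => exact (runs_skip S).of_eq (by simp)
  | cons x w ih => exact (ih.seq (runs_push a x _)).of_eq (by simp)

end Basic

end Prog

/-! ### Binary trees in Polish notation -/

/-- Binary trees, the data on which polynomial time functions work. -/
inductive BTree where
  | nil : BTree
  | cons (a b : BTree) : BTree

namespace BTree

/-- The Polish notation of a tree. -/
def code : BTree → List Symbol
  | nil => [Symbol.sep]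
  | cons a b => Symbol.one :: (code a ++ code b)

def size : BTree → ℕ
  | nil => 1
  | cons a b => 1 + (size a + size b)

/-- The number of inner nodes. -/
def inner : BTree → ℕ
  | nil => 0
  | cons a b => 1 + (inner a + inner b)

def car : BTree → BTree
  | nil => nil
  | cons a _ => a

def cdr : BTree → BTree
  | nil => nil
  | cons _ b => b

@[simp] theorem length_code (t : BTree) : t.code.length = t.size := by
  induction t with
  | nil => rfl
  | cons a b iha ihb => simp [code, size, iha, ihb]; omega

theorem size_pos (t : BTree) : 0 < t.size := by cases t <;> simp [size]

theorem inner_lt_size (t : BTree) : t.inner < t.size := by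
  induction t with
  | nil => simp [inner, size]
  | cons a b iha ihb => simp only [inner, size]; omega

/-- The letters `one` in the word of a tree can thus serve as a unary loop counter. -/
theorem count_code (t : BTree) : t.code.count Symbol.one = t.inner := by
  induction t with
  | nil => rfl
  | cons a b iha ihb => simp [code, inner, iha, ihb]; omega

end BTree

namespace Prog

open Function

section Take

variable {K : Type} [DecidableEq K]

/-- Read the root of a tree from `src`, for each subtree that is still to be read. -/
def takeLoop (src cnt dst : K) : Prog K Symbol :=
  loop cnt fun _ => case src fun
    | some .one => seq (push dst .one) (seq (push cnt .one) (push cnt .one))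
    | some s => push dst s
    | none => skip

/-- The stack `cnt` holds one letter for each subtree still to be read: a leaf removes one, an inner
node adds one on balance. The remaining run, to `S'` in time `T`, is a hypothesis, so that the two
subtrees of a node can be handled one after the other. -/
theorem runs_takeLoop {src cnt dst : K} (h₁ : src ≠ cnt) (h₂ : src ≠ dst) (h₃ : cnt ≠ dst)
    (t : BTree) : ∀ (S : K → List Symbol) (r c : List Symbol) (S' : K → List Symbol) (T : ℕ),
      S src = t.code ++ r → S cnt = Symbol.one :: c →
      Runs (takeLoop src cnt dst)
        (update (update (update S src r) cnt c) dst (t.code.reverse ++ S dst)) S' T →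
      Runs (takeLoop src cnt dst) S S' (T + 5 * t.size) := by
  induction t with
  | nil =>
    intro S r c S' T hs hc h
    refine Runs.mono (Runs.loop_cons hc (Runs.case (Symbol.sep :: r) ?_ (runs_push _ _ _))
      (T' := T) ?_) (by simp only [BTree.size]; omega)
    · simpa [h₁, BTree.code] using hs
    · refine h.congr_left ?_
      funext k
      by_cases hd : k = dst
      · subst hd; simp [BTree.code, h₂.symm, h₃.symm]
      · by_cases hk : k = cnt
        · subst hk; simp [hd, h₁.symm]
        · by_cases ha : k = src <;> simp [ha, hd, hk, h₁, h₂]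
  | cons a b iha ihb =>
    intro S r c S' T hs hc h
    have key := iha (update (update (update S src (a.code ++ (b.code ++ r))) cnt
      (Symbol.one :: Symbol.one :: c)) dst (Symbol.one :: S dst)) (b.code ++ r)
      (Symbol.one :: c) S' (T + 5 * b.size) (by simp [h₁, h₂]) (by simp [h₃]) (by
        refine ihb _ r c S' T (by simp [h₁, h₂]) (by simp [h₃]) ?_
        refine h.congr_left ?_
        funext k
        by_cases hd : k = dst
        · subst hd; simp [BTree.code]
        · by_cases hk : k = cnt
          · subst hk; simp [hd]
          · by_cases ha : k = src <;> simp [ha, hd, hk, h₁, h₂])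
    refine Runs.mono (Runs.loop_cons hc (Runs.case (Symbol.one :: (a.code ++ (b.code ++ r))) ?_
      ((runs_push _ _ _).seq ((runs_push _ _ _).seq (runs_push _ _ _)))) (T' :=
        T + 5 * b.size + 5 * a.size) ?_) (by simp only [BTree.size]; omega)
    · simpa [h₁, BTree.code] using hs
    · refine key.congr_left ?_
      funext k
      by_cases hd : k = dst
      · subst hd; simp [h₂.symm, h₃.symm]
      · by_cases hk : k = cnt
        · subst hk; simp [hd, h₁.symm]
        · by_cases ha : k = src <;> simp [ha, hd, hk, h₁, h₂]

/-- Move a tree from `src` to `dst`, reversing its word. -/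
def take (src cnt dst : K) : Prog K Symbol := seq (push cnt .one) (takeLoop src cnt dst)

theorem runs_take {src cnt dst : K} (h₁ : src ≠ cnt) (h₂ : src ≠ dst) (h₃ : cnt ≠ dst)
    (t : BTree) {S : K → List Symbol} (r : List Symbol) (hs : S src = t.code ++ r)
    (hc : S cnt = []) :
    Runs (take src cnt dst) S (update (update S src r) dst (t.code.reverse ++ S dst))
      (5 * t.size + 2) := by
  refine ((runs_push _ _ _).seq (runs_takeLoop h₁ h₂ h₃ t _ r [] _ 1 ?_ ?_
    (Runs.of_eq (Runs.loop_nil ?_) ?_))).mono (by omega)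
  · simpa [h₁] using hs
  · simp [hc]
  · simp [h₃]
  · funext k
    by_cases hd : k = dst
    · subst hd; simp [h₃.symm]
    · by_cases hk : k = cnt
      · subst hk; simp [hd, h₁.symm, hc]
      · by_cases ha : k = src <;> simp [ha, hd, hk, h₁, h₂]

end Take

end Prog

end DeMorgan

/-! ### Polynomial time on families of trees -/

namespace DeMorgan

theorem polynomial_eval_mono (P : Polynomial ℕ) {a b : ℕ} (h : a ≤ b) : P.eval a ≤ P.eval b := by
  simp only [Polynomial.eval_eq_sum, Polynomial.sum]
  gcongr

open Prog Function

/-- Some program computes `v x` from `u x`, for all `x` in the index set, in polynomial time. -/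
def PolyTrees {ι : Type} (u v : ι → BTree) : Prop :=
  ∃ (K : Type) (_ : Fintype K) (_ : DecidableEq K) (p : Prog K Symbol) (i o : K)
    (P : Polynomial ℕ), ∀ x,
      Runs p (single i (u x).code) (single o (v x).code) (P.eval (u x).size) ∧
        (v x).size ≤ P.eval (u x).size

namespace PolyTrees

variable {ι κ : Type} {u v w : ι → BTree}

theorem refl (u : ι → BTree) : PolyTrees u u :=
  ⟨Unit, inferInstance, inferInstance, skip, (), (), .X + 1, fun x =>
    ⟨(runs_skip _).mono (by simp), by simp⟩⟩

theorem precomp (h : PolyTrees u v) (f : κ → ι) :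
    PolyTrees (fun x => u (f x)) (fun x => v (f x)) :=
  let ⟨K, h₁, h₂, p, i, o, P, h⟩ := h
  ⟨K, h₁, h₂, p, i, o, P, fun x => h (f x)⟩

/-- The time of the second program is polynomial in the first input because `PolyTrees` also bounds
the size of the result. -/
theorem trans (h : PolyTrees u v) (h' : PolyTrees v w) : PolyTrees u w := by
  obtain ⟨K, _, _, p, i, o, P, h⟩ := h
  obtain ⟨K', _, _, p', i', o', P', h'⟩ := h'
  refine ⟨K ⊕ K' ⊕ Unit, inferInstance, inferInstance,
    seq (p.map Sum.inl) (seq (transfer (Sum.inl o) (Sum.inr (Sum.inr ())) (Sum.inr (Sum.inl i')))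
      (p'.map fun k => Sum.inr (Sum.inl k))), Sum.inl i, Sum.inr (Sum.inl o'),
    5 * P + 2 + P'.comp P, fun x => ⟨?_, ?_⟩⟩
  · refine (((h x).1.call_single Sum.inl_injective).seq
      ((runs_transfer_single (by simp) (by simp) (by simp) _).seq
        ((h' x).1.call_single (e := fun k => Sum.inr (Sum.inl k)) fun a b hab => by
          simpa using hab))).mono ?_
    have := polynomial_eval_mono P' (h x).2
    have h₂ := (h x).2
    simp only [Polynomial.eval_add, Polynomial.eval_mul, Polynomial.eval_ofNat,
      Polynomial.eval_comp, BTree.length_code] at *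
    omega
  · have := polynomial_eval_mono P' (h x).2
    have h₂ := (h' x).2
    simp only [Polynomial.eval_add, Polynomial.eval_mul, Polynomial.eval_ofNat,
      Polynomial.eval_comp] at *
    omega

theorem const (u : ι → BTree) (t : BTree) : PolyTrees u fun _ => t :=
  ⟨Unit, inferInstance, inferInstance, seq (clear ()) (pushWord () t.code), (), (),
    2 * .X + Polynomial.C (t.size + 2), fun x => by
      simp only [Polynomial.eval_add, Polynomial.eval_mul, Polynomial.eval_ofNat,
        Polynomial.eval_X, Polynomial.eval_C]
      refine ⟨(((runs_clear () _ _ (single_self _ _)).seq (runs_pushWord _ _ _)).of_eq ?_).mono ?_,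
        by omega⟩
      · funext k; simp [single]
      · simp only [BTree.length_code]; omega⟩

/-- The input is duplicated since each program consumes its copy. The second result is moved first,
so that it ends up below the first one, as Polish notation demands. -/
theorem cons (h : PolyTrees u v) (h' : PolyTrees u w) :
    PolyTrees u fun x => BTree.cons (v x) (w x) := by
  obtain ⟨K, _, _, p, i, o, P, h⟩ := h
  obtain ⟨K', _, _, p', i', o', P', h'⟩ := h'
  let e₁ : K → K ⊕ K' ⊕ Bool := Sum.inl
  let e₂ : K' → K ⊕ K' ⊕ Bool := fun k => Sum.inr (Sum.inl k)
  let a : K ⊕ K' ⊕ Bool := Sum.inr (Sum.inr false)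
  let b : K ⊕ K' ⊕ Bool := Sum.inr (Sum.inr true)
  have he₁ : Injective e₁ := Sum.inl_injective
  have he₂ : Injective e₂ := fun k k' hk => by simpa [e₂] using hk
  have h₁₂ : ∀ k k', e₁ k ≠ e₂ k' := by simp [e₁, e₂]
  have h₁a : ∀ k, e₁ k ≠ a := by simp [e₁, a]
  have h₁b : ∀ k, e₁ k ≠ b := by simp [e₁, b]
  have h₂a : ∀ k, e₂ k ≠ a := by simp [e₂, a]
  have h₂b : ∀ k, e₂ k ≠ b := by simp [e₂, b]
  have hab : a ≠ b := by simp [a, b]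
  refine ⟨K ⊕ K' ⊕ Bool, inferInstance, inferInstance,
    seq (moveRev (e₁ i) a) (seq (dupRev a (e₁ i) (e₂ i'))
      (seq (p.map e₁) (seq (p'.map e₂) (seq (transfer (e₂ o') a b)
        (seq (transfer (e₁ o) a b) (push b .one)))))), e₁ i, b,
    5 * .X + 5 * P + 5 * P' + 10, fun x => ⟨?_, ?_⟩⟩
  · have h₂ := (h x).2
    have h₃ := (h' x).2
    refine (((runs_moveRev (h₁a i) _ (u x).code (single_self _ _)).seq
      ((runs_dupRev (h₁a i).symm (h₂a i').symm (h₁₂ _ _) _ (u x).code.reverse ?_).seq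
      (((h x).1.call he₁ ?_ ?_).seq (((h' x).1.call he₂ ?_ ?_).seq
      ((runs_transfer (h₂a _) hab (h₂b _) (w x).code ?_ ?_).seq
      ((runs_transfer (h₁a _) hab (h₁b _) (v x).code ?_ ?_).seq
      (runs_push b _ _))))))).of_eq ?_).mono ?_
    · simp [single, (h₁a i).symm]
    · simp [single, h₁a, h₁₂]
    · intro k hk
      simp [single, h₁a, h₁₂, he₁.ne hk]
    · simp [single, (h₁a _).symm, (h₁₂ _ _).symm, h₂a]
    · intro k hk
      simp [single, (h₁₂ _ _).symm, he₂.ne hk, h₂a]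
    · simp
    · simp [single, (h₁a _).symm, (h₂a _).symm]
    · simp [single, h₁₂, h₁a, h₁b]
    · simp [single, (h₁a _).symm, (h₂a _).symm, hab]
    · funext k
      by_cases hb : k = b
      · subst hb
        simp [single, BTree.code, (h₁b _).symm, (h₂b _).symm]
      · rw [single_of_ne hb]
        by_cases ho : k = e₁ o
        · subst ho; simp [h₁b]
        · by_cases ho' : k = e₂ o'
          · subst ho'; simp [h₂b, (h₁₂ _ _).symm]
          · by_cases ha : k = a
            · subst ha; simp [single, (h₁a _).symm, (h₂a _).symm, hab]
            · simp only [single, update_apply, hb, ho, ho', ha, if_false]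
              split_ifs <;> simp_all
    · simp only [Polynomial.eval_add, Polynomial.eval_mul, Polynomial.eval_ofNat,
        Polynomial.eval_X, BTree.length_code, List.length_reverse] at *
      omega
  · have h₂ := (h x).2
    have h₃ := (h' x).2
    simp only [Polynomial.eval_add, Polynomial.eval_mul, Polynomial.eval_ofNat,
      Polynomial.eval_X, BTree.size] at *
    omega

theorem car_id : PolyTrees id BTree.car := by
  refine ⟨Fin 3, inferInstance, inferInstance, case 0 fun
    | some .one => seq (take 0 1 2) (seq (clear 0) (moveRev 2 0))
    | _ => push 0 .sep, 0, 0, 10 * .X + 10, fun t => ?_⟩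
  simp only [Polynomial.eval_add, Polynomial.eval_mul, Polynomial.eval_ofNat, Polynomial.eval_X,
    id]
  rcases t with _ | ⟨a, b⟩
  · refine ⟨((Runs.case [Symbol.sep] (single_self _ _) (runs_push _ _ _)).of_eq ?_).mono
      (by omega), by simp [BTree.car]; omega⟩
    funext k; fin_cases k <;> simp [single, BTree.code, BTree.car]
  · refine ⟨((Runs.case (Symbol.one :: (a.code ++ b.code)) (single_self _ _)
      ((runs_take (by decide) (by decide) (by decide) a b.code ?_ ?_).seq
        ((runs_clear _ _ b.code ?_).seq (runs_moveRev (by decide) _ a.code.reverse ?_)))).of_eq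
          ?_).mono ?_, ?_⟩
    · simp
    · simp [single]
    · simp
    · simp [single]
    · funext k; fin_cases k <;> simp [single, BTree.car]
    · simp [BTree.size]; omega
    · simp [BTree.size, BTree.car]; omega

theorem cdr_id : PolyTrees id BTree.cdr := by
  refine ⟨Fin 3, inferInstance, inferInstance, case 0 fun
    | some .one => seq (take 0 1 2) (clear 2)
    | _ => push 0 .sep, 0, 0, 10 * .X + 10, fun t => ?_⟩
  simp only [Polynomial.eval_add, Polynomial.eval_mul, Polynomial.eval_ofNat, Polynomial.eval_X,
    id]
  rcases t with _ | ⟨a, b⟩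
  · refine ⟨((Runs.case [Symbol.sep] (single_self _ _) (runs_push _ _ _)).of_eq ?_).mono
      (by omega), by simp [BTree.cdr]; omega⟩
    funext k; fin_cases k <;> simp [single, BTree.code, BTree.cdr]
  · refine ⟨((Runs.case (Symbol.one :: (a.code ++ b.code)) (single_self _ _)
      ((runs_take (by decide) (by decide) (by decide) a b.code ?_ ?_).seq
        (runs_clear _ _ a.code.reverse ?_))).of_eq ?_).mono ?_, ?_⟩
    · simp
    · simp [single]
    · simp [single]
    · funext k; fin_cases k <;> simp [single, BTree.cdr]
    · simp [BTree.size]; omega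
    · simp [BTree.size, BTree.cdr]; omega

theorem car (h : PolyTrees u v) : PolyTrees u fun x => (v x).car :=
  h.trans (car_id.precomp v)

theorem cdr (h : PolyTrees u v) : PolyTrees u fun x => (v x).cdr :=
  h.trans (cdr_id.precomp v)

/-- For each letter `one` on the stack `a`, push a letter onto the stack `b`. -/
def _root_.DeMorgan.Prog.countOnes {K : Type} (a b : K) : Prog K Symbol :=
  loop a fun
    | .one => push b .one
    | _ => skip

theorem _root_.DeMorgan.Prog.runs_countOnes {K : Type} [DecidableEq K] {a b : K} (hab : a ≠ b)
    (S : K → List Symbol) (w : List Symbol) (hw : S a = w) :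
    Runs (countOnes a b) S (update (update S a []) b
      (List.replicate (w.count Symbol.one) Symbol.one ++ S b)) (2 * w.length + 1) := by
  induction w generalizing S with
  | nil =>
    have e : update S a [] = S := by rw [← hw, update_eq_self]
    exact (Runs.loop_nil hw).of_eq (by simp [e])
  | cons y w ih =>
    by_cases hy : y = Symbol.one
    · have e : Runs (match y with | .one => push b .one | _ => skip) (update S a w)
          (update (update S a w) b (.one :: update S a w b)) 1 := by rw [hy]; exact runs_push b .one _
      refine ((Runs.loop_cons hw e (ih _ ?_)).of_eq ?_).mono
        (by simp only [List.length_cons]; omega)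
      · simp [hab]
      · funext k
        by_cases hb : k = b
        · subst hb
          simp [hab.symm, hy, ← List.replicate_append_replicate]
        · by_cases ha : k = a <;> simp [ha, hb, hab]
    · have e : Runs (match y with | .one => push b .one | _ => skip) (update S a w)
          (update S a w) 1 := by
        cases y <;> first | exact absurd rfl hy | exact runs_skip _
      refine ((Runs.loop_cons hw e (ih _ ?_)).of_eq ?_).mono
        (by simp only [List.length_cons]; omega)
      · simp
      · simp [hy, hab.symm]

/-- Iteration of a step that is computable in polynomial time, with a tree as the counter. -/
theorem iterate {c : ι → BTree} {s : ι → ℕ → BTree}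
    (h : PolyTrees (fun y : {y : ι × ℕ // y.2 < (c y.1).inner} => s y.1.1 y.1.2)
      (fun y => s y.1.1 (y.1.2 + 1)))
    (Q : Polynomial ℕ)
    (hQ : ∀ x, ∀ k ≤ (c x).inner, (s x k).size ≤ Q.eval (BTree.cons (c x) (s x 0)).size) :
    PolyTrees (fun x => BTree.cons (c x) (s x 0)) (fun x => s x (c x).inner) := by
  obtain ⟨K, _, _, p, i, o, P, h⟩ := h
  let e : K → K ⊕ Fin 5 := Sum.inl
  let f : Fin 5 → K ⊕ Fin 5 := Sum.inr
  have he : Injective e := Sum.inl_injective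
  have hf : Injective f := Sum.inr_injective
  have hef : ∀ k k', e k ≠ f k' := by simp [e, f]
  have hlt : ∀ x, (c x).inner ≤ (BTree.cons (c x) (s x 0)).size := fun x => by
    have := (c x).inner_lt_size
    simp only [BTree.size]
    omega
  -- `k` rounds are done and `m` remain, counted on the stack `f 3`. Between rounds only this stack
  -- and the input stack of `p` are occupied. In the time of a round, `8 * Q` pays for the two
  -- transfers.
  have key : ∀ x m k, k + m = (c x).inner → ∀ S : K ⊕ Fin 5 → List Symbol,
      S (f 3) = List.replicate m Symbol.one → (∀ l, l ≠ 3 → S (f l) = []) →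
      (∀ k, k ≠ i → S (e k) = []) → S (e i) = (s x k).code →
      Runs (loop (f 3) fun _ => seq (p.map e) (seq (transfer (e o) (f 4) (f 1))
          (transfer (f 1) (f 4) (e i)))) S
        (single (e i) (s x (c x).inner).code)
        (m * (P.comp Q + 8 * Q + 6).eval (BTree.cons (c x) (s x 0)).size + 1) := by
    intro x m
    induction m with
    | zero =>
      intro k hk S h₃ hf' he' hi
      refine (Runs.loop_nil h₃).of_eq ?_ |>.mono (by omega)
      funext l
      rcases l with l | l
      · by_cases hl : l = i
        · subst hl; rw [single_self, ← hk]; exact hi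
        · exact (he' l hl).trans (single_of_ne (he.ne hl) _).symm
      · rw [single_of_ne (by simp [e])]
        by_cases hl : l = 3
        · subst hl; exact h₃
        · exact hf' l hl
    | succ m ih =>
      intro k hk S h₃ hf' he' hi
      have hstep := (h ⟨(x, k), by simp only; omega⟩).1
      have h₁ := polynomial_eval_mono P (hQ x k (by omega))
      have h₂ := hQ x (k + 1) (by omega)
      simp only at hstep
      refine ((Runs.loop_cons (l := List.replicate m Symbol.one) h₃
        (Runs.seq (hstep.call he ?_ ?_) (Runs.seq
          (runs_transfer (hef _ _) (hf.ne (by decide)) (hef _ _) (s x (k + 1)).code ?_ ?_)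
          (runs_transfer (hf.ne (by decide)) (hef _ _).symm (hef _ _).symm (s x (k + 1)).code
            ?_ ?_)))
        (ih (k + 1) (by omega) _ ?_ ?_ ?_ ?_))).mono ?_
      · simpa [hef] using hi
      · intro l hl
        simpa [hef] using he' l hl
      · simp
      · simp [(hef _ _).symm, hf.ne, hf' 4 (by decide)]
      · simp [(hef _ _).symm, hf.eq_iff, hf' 1 (by decide)]
      · simp [(hef _ _).symm, hf.eq_iff, hf' 4 (by decide)]
      · simp [(hef _ _).symm, hf.eq_iff]
      · intro l hl
        by_cases hl' : l = 1
        · subst hl'; simp [(hef _ _).symm]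
        · simp [(hef _ _).symm, hf.eq_iff, hl, hl', hf' l hl]
      · intro l hl
        by_cases hl' : l = o
        · subst hl'; simp [hef, he.eq_iff, hl]
        · simp [hef, he.eq_iff, hl, hl', he' l hl]
      · by_cases hl' : i = o
        · subst hl'; simp [hef]
        · simp [hef, he.eq_iff, hl']
      · simp only [Polynomial.eval_add, Polynomial.eval_mul, Polynomial.eval_ofNat,
          Polynomial.eval_comp, BTree.length_code, Nat.add_mul, one_mul] at *
        omega
  -- The first `case` strips the root letter of the pair, `take` cuts out the counter tree, and
  -- `countOnes` turns it into a unary counter.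
  refine ⟨K ⊕ Fin 5, inferInstance, inferInstance,
    seq (case (f 0) fun _ => skip) (seq (take (f 0) (f 1) (f 2)) (seq (countOnes (f 2) (f 3))
      (seq (transfer (f 0) (f 4) (e i))
        (loop (f 3) fun _ => seq (p.map e) (seq (transfer (e o) (f 4) (f 1))
          (transfer (f 1) (f 4) (e i))))))), f 0, e i,
    .X * (P.comp Q + 8 * Q + 6) + 20 * .X + 20 + Q, fun x => ⟨?_, ?_⟩⟩
  · refine ((Runs.seq (Runs.case (Symbol.one :: ((c x).code ++ (s x 0).code)) (single_self _ _)
      (runs_skip _)) (Runs.seq (runs_take (hf.ne (by decide)) (hf.ne (by decide))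
        (hf.ne (by decide)) (c x) (s x 0).code ?_ ?_)
      (Runs.seq (runs_countOnes (hf.ne (by decide)) _ (c x).code.reverse ?_)
      (Runs.seq (runs_transfer (hf.ne (by decide)) (hef _ _).symm (hef _ _).symm (s x 0).code
        ?_ ?_)
        (key x (c x).inner 0 (by omega) _ ?_ ?_ ?_ ?_)))))).mono ?_
    · simp
    · simp [single, hf.eq_iff]
    · simp [single, hf.eq_iff]
    · simp [hf.eq_iff]
    · simp [single, hf.eq_iff]
    · simp [single, hf.eq_iff, (hef _ _).symm, BTree.count_code]
    · intro l hl
      simp only [single, update_apply, hf.eq_iff, (hef _ _).symm, if_false]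
      fin_cases l <;> simp at hl ⊢
    · intro k hk
      simp [single, hef, he.eq_iff, hk]
    · simp [single, hef]
    · have h₁ : (BTree.cons (c x) (s x 0)).size = 1 + ((c x).size + (s x 0).size) := rfl
      have h₂ := Nat.mul_le_mul_right
        ((P.comp Q + 8 * Q + 6).eval (BTree.cons (c x) (s x 0)).size) (hlt x)
      simp only [Polynomial.eval_add, Polynomial.eval_mul, Polynomial.eval_ofNat,
        Polynomial.eval_X, BTree.length_code, List.length_reverse] at *
      omega
  · have := hQ x _ le_rfl
    simp only [Polynomial.eval_add]
    omega

end PolyTrees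

end DeMorgan

namespace DeMorgan

namespace PolyTrees

variable {ι : Type} {u v w c : ι → BTree}

/-- Branching is reduced to iteration: one step turns the pair of `v x` and `w x` into two copies of
`v x`, and further steps change nothing. Iterating with `c x` as the counter, the second component
stays `w x` exactly when `c x` has no inner node. -/
theorem ite_nil (hc : PolyTrees u c) (hv : PolyTrees u v) (hw : PolyTrees u w) :
    PolyTrees u fun x => match c x with | .nil => w x | .cons _ _ => v x := by
  let s : ι → ℕ → BTree := fun x k =>
    Nat.casesOn k (.cons (v x) (w x)) fun _ => .cons (v x) (v x)
  have hs : ∀ x k, (s x k).car = v x := fun x k => by cases k <;> rfl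
  have key := iterate (c := c) (s := s) (by
    refine ((refl _).car.cons (refl _).car).trans ?_
    simp only [hs]
    exact refl _) (2 * .X) (by
      intro x k _
      have : (BTree.cons (c x) (s x 0)).size = 1 + ((c x).size + (1 + ((v x).size + (w x).size))) :=
        rfl
      simp only [Polynomial.eval_mul, Polynomial.eval_ofNat, Polynomial.eval_X, this]
      cases k <;> simp only [s, BTree.size] <;> omega)
  have := ((hc.cons (hv.cons hw)).trans key).cdr
  convert this using 2 with x
  rcases hcx : c x with _ | ⟨a, b⟩
  · rfl
  · rw [BTree.inner, Nat.add_comm]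
    rfl

end PolyTrees

/-! ### Polynomial time functions on encoded data -/

/-- Data that are encoded by binary trees. -/
class TreeEncodable (α : Type) where
  tree : α → BTree

open TreeEncodable

namespace TreeEncodable

def treeNat : ℕ → BTree
  | 0 => .nil
  | n + 1 => .cons .nil (treeNat n)

instance : TreeEncodable ℕ := ⟨treeNat⟩

instance : TreeEncodable Bool := ⟨fun b => bif b then .cons .nil .nil else .nil⟩

instance {α β : Type} [TreeEncodable α] [TreeEncodable β] : TreeEncodable (α × β) :=
  ⟨fun x => .cons (tree x.1) (tree x.2)⟩

def treeList {α : Type} [TreeEncodable α] : List α → BTree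
  | [] => .nil
  | a :: l => .cons (tree a) (treeList l)

instance {α : Type} [TreeEncodable α] : TreeEncodable (List α) := ⟨treeList⟩

instance : TreeEncodable Symbol := ⟨fun s => tree (match s with
  | .one => 0 | .sep => 1 | .and => 2 | .or => 3 | .not => 4 | .out => 5 : ℕ)⟩

end TreeEncodable

/-- The size of the encoding. -/
def treeSize {α : Type} [TreeEncodable α] (a : α) : ℕ := (tree a).size

section Size

variable {α β : Type} [TreeEncodable α] [TreeEncodable β]

theorem treeSize_pos (a : α) : 0 < treeSize a := BTree.size_pos _

@[simp] theorem treeSize_prod (x : α × β) : treeSize x = 1 + (treeSize x.1 + treeSize x.2) := rfl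

@[simp] theorem treeSize_nil : treeSize ([] : List α) = 1 := rfl

@[simp] theorem treeSize_cons (a : α) (l : List α) :
    treeSize (a :: l) = 1 + (treeSize a + treeSize l) := rfl

@[simp] theorem treeSize_zero : treeSize 0 = 1 := rfl

@[simp] theorem treeSize_succ (n : ℕ) : treeSize (n + 1) = treeSize n + 2 := by
  change 1 + (1 + treeSize n) = _
  omega

theorem treeSize_nat (n : ℕ) : treeSize n = 2 * n + 1 := by
  induction n with
  | zero => rfl
  | succ n ih => rw [treeSize_succ, ih]; omega

theorem treeSize_bool_le (b : Bool) : treeSize b ≤ 3 := by cases b <;> decide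

theorem treeSize_append (l l' : List α) :
    treeSize (l ++ l') + 1 = treeSize l + treeSize l' := by
  induction l with
  | nil => simp; omega
  | cons a l ih => simp only [List.cons_append, treeSize_cons]; omega

theorem treeSize_lt_of_mem {a : α} {l : List α} (h : a ∈ l) : treeSize a < treeSize l := by
  induction l with
  | nil => simp at h
  | cons b l ih =>
    rcases List.mem_cons.1 h with rfl | h
    · simp only [treeSize_cons]; omega
    · have := ih h; simp only [treeSize_cons]; omega

theorem length_lt_treeSize (l : List α) : l.length < treeSize l := by
  induction l with
  | nil => simp
  | cons a l ih => simp only [treeSize_cons, List.length_cons]; omega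

theorem treeSize_drop_le (l : List α) (k : ℕ) : treeSize (l.drop k) ≤ treeSize l := by
  have h := treeSize_append (l.take k) (l.drop k)
  have := treeSize_pos (l.take k)
  rw [List.take_append_drop] at h
  omega

theorem treeSize_le_length_mul (l : List α) (B : ℕ) (h : ∀ a ∈ l, treeSize a ≤ B) :
    treeSize l ≤ l.length * (B + 1) + 1 := by
  induction l with
  | nil => simp
  | cons a l ih =>
    have h₁ := ih fun a ha => h a (List.mem_cons_of_mem _ ha)
    have h₂ := h a List.mem_cons_self
    simp only [treeSize_cons, List.length_cons, Nat.add_mul, one_mul]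
    omega

theorem inner_treeNat (n : ℕ) : (tree n).inner = n := by
  induction n with
  | zero => rfl
  | succ n ih =>
    change 1 + (0 + (tree n).inner) = n + 1
    omega

theorem length_le_inner (l : List α) : l.length ≤ (tree l).inner := by
  induction l with
  | nil => simp
  | cons a l ih =>
    change l.length + 1 ≤ 1 + ((tree a).inner + (tree l).inner)
    omega

end Size

/-- The function is computed in polynomial time on encodings by trees. -/
@[fun_prop]
def PolyTime {α β : Type} [TreeEncodable α] [TreeEncodable β] (f : α → β) : Prop :=
  PolyTrees (fun x => tree x) (fun x => tree (f x))

namespace PolyTime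

variable {α β γ δ : Type} [TreeEncodable α] [TreeEncodable β] [TreeEncodable γ] [TreeEncodable δ]

theorem exists_size_le {f : α → β} (h : PolyTime f) :
    ∃ P : Polynomial ℕ, ∀ x, treeSize (f x) ≤ P.eval (treeSize x) :=
  let ⟨_, _, _, _, _, _, P, h⟩ := h
  ⟨P, fun x => (h x).2⟩

@[fun_prop] theorem id : PolyTime fun x : α => x := PolyTrees.refl _

@[fun_prop] theorem const (b : β) : PolyTime fun _ : α => b := PolyTrees.const _ _

@[fun_prop] theorem comp {g : β → γ} {f : α → β} (hg : PolyTime g) (hf : PolyTime f) :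
    PolyTime fun x => g (f x) :=
  PolyTrees.trans hf (PolyTrees.precomp hg f)

@[fun_prop] theorem prodMk {f : α → β} {g : α → γ} (hf : PolyTime f) (hg : PolyTime g) :
    PolyTime fun x => (f x, g x) := PolyTrees.cons hf hg

@[fun_prop] theorem fst {f : α → β × γ} (hf : PolyTime f) : PolyTime fun x => (f x).1 :=
  PolyTrees.car hf

@[fun_prop] theorem snd {f : α → β × γ} (hf : PolyTime f) : PolyTime fun x => (f x).2 :=
  PolyTrees.cdr hf

@[fun_prop] theorem list_cons {f : α → β} {g : α → List β} (hf : PolyTime f) (hg : PolyTime g) :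
    PolyTime fun x => f x :: g x := PolyTrees.cons hf hg

@[fun_prop] theorem tail {f : α → List β} (hf : PolyTime f) : PolyTime fun x => (f x).tail := by
  have := PolyTrees.cdr hf
  unfold PolyTime
  convert this using 2 with x
  beta_reduce
  cases f x <;> rfl

@[fun_prop] theorem headD {f : α → List β} {g : α → β} (hf : PolyTime f) (hg : PolyTime g) :
    PolyTime fun x => (f x).headD (g x) := by
  have := PolyTrees.ite_nil hf (PolyTrees.car hf) hg
  unfold PolyTime
  convert this using 2 with x
  beta_reduce
  cases f x <;> rfl

@[fun_prop] theorem bcond {c : α → Bool} {f g : α → β} (hc : PolyTime c) (hf : PolyTime f)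
    (hg : PolyTime g) : PolyTime fun x => cond (c x) (f x) (g x) := by
  have := PolyTrees.ite_nil hc hf hg
  unfold PolyTime
  convert this using 2 with x
  beta_reduce
  cases c x <;> rfl

@[fun_prop] theorem not {f : α → Bool} (hf : PolyTime f) : PolyTime fun x => !(f x) := by
  have : PolyTime fun x => cond (f x) false true := by fun_prop
  convert this using 2 with x
  cases f x <;> rfl

@[fun_prop] theorem and {f g : α → Bool} (hf : PolyTime f) (hg : PolyTime g) :
    PolyTime fun x => f x && g x := by
  have : PolyTime fun x => cond (f x) (g x) false := by fun_prop
  convert this using 2 with x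
  cases f x <;> rfl

@[fun_prop] theorem xor {f g : α → Bool} (hf : PolyTime f) (hg : PolyTime g) :
    PolyTime fun x => f x ^^ g x := by
  have : PolyTime fun x => cond (f x) (!(g x)) (g x) := by fun_prop
  convert this using 2 with x
  cases f x <;> cases g x <;> rfl

@[fun_prop] theorem isEmpty {f : α → List β} (hf : PolyTime f) :
    PolyTime fun x => (f x).isEmpty := by
  have := PolyTrees.ite_nil hf (PolyTime.const (α := α) false) (PolyTime.const (α := α) true)
  unfold PolyTime
  convert this using 2 with x
  beta_reduce
  cases f x <;> rfl

@[fun_prop] theorem succ {f : α → ℕ} (hf : PolyTime f) : PolyTime fun x => f x + 1 :=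
  PolyTrees.cons (PolyTrees.const _ .nil) hf

@[fun_prop] theorem pred {f : α → ℕ} (hf : PolyTime f) : PolyTime fun x => (f x).pred := by
  have := PolyTrees.cdr hf
  unfold PolyTime
  convert this using 2 with x
  beta_reduce
  cases f x <;> rfl

@[fun_prop] theorem beq_zero {f : α → ℕ} (hf : PolyTime f) : PolyTime fun x => f x == 0 := by
  have := PolyTrees.ite_nil hf (PolyTime.const (α := α) false) (PolyTime.const (α := α) true)
  unfold PolyTime
  convert this using 2 with x
  beta_reduce
  cases f x <;> rfl

/-- Iteration, with an encoded object as the counter. -/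
theorem iterate_inner {c : γ → δ} {f : γ → α → α} {init : γ → α} (hc : PolyTime c)
    (hf : PolyTime fun y : γ × α => f y.1 y.2) (hi : PolyTime init) (Q : Polynomial ℕ)
    (hQ : ∀ x, ∀ k, treeSize ((f x)^[k] (init x)) ≤ Q.eval (treeSize x)) :
    PolyTime fun x => (f x)^[(tree (c x)).inner] (init x) := by
  -- The parameter `x` is carried along in the state, since every step needs it.
  let s : γ → ℕ → BTree := fun x k => tree (x, (f x)^[k] (init x))
  have key := PolyTrees.iterate (c := fun x => tree (c x)) (s := s) (by
    have := PolyTrees.precomp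
      (PolyTime.prodMk (PolyTime.fst (PolyTime.id (α := γ × α))) hf)
      (fun y : {y : γ × ℕ // y.2 < (tree (c y.1)).inner} => (y.1.1, (f y.1.1)^[y.1.2] (init y.1.1)))
    simp only [s, Function.iterate_succ_apply']
    exact this) (.X + 1 + Q) (by
      intro x k _
      have h₁ : (BTree.cons (tree (c x)) (s x 0)).size =
        1 + ((tree (c x)).size + (1 + (treeSize x + treeSize (init x)))) := rfl
      have h₂ : (s x k).size = 1 + (treeSize x + treeSize ((f x)^[k] (init x))) := rfl
      have h₃ := hQ x k
      have h₄ := polynomial_eval_mono Q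
        (show treeSize x ≤ (BTree.cons (tree (c x)) (s x 0)).size by omega)
      simp only [Polynomial.eval_add, Polynomial.eval_X, Polynomial.eval_one]
      omega)
  exact PolyTrees.cdr ((PolyTrees.cons hc (PolyTime.prodMk PolyTime.id hi)).trans key)

theorem iterate {n : γ → ℕ} {f : γ → α → α} {init : γ → α} (hn : PolyTime n)
    (hf : PolyTime fun y : γ × α => f y.1 y.2) (hi : PolyTime init) (Q : Polynomial ℕ)
    (hQ : ∀ x, ∀ k, treeSize ((f x)^[k] (init x)) ≤ Q.eval (treeSize x)) :
    PolyTime fun x => (f x)^[n x] (init x) := by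
  have := iterate_inner hn hf hi Q hQ
  simpa only [inner_treeNat] using this

@[fun_prop] theorem sub {f g : α → ℕ} (hf : PolyTime f) (hg : PolyTime g) :
    PolyTime fun x => f x - g x := by
  obtain ⟨P, hP⟩ := hf.exists_size_le
  have h : ∀ k n, Nat.pred^[k] n = n - k := fun k n => by
    induction k with
    | zero => rfl
    | succ k ih => rw [Function.iterate_succ_apply', ih]; rfl
  have := iterate (f := fun _ => Nat.pred) hg (by fun_prop) hf P (fun x k => by
    refine le_trans ?_ (hP x)
    rw [h, treeSize_nat, treeSize_nat]
    omega)
  simpa only [h] using this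

@[fun_prop] theorem beq {f g : α → ℕ} (hf : PolyTime f) (hg : PolyTime g) :
    PolyTime fun x => f x == g x := by
  have : PolyTime fun x => (f x - g x == 0) && (g x - f x == 0) := by fun_prop
  convert this using 2 with x
  rw [Bool.eq_iff_iff]
  simp only [beq_iff_eq, Bool.and_eq_true]
  omega

@[fun_prop] theorem getD {f : α → List β} {k : α → ℕ} {g : α → β} (hf : PolyTime f)
    (hk : PolyTime k) (hg : PolyTime g) : PolyTime fun x => (f x).getD (k x) (g x) := by
  obtain ⟨P, hP⟩ := hf.exists_size_le
  have h : ∀ k (l : List β), List.tail^[k] l = l.drop k := fun k l => by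
    induction k with
    | zero => rfl
    | succ k ih => rw [Function.iterate_succ_apply', ih, List.tail_drop]
  have h₁ := iterate (f := fun _ => List.tail) hk (by fun_prop) hf P (fun x k => by
    rw [h]
    exact (treeSize_drop_le _ _).trans (hP x))
  have h₂ : PolyTime fun x => (List.tail^[k x] (f x)).headD (g x) := by fun_prop
  convert h₂ using 2 with x
  rw [h, List.headD_eq_head?_getD, List.head?_drop, List.getD_eq_getElem?_getD]

/-- Recursion on lists, under a bound on the size of the intermediate results. -/
theorem foldl_of_bound {l : γ → List β} {f : γ → α → β → α} {init : γ → α} (d : β)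
    (hl : PolyTime l) (hf : PolyTime fun y : γ × α × β => f y.1 y.2.1 y.2.2) (hi : PolyTime init)
    (Q : Polynomial ℕ)
    (hQ : ∀ x, ∀ k, treeSize (((l x).take k).foldl (f x) (init x)) ≤ Q.eval (treeSize x)) :
    PolyTime fun x => (l x).foldl (f x) (init x) := by
  obtain ⟨P, hP⟩ := hl.exists_size_le
  -- The list serves as its own counter: its encoding has at least as many inner nodes as the list
  -- has entries. Superfluous rounds are harmless because a step on the empty list is the identity,
  -- and for the same reason the default `d` never influences the result.
  let step : γ → α × List β → α × List β := fun x s =>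
    cond s.2.isEmpty s (f x s.1 (s.2.headD d), s.2.tail)
  have hs : ∀ x k, (step x)^[k] (init x, l x) =
      (((l x).take k).foldl (f x) (init x), (l x).drop k) := fun x k => by
    induction k with
    | zero => simp
    | succ k ih =>
      rw [Function.iterate_succ_apply', ih]
      by_cases hk : k < (l x).length
      · rw [List.take_add_one, List.foldl_append, List.getElem?_eq_getElem hk,
          List.drop_eq_getElem_cons hk]
        simp only [step, List.isEmpty_cons, cond_false, List.headD_cons, List.tail_cons,
          List.foldl_cons, List.foldl_nil, Option.toList_some]
      · have h₁ : (l x).drop k = [] := List.drop_eq_nil_iff.2 (by omega)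
        have h₂ : (l x).drop (k + 1) = [] := List.drop_eq_nil_iff.2 (by omega)
        rw [List.take_of_length_le (by omega), List.take_of_length_le (by omega), h₁, h₂]
        simp [step]
  have hstep : PolyTime fun y : γ × α × List β => step y.1 y.2 := by
    have : PolyTime fun y : γ × α × List β => f y.1 y.2.1 (y.2.2.headD d) :=
      hf.comp (f := fun y : γ × α × List β => (y.1, y.2.1, y.2.2.headD d)) (by fun_prop)
    fun_prop
  have key := iterate_inner hl hstep (hi.prodMk hl) (1 + Q + P) (fun x k => by
    rw [hs]
    have h₁ := hQ x k
    have h₂ := (treeSize_drop_le (l x) k).trans (hP x)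
    simp only [treeSize_prod, Polynomial.eval_add, Polynomial.eval_one]
    omega)
  refine cast ?_ key.fst
  congr 1
  funext x
  rw [hs, List.take_of_length_le (length_le_inner _)]

/-- Recursion on lists, if every step increases the size by a bounded amount. -/
theorem foldl_of_invariant {l : γ → List β} {f : γ → α → β → α} {init : γ → α} (d : β)
    (I : γ → α → Prop) (hl : PolyTime l) (hf : PolyTime fun y : γ × α × β => f y.1 y.2.1 y.2.2)
    (hi : PolyTime init) (R : Polynomial ℕ) (hI : ∀ x, I x (init x))
    (hR : ∀ x s, I x s → ∀ a ∈ l x, I x (f x s a) ∧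
      treeSize (f x s a) ≤ treeSize s + R.eval (treeSize x)) :
    PolyTime fun x => (l x).foldl (f x) (init x) := by
  obtain ⟨P, hP⟩ := hl.exists_size_le
  obtain ⟨P', hP'⟩ := hi.exists_size_le
  refine foldl_of_bound d hl hf hi (P' + P * R) fun x k => ?_
  have key : ∀ l' : List β, (∀ a ∈ l', a ∈ l x) → ∀ s, I x s → treeSize (l'.foldl (f x) s) ≤
      treeSize s + l'.length * R.eval (treeSize x) := by
    intro l'
    induction l' with
    | nil => simp
    | cons a l' ih =>
      intro hl' s hs
      have h₁ := hR x s hs a (hl' a List.mem_cons_self)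
      have h₂ := ih (fun a ha => hl' a (List.mem_cons_of_mem _ ha)) _ h₁.1
      simp only [List.foldl_cons, List.length_cons, Nat.add_mul, one_mul]
      omega
  refine (key _ (fun a ha => List.mem_of_mem_take ha) _ (hI x)).trans ?_
  simp only [Polynomial.eval_add, Polynomial.eval_mul]
  gcongr
  · exact hP' x
  · refine le_trans ?_ (hP x)
    refine le_trans ?_ (length_lt_treeSize (l x)).le
    simp

theorem foldl {l : γ → List β} {f : γ → α → β → α} {init : γ → α} (d : β)
    (hl : PolyTime l) (hf : PolyTime fun y : γ × α × β => f y.1 y.2.1 y.2.2)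
    (hi : PolyTime init) (R : Polynomial ℕ)
    (hR : ∀ x s, ∀ a ∈ l x, treeSize (f x s a) ≤ treeSize s + R.eval (treeSize x)) :
    PolyTime fun x => (l x).foldl (f x) (init x) :=
  foldl_of_invariant d (fun _ _ => True) hl hf hi R (fun _ => trivial)
    fun x s _ a ha => ⟨trivial, hR x s a ha⟩

variable [Inhabited β]

@[fun_prop] theorem reverse {f : α → List β} (hf : PolyTime f) :
    PolyTime fun x => (f x).reverse := by
  obtain ⟨P, hP⟩ := hf.exists_size_le
  have := foldl (f := fun _ s a => a :: s) (init := fun _ => []) default hf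
    (by fun_prop) (by fun_prop) (1 + P) (fun x s a ha => by
      have := (treeSize_lt_of_mem ha).le.trans (hP x)
      simp only [treeSize_cons, Polynomial.eval_add, Polynomial.eval_one]
      omega)
  simpa only [List.foldl_flip_cons_eq_append', List.append_nil] using this

@[fun_prop] theorem append {f g : α → List β} (hf : PolyTime f) (hg : PolyTime g) :
    PolyTime fun x => f x ++ g x := by
  obtain ⟨P, hP⟩ := hf.exists_size_le
  have := foldl (f := fun _ s a => a :: s) (l := fun x => (f x).reverse) default (by fun_prop)
    (by fun_prop) hg (1 + P) (fun x s a ha => by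
      have := (treeSize_lt_of_mem (List.mem_reverse.1 ha)).le.trans (hP x)
      simp only [treeSize_cons, Polynomial.eval_add, Polynomial.eval_one]
      omega)
  simpa only [List.foldl_flip_cons_eq_append', List.reverse_reverse] using this

theorem flatMap [Inhabited δ] {l : γ → List β} {f : γ → β → List δ} (hl : PolyTime l)
    (hf : PolyTime fun y : γ × β => f y.1 y.2) : PolyTime fun x => (l x).flatMap (f x) := by
  obtain ⟨P, hP⟩ := hl.exists_size_le
  obtain ⟨P', hP'⟩ := hf.exists_size_le
  have hf' : PolyTime fun y : γ × List δ × β => f y.1 y.2.2 :=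
    hf.comp (f := fun y : γ × List δ × β => (y.1, y.2.2)) (by fun_prop)
  have := foldl (f := fun x s a => s ++ f x a) (init := fun _ => []) default hl
    (by fun_prop) (by fun_prop) (P'.comp (1 + .X + P)) (fun x s a ha => by
      have h₁ := (treeSize_lt_of_mem ha).le.trans (hP x)
      have h₂ := hP' (x, a)
      have h₃ := treeSize_append s (f x a)
      have h₄ := polynomial_eval_mono P' (show treeSize (x, a) ≤
        1 + treeSize x + P.eval (treeSize x) by simp only [treeSize_prod]; omega)
      simp only [Polynomial.eval_comp, Polynomial.eval_add, Polynomial.eval_one,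
        Polynomial.eval_X] at *
      omega)
  refine cast ?_ this
  congr 1
  funext x
  rw [List.foldl_append_eq_append, List.nil_append]
  rfl

theorem map [Inhabited δ] {l : γ → List β} {f : γ → β → δ} (hl : PolyTime l)
    (hf : PolyTime fun y : γ × β => f y.1 y.2) : PolyTime fun x => (l x).map (f x) := by
  have : PolyTime fun x => (l x).flatMap fun a => [f x a] :=
    flatMap hl (f := fun x a => [f x a]) (by fun_prop)
  simpa only [List.map_eq_flatMap] using this

-- A symbol has the encoding of a number, so reading it as a number costs nothing; what remains is a
-- case distinction over six numbers.
omit [TreeEncodable α] [TreeEncodable β] [Inhabited β] in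
theorem ofSymbol {f : Symbol → δ} : PolyTime f := by
  have h : ∀ k : ℕ, PolyTime fun s : Symbol => BTree.rec (motive := fun _ => ℕ) 0
    (fun _ _ _ n => n + 1) (tree s) == k := by
    intro k
    have : PolyTime fun s : Symbol => BTree.rec (motive := fun _ => ℕ) 0
        (fun _ _ _ n => n + 1) (tree s) := by
      have := PolyTrees.refl fun s : Symbol => tree s
      unfold PolyTime
      convert this using 2 with s
      cases s <;> rfl
    fun_prop
  have h₀ := h 0
  have h₁ := h 1
  have h₂ := h 2
  have h₃ := h 3
  have h₄ := h 4
  have := bcond h₀ (const (f .one)) (bcond h₁ (const (f .sep)) (bcond h₂ (const (f .and))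
    (bcond h₃ (const (f .or)) (bcond h₄ (const (f .not)) (const (f .out))))))
  convert this using 2 with s
  cases s <;> rfl

@[fun_prop] theorem range {f : α → ℕ} (hf : PolyTime f) : PolyTime fun x => List.range (f x) := by
  obtain ⟨P, hP⟩ := hf.exists_size_le
  -- The list is built downwards from `n`; this closed form of the state bounds its size
  -- quadratically in every round.
  have h : ∀ n k, (fun s : ℕ × List ℕ => (s.1.pred, cond (s.1 == 0) s.2 (s.1.pred :: s.2)))^[k]
      (n, []) = (n - k, List.range' (n - k) (min n k)) := fun n k => by
    induction k with
    | zero => simp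
    | succ k ih =>
      rw [Function.iterate_succ_apply', ih]
      rcases Nat.lt_or_ge k n with hk | hk
      · have h₁ : (n - k == 0) = false := by simp; omega
        have h₂ : min n (k + 1) = min n k + 1 := by omega
        simp only [h₁, cond_false, h₂, List.range'_succ, Prod.mk.injEq, Nat.pred_eq_sub_one]
        refine ⟨by omega, ?_⟩
        rw [show n - (k + 1) = n - k - 1 by omega, show n - k - 1 + 1 = n - k by omega]
      · have h₁ : (n - k == 0) = true := by simp; omega
        simp only [h₁, cond_true, Prod.mk.injEq, Nat.pred_eq_sub_one]
        exact ⟨by omega, by congr 1 <;> omega⟩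
  have := iterate (γ := α)
    (f := fun _ (s : ℕ × List ℕ) => (s.1.pred, cond (s.1 == 0) s.2 (s.1.pred :: s.2)))
    (init := fun x => (f x, [])) hf (by fun_prop) (by fun_prop) (1 + P + (P * (P + 1) + 1))
    (fun x k => by
      have h₁ := hP x
      rw [h]
      have h₂ := treeSize_le_length_mul (List.range' (f x - k) (min (f x) k)) (treeSize (f x))
        (fun a ha => by
          simp only [List.mem_range'_1] at ha
          rw [treeSize_nat, treeSize_nat]
          omega)
      have h₃ : treeSize (f x - k) ≤ treeSize (f x) := by
        rw [treeSize_nat, treeSize_nat]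
        omega
      have h₄ : (List.range' (f x - k) (min (f x) k)).length ≤ P.eval (treeSize x) := by
        rw [treeSize_nat] at h₁
        simp only [List.length_range']
        omega
      simp only [treeSize_prod, Polynomial.eval_add, Polynomial.eval_one, Polynomial.eval_mul]
      have h₅ := Nat.mul_le_mul h₄ (Nat.add_le_add_right h₁ 1)
      omega)
  have := this.snd
  simp only [h] at this
  convert this using 2 with x
  simp [List.range_eq_range']

end PolyTime

end DeMorgan

namespace DeMorgan

open TreeEncodable

instance : Inhabited Symbol := ⟨.one⟩

/-! ### The algorithm -/

/-- An abstract value: an index, whether the value is constant, whether it is that of a gate, and a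
bit. The value `(i, true, _, b)` is the constant `b`, the value `(i, false, false, b)` is the
variable `i` plus `b`, and the value `(i, false, true, b)` is that of a gate above some gate that
reads two distinct variables and becomes constant when the variable `i` is set to `b`. -/
abbrev AbsVal := ℕ × Bool × Bool × Bool

namespace AbsVal

/-- For the value of a gate the last bit is not a sign but the killing value of the variable, so
negation keeps it. -/
def neg (u : AbsVal) : AbsVal := (u.1, u.2.1, u.2.2.1, cond u.2.2.1 u.2.2.2 (!u.2.2.2))

def false : AbsVal := (0, true, .false, .false)

/-- An operand that is a gate hands on its proposal. Two distinct variables create a new one: the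
literal of `u` vanishes, and with it the conjunction, when its variable equals the bit of `u`. -/
def and (u v : AbsVal) : AbsVal :=
  cond u.2.1 (cond u.2.2.2 v false)
    (cond v.2.1 (cond v.2.2.2 u false)
      (cond u.2.2.1 u
        (cond v.2.2.1 v
          (cond (u.1 == v.1) (cond (u.2.2.2 ^^ v.2.2.2) false u)
            (u.1, .false, true, u.2.2.2)))))

/-- The abstract value of a gate. -/
def op (s : Symbol) (u v : AbsVal) : AbsVal :=
  cond (s == .and) (and u v) (cond (s == .or) (neg (and (neg u) (neg v)))
    (cond (s == .not) (neg u) u))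

end AbsVal

namespace Checker

/-- A token: a gate or the output mark, with the numbers that follow it. -/
abbrev Token := Symbol × List ℕ

/-- The word is read from its end. There a separator comes before its number, so it opens a new
counter, which the letters `one` increment; any other letter closes a token with the numbers
collected so far. -/
def parseStep (t : List ℕ × List Token) (s : Symbol) : List ℕ × List Token :=
  cond (s == .one) ((t.1.headD 0 + 1) :: t.1.tail, t.2)
    (cond (s == .sep) (0 :: t.1, t.2) ([], (s, t.1) :: t.2))

/-- Read the description of a circuit. -/
def parse (w : List Symbol) : List ℕ × List Token := w.reverse.foldl parseStep ([], [])

/-- A missing argument defaults to node `0`; this is harmless, since NOT and the output mark ignore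
their second argument. The output mark copies its argument, so the output becomes the last node. -/
def evalStep (vs : List AbsVal) (t : Token) : List AbsVal :=
  vs ++ [AbsVal.op t.1 (vs.getD (t.2.getD 0 0) AbsVal.false) (vs.getD (t.2.getD 1 0) AbsVal.false)]

/-- The abstract value of the last node, given those of the input variables. -/
def absEval (x : List Token × List AbsVal) : AbsVal :=
  (x.1.foldl evalStep x.2).reverse.headD AbsVal.false

def setVar (ρ : List AbsVal) (i : ℕ) (c : Bool) : List AbsVal :=
  ρ.map fun e => cond (e.1 == i) (e.1, true, false, c) e

/-- Fix the variable that the abstract value of the output proposes. -/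
def next (ts : List Token) (ρ : List AbsVal) : List AbsVal :=
  cond ((absEval (ts, ρ)).2.2.1 && !(absEval (ts, ρ)).2.1)
    (setVar ρ (absEval (ts, ρ)).1 (absEval (ts, ρ)).2.2.2) ρ

def mods (ρ : List AbsVal) : List (List AbsVal) :=
  ρ :: ρ.flatMap fun e => [setVar ρ e.1 false, setVar ρ e.1 true]

/-- The indices stored in `ρ` run through all variables, so mapping over `ρ` doubles as counting and
produces the iterates up to the number of variables. -/
def path (ts : List Token) (ρ : List AbsVal) : List (List AbsVal) :=
  ρ :: ρ.map fun e => (next ts)^[e.1 + 1] ρ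

/-- Free variables count as zero, as in `zeroFill`. -/
def bit (e : AbsVal) : Bool := e.2.1 && e.2.2.2

def fill (ρ : List AbsVal) : List AbsVal := ρ.map fun e => (e.1, true, false, bit e)

def parity (b : Bool) (ρ : List AbsVal) : Bool := ρ.foldl (fun p e => p ^^ bit e) b

def fails (b : Bool) (ts : List Token) (ρ : List AbsVal) : Bool :=
  (absEval (ts, fill ρ)).2.2.2 ^^ parity b ρ

/-- This mirrors `Found` and `Good`: a stretch of the greedy path, at most one deviation, a second
stretch, and up to three changed bits. -/
def candidates (ts : List Token) (ρ : List AbsVal) : List (List AbsVal) :=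
  (((((path ts ρ).flatMap mods).flatMap (path ts)).flatMap mods).flatMap mods).flatMap mods

def search (b : Bool) (ts : List Token) (ρ : List AbsVal) : List Bool :=
  ((candidates ts ρ).flatMap fun τ => cond (fails b ts τ) [τ.map bit] []).headD []

def free (n : ℕ) : List AbsVal := (List.range n).map fun i => (i, false, false, false)

/-- The word that the machine outputs on the input word `w`. -/
def answer (b : Bool) (w : List Symbol) : List Bool :=
  search b (parse w).2 (free ((parse w).1.headD 0))

/-! ### The algorithm runs in polynomial time -/

section PolyTime

variable {α : Type} [TreeEncodable α]

@[fun_prop] theorem polyTime_beq_symbol {f : α → Symbol} (hf : PolyTime f) (s : Symbol) :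
    PolyTime fun x => f x == s :=
  (PolyTime.ofSymbol (f := fun t => t == s)).comp hf

theorem polyTime_parse : PolyTime parse := by
  have h : PolyTime fun x : List Symbol × (List ℕ × List Token) × Symbol =>
      parseStep x.2.1 x.2.2 := by
    unfold parseStep
    fun_prop
  refine PolyTime.foldl (f := fun _ => parseStep) (init := fun _ => ([], [])) default
    (by fun_prop) h (by fun_prop) 14 fun x t s _ => ?_
  obtain ⟨ns, ts⟩ := t
  -- The increment 14 comes from closing a token: at most 11 for its letter and 3 for the new nodes.
  have hs : treeSize s ≤ 11 := by cases s <;> decide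
  have h14 : Polynomial.eval (treeSize x) 14 = 14 := Polynomial.eval_ofNat ..
  rw [h14, parseStep]
  cases s == .one
  · cases s == .sep
    · simp only [cond_false, treeSize_prod, treeSize_nil, treeSize_cons]
      omega
    · simp only [cond_false, cond_true, treeSize_prod, treeSize_cons, treeSize_zero]
      omega
  · simp only [cond_true, treeSize_prod, treeSize_cons]
    cases ns with
    | nil => simp; omega
    | cons n ns => simp; omega

@[fun_prop] theorem polyTime_neg {f : α → AbsVal} (hf : PolyTime f) :
    PolyTime fun x => AbsVal.neg (f x) := by
  unfold AbsVal.neg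
  fun_prop

@[fun_prop] theorem polyTime_and {f g : α → AbsVal} (hf : PolyTime f) (hg : PolyTime g) :
    PolyTime fun x => AbsVal.and (f x) (g x) := by
  unfold AbsVal.and
  fun_prop

@[fun_prop] theorem polyTime_op {s : α → Symbol} {f g : α → AbsVal} (hs : PolyTime s)
    (hf : PolyTime f) (hg : PolyTime g) : PolyTime fun x => AbsVal.op (s x) (f x) (g x) := by
  unfold AbsVal.op
  fun_prop

theorem treeSize_absVal_le (u : AbsVal) : treeSize u ≤ treeSize u.1 + 12 := by
  have h₁ := treeSize_bool_le u.2.1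
  have h₂ := treeSize_bool_le u.2.2.1
  have h₃ := treeSize_bool_le u.2.2.2
  simp only [treeSize_prod]
  omega

/-- Indices of variables are copied and never computed, so abstract values stay small however many
gates they pass; this is the invariant of the fold in `polyTime_absEval`. -/
theorem treeSize_and_le {u v : AbsVal} {B : ℕ} (hu : treeSize u.1 ≤ B) (hv : treeSize v.1 ≤ B) :
    treeSize (AbsVal.and u v).1 ≤ B := by
  have h0 : treeSize AbsVal.false.1 ≤ B := by
    have := treeSize_pos u.1
    change 1 ≤ B
    omega
  unfold AbsVal.and
  repeat' first
    | assumption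
    | (rw [Bool.cond_eq_ite]; split)

theorem treeSize_op_le {s : Symbol} {u v : AbsVal} {B : ℕ} (hu : treeSize u.1 ≤ B)
    (hv : treeSize v.1 ≤ B) : treeSize (AbsVal.op s u v).1 ≤ B := by
  have h₁ := treeSize_and_le hu hv
  have h₂ : treeSize (AbsVal.neg (AbsVal.and (AbsVal.neg u) (AbsVal.neg v))).1 ≤ B :=
    treeSize_and_le (u := AbsVal.neg u) (v := AbsVal.neg v) hu hv
  unfold AbsVal.op
  repeat' first
    | assumption
    | (rw [Bool.cond_eq_ite]; split)

@[fun_prop] theorem polyTime_absEval {f : α → List Token × List AbsVal} (hf : PolyTime f) :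
    PolyTime fun x => absEval (f x) := by
  have h : PolyTime fun x : (List Token × List AbsVal) × List AbsVal × Token =>
      evalStep x.2.1 x.2.2 := by
    unfold evalStep
    fun_prop
  have h₁ : PolyTime fun x : List Token × List AbsVal => x.1.foldl evalStep x.2 := by
    refine PolyTime.foldl_of_invariant (f := fun _ => evalStep) default
      (fun x vs => ∀ e ∈ vs, treeSize e.1 ≤ treeSize x)
      (by fun_prop) h (by fun_prop) (.X + 13) (fun x e he => ?_) fun x vs hvs t _ => ?_
    · have h₁ := treeSize_lt_of_mem he
      simp only [treeSize_prod] at h₁ ⊢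
      omega
    · have hget : ∀ k, treeSize (vs.getD k AbsVal.false).1 ≤ treeSize x := fun k => by
        rw [List.getD_eq_getElem?_getD]
        rcases hk : vs[k]? with _ | e
        · exact treeSize_pos x
        · exact hvs e (List.mem_of_getElem? hk)
      have hop := treeSize_op_le (s := t.1) (hget (t.2.getD 0 0)) (hget (t.2.getD 1 0))
      refine ⟨fun e he => ?_, ?_⟩
      · rw [evalStep, List.mem_append, List.mem_singleton] at he
        rcases he with he | rfl
        · exact hvs e he
        · exact hop
      · have h₁ := treeSize_append vs [AbsVal.op t.1 (vs.getD (t.2.getD 0 0) AbsVal.false)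
          (vs.getD (t.2.getD 1 0) AbsVal.false)]
        have h₂ := treeSize_absVal_le (AbsVal.op t.1 (vs.getD (t.2.getD 0 0) AbsVal.false)
          (vs.getD (t.2.getD 1 0) AbsVal.false))
        rw [treeSize_cons, treeSize_nil] at h₁
        rw [evalStep, Polynomial.eval_add, Polynomial.eval_X, Polynomial.eval_ofNat]
        omega
  have h₂ : PolyTime absEval := by
    unfold absEval
    fun_prop
  exact h₂.comp hf

@[fun_prop] theorem polyTime_setVar {ρ : α → List AbsVal} {i : α → ℕ} {c : α → Bool}
    (hρ : PolyTime ρ) (hi : PolyTime i) (hc : PolyTime c) :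
    PolyTime fun x => setVar (ρ x) (i x) (c x) := by
  unfold setVar
  exact PolyTime.map (f := fun x (e : AbsVal) => cond (e.1 == i x) (e.1, true, false, c x) e) hρ
    (by fun_prop)

@[fun_prop] theorem polyTime_next {ts : α → List Token} {ρ : α → List AbsVal}
    (hts : PolyTime ts) (hρ : PolyTime ρ) : PolyTime fun x => next (ts x) (ρ x) := by
  unfold next
  fun_prop

@[fun_prop] theorem polyTime_mods {ρ : α → List AbsVal} (hρ : PolyTime ρ) :
    PolyTime fun x => mods (ρ x) := by
  have := PolyTime.flatMap (f := fun x (e : AbsVal) => [setVar (ρ x) e.1 false,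
    setVar (ρ x) e.1 true]) hρ (by fun_prop)
  unfold mods
  fun_prop

theorem map_fst_setVar (ρ : List AbsVal) (i : ℕ) (c : Bool) :
    (setVar ρ i c).map Prod.fst = ρ.map Prod.fst := by
  rw [setVar, List.map_map]
  refine List.map_congr_left fun e _ => ?_
  rw [Function.comp_apply, Bool.cond_eq_ite]
  split <;> rfl

/-- Fixing variables does not touch the indices, which bounds all iterates by a fixed multiple of
the initial size. -/
theorem map_fst_next_iterate (ts : List Token) (ρ : List AbsVal) (k : ℕ) :
    ((next ts)^[k] ρ).map Prod.fst = ρ.map Prod.fst := by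
  induction k with
  | zero => rfl
  | succ k ih =>
    rw [Function.iterate_succ_apply', next, Bool.cond_eq_ite]
    split
    · rw [map_fst_setVar, ih]
    · exact ih

theorem treeSize_le_of_map_fst {ρ τ : List AbsVal} (h : τ.map Prod.fst = ρ.map Prod.fst) :
    treeSize τ ≤ 13 * treeSize ρ := by
  induction ρ generalizing τ with
  | nil =>
    rw [List.map_nil, List.map_eq_nil_iff] at h
    subst h
    simp
  | cons e ρ ih =>
    cases τ with
    | nil => simp at h
    | cons u τ =>
      simp only [List.map_cons, List.cons.injEq] at h
      have h₁ := ih h.2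
      have h₂ := treeSize_absVal_le u
      rw [h.1] at h₂
      simp only [treeSize_cons, treeSize_prod] at *
      omega

@[fun_prop] theorem polyTime_path {ts : α → List Token} {ρ : α → List AbsVal}
    (hts : PolyTime ts) (hρ : PolyTime ρ) : PolyTime fun x => path (ts x) (ρ x) := by
  obtain ⟨P, hP⟩ := hρ.exists_size_le
  have h₁ : PolyTime fun y : α × AbsVal => (next (ts y.1))^[y.2.1 + 1] (ρ y.1) := by
    refine PolyTime.iterate (f := fun y : α × AbsVal => next (ts y.1)) (by fun_prop)
      (by fun_prop) (by fun_prop) (13 * P) fun y k => ?_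
    refine (treeSize_le_of_map_fst (map_fst_next_iterate _ _ _)).trans ?_
    rw [Polynomial.eval_mul, Polynomial.eval_ofNat]
    gcongr
    refine (hP y.1).trans (polynomial_eval_mono P ?_)
    rw [treeSize_prod]
    omega
  have := PolyTime.map (f := fun x (e : AbsVal) => (next (ts x))^[e.1 + 1] (ρ x)) hρ h₁
  unfold path
  fun_prop

@[fun_prop] theorem polyTime_bit {f : α → AbsVal} (hf : PolyTime f) :
    PolyTime fun x => bit (f x) := by
  unfold bit
  fun_prop

@[fun_prop] theorem polyTime_fill {ρ : α → List AbsVal} (hρ : PolyTime ρ) :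
    PolyTime fun x => fill (ρ x) :=
  PolyTime.map (f := fun _ (e : AbsVal) => (e.1, true, false, bit e)) hρ (by fun_prop)

@[fun_prop] theorem polyTime_parity (b : Bool) {ρ : α → List AbsVal} (hρ : PolyTime ρ) :
    PolyTime fun x => parity b (ρ x) :=
  PolyTime.foldl (f := fun _ p (e : AbsVal) => p ^^ bit e) (init := fun _ => b) default hρ
    (by fun_prop) (by fun_prop) 3 fun x p e _ => by
      have := treeSize_bool_le (p ^^ bit e)
      rw [Polynomial.eval_ofNat]
      omega

@[fun_prop] theorem polyTime_fails (b : Bool) {ts : α → List Token} {ρ : α → List AbsVal}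
    (hts : PolyTime ts) (hρ : PolyTime ρ) : PolyTime fun x => fails b (ts x) (ρ x) := by
  unfold fails
  fun_prop

@[fun_prop] theorem polyTime_candidates {ts : α → List Token} {ρ : α → List AbsVal}
    (hts : PolyTime ts) (hρ : PolyTime ρ) : PolyTime fun x => candidates (ts x) (ρ x) := by
  have hm : ∀ {l : α → List (List AbsVal)}, PolyTime l → PolyTime fun x => (l x).flatMap mods :=
    fun hl => PolyTime.flatMap (f := fun _ => mods) hl (by fun_prop)
  exact hm (hm (hm (PolyTime.flatMap (f := fun x => path (ts x)) (hm (polyTime_path hts hρ))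
    (by fun_prop))))

theorem polyTime_answer (b : Bool) : PolyTime (answer b) := by
  have h₁ : PolyTime fun n : ℕ => free n := by
    unfold free
    exact PolyTime.map (f := fun _ (i : ℕ) => ((i, false, false, false) : AbsVal)) (by fun_prop)
      (by fun_prop)
  have h₂ : PolyTime fun x : List Token × List AbsVal => search b x.1 x.2 := by
    have h₃ : PolyTime fun y : (List Token × List AbsVal) × List AbsVal => y.2.map bit :=
      PolyTime.map (f := fun _ => bit) (by fun_prop) (by fun_prop)
    have h₄ := PolyTime.flatMap (l := fun x : List Token × List AbsVal => candidates x.1 x.2)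
      (f := fun (x : List Token × List AbsVal) (τ : List AbsVal) =>
        cond (fails b x.1 τ) [τ.map bit] []) (by fun_prop) (by fun_prop)
    unfold search
    fun_prop
  have h₃ := polyTime_parse
  exact h₂.comp (f := fun w => ((parse w).2, free ((parse w).1.headD 0))) (by fun_prop)

end PolyTime

end Checker

end DeMorgan

/-! ### From words to trees and back, and the resulting machine -/

namespace DeMorgan

open TreeEncodable Prog Function

namespace Prog

/-- Replace a word by the encoding of the list of its letters. -/
def encodeWord {K : Type} (i x : K) : Prog K Symbol :=
  seq (moveRev i x) (seq (push i .sep) (loop x fun s =>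
    seq (pushWord i (tree s).code) (push i .one)))

theorem treeSize_symbol_le (s : Symbol) : (tree s).size ≤ 11 := by cases s <;> decide

theorem runs_encodeLoop {K : Type} [DecidableEq K] {i x : K} (hix : i ≠ x) (w : List Symbol) :
    ∀ (S : K → List Symbol) (l : List Symbol), S x = w → S i = (tree l).code →
      Runs (loop x fun s => seq (pushWord i (tree s).code) (push i .one)) S
        (update (update S x []) i (tree (w.reverse ++ l)).code) (14 * w.length + 1) := by
  induction w with
  | nil =>
    intro S l hw hl
    refine (Runs.loop_nil hw).of_eq ?_
    have e : update S x [] = S := by rw [← hw, update_eq_self]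
    rw [e, List.reverse_nil, List.nil_append, ← hl, update_eq_self]
  | cons s w ih =>
    intro S l hw hl
    refine ((Runs.loop_cons hw ((runs_pushWord i _ (tree s).code).seq (runs_push i .one _))
      (ih _ (s :: l) ?_ ?_)).of_eq ?_).mono ?_
    · simp [hix.symm]
    · simp [hix, hl]
      rfl
    · funext k
      by_cases hk : k = i
      · subst hk; simp
      · by_cases hx : k = x <;> simp [hk, hx, hix.symm]
    · have := treeSize_symbol_le s
      simp only [BTree.length_code, List.length_cons]
      omega

theorem runs_encodeWord {K : Type} [DecidableEq K] {i x : K} (hix : i ≠ x) (w : List Symbol) :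
    Runs (encodeWord i x) (single i w) (single i (tree w).code) (16 * w.length + 3) := by
  refine (((runs_moveRev hix _ w (single_self _ _)).seq ((runs_push i .sep _).seq
    (runs_encodeLoop hix w.reverse _ [] ?_ ?_))).of_eq ?_).mono ?_
  · simp [single, hix.symm]
  · simp [hix]
    rfl
  · funext k
    by_cases hk : k = i
    · subst hk; simp [single]
    · by_cases hx : k = x <;> simp [single, hk, hx, hix.symm]
  · simp only [List.length_reverse]
    omega

def symbolOfBool (b : Bool) : Symbol := cond b .one .sep

/-- Replace the encoding of a list of bits by the word of these bits, on another stack. -/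
def decodeBits {K : Type} (i o : K) : Prog K Symbol :=
  loop i fun
    | .one => case i fun
      | some .one => seq (case i fun _ => skip) (seq (case i fun _ => skip) (push o .one))
      | _ => push o .sep
    | _ => skip

/-- After the letter `one` of a list cell, the bit `false` reads `sep` and `true` reads `one`,
`sep`, `sep`. The bits pile up in reverse order, which the output loop of `machine` undoes. -/
theorem runs_decodeBits {K : Type} [DecidableEq K] {i o : K} (hio : i ≠ o) (l : List Bool) :
    ∀ S : K → List Symbol, S i = (tree l).code →
      Runs (decodeBits i o) S (update (update S i []) o (l.reverse.map symbolOfBool ++ S o))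
        (10 * l.length + 3) := by
  induction l with
  | nil =>
    intro S hS
    refine ((Runs.loop_cons (a := .sep) (l := []) hS (runs_skip _)
      (Runs.loop_nil (update_self _ _ _))).of_eq ?_).mono (by simp)
    funext k
    by_cases hk : k = o
    · subst hk; simp [hio.symm]
    · simp [hk]
  | cons b l ih =>
    intro S hS
    cases b
    · refine ((Runs.loop_cons (a := .one) (l := .sep :: (tree l).code) hS
        (Runs.case (.sep :: (tree l).code) (update_self _ _ _) (runs_push o .sep _))
        (ih _ ?_)).of_eq ?_).mono ?_
      · simp [hio]
      · funext k
        by_cases hk : k = o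
        · subst hk; simp [hio.symm, symbolOfBool]
        · by_cases hi : k = i <;> simp [hk, hi, hio]
      · simp only [List.length_cons]; omega
    · refine ((Runs.loop_cons (a := .one) (l := .one :: .sep :: .sep :: (tree l).code) hS
        (Runs.case (.one :: .sep :: .sep :: (tree l).code) (update_self _ _ _)
          (Runs.seq (Runs.case (.sep :: .sep :: (tree l).code) ?_ (runs_skip _))
            (Runs.seq (Runs.case (.sep :: (tree l).code) ?_ (runs_skip _)) (runs_push o .one _))))
        (ih _ ?_)).of_eq ?_).mono ?_
      · simp
      · simp
      · simp [hio]
      · funext k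
        by_cases hk : k = o
        · subst hk; simp [hio.symm, symbolOfBool]
        · by_cases hi : k = i <;> simp [hk, hi, hio]
      · simp only [List.length_cons]; omega

end Prog

instance : Fintype Symbol :=
  ⟨{.one, .sep, .and, .or, .not, .out}, fun s => by cases s <;> decide⟩

theorem treeSize_word_le (w : List Symbol) : treeSize w ≤ 12 * w.length + 1 := by
  have := treeSize_le_length_mul w 11 fun s _ => treeSize_symbol_le s
  omega

/-- Polynomial time functions on words are computed by Turing machines in polynomial time. -/
theorem PolyTime.exists_machine {f : List Symbol → List Bool} (hf : PolyTime f) :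
    ∃ (M : Turing.TM2ComputableAux Symbol Bool) (P : Polynomial ℕ),
      ∀ w, OutputsInTime M w (f w) (P.eval w.length) := by
  obtain ⟨K, _, _, p, i, o, P, h⟩ := hf
  let e : K → K ⊕ Bool := Sum.inl
  have he : Injective e := Sum.inl_injective
  refine ⟨toComputableAux (seq (encodeWord (e i) (Sum.inr false)) (seq (p.map e)
    (decodeBits (e o) (Sum.inr true)))) (e i) (Sum.inr true) (· == .one),
    16 * .X + 10 + 12 * P.comp (12 * .X + 1), fun w => ?_⟩
  have h₁ := runs_encodeWord (i := e i) (x := Sum.inr false) (by simp [e]) w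
  have h₂ := (h w).1.call_single he
  have h₃ := runs_decodeBits (i := e o) (o := Sum.inr true) (by simp [e]) (f w)
    (single (e o) (tree (f w)).code) (single_self _ _)
  rw [update_update_single, single_of_ne (by simp [e]), List.append_nil] at h₃
  obtain ⟨t, ht, hrun⟩ := h₁.seq (h₂.seq h₃)
  have hlen : (f w).length ≤ P.eval (12 * w.length + 1) :=
    ((length_lt_treeSize (f w)).le.trans (h w).2).trans
      (polynomial_eval_mono P (treeSize_word_le w))
  have htime := polynomial_eval_mono P (treeSize_word_le w)
  have key := outputsInTime_of_exec (bit := (· == .one)) hrun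
    (T := (16 * .X + 10 + 12 * P.comp (12 * .X + 1)).eval w.length) (by
      simp only [Polynomial.eval_add, Polynomial.eval_mul, Polynomial.eval_ofNat,
        Polynomial.eval_X, Polynomial.eval_comp, Polynomial.eval_one, List.length_map,
        List.length_reverse, treeSize] at *
      omega)
  convert key using 1
  rw [List.map_map, ← List.map_reverse, List.reverse_reverse]
  conv_lhs => rw [← List.map_id (f w)]
  refine List.map_congr_left fun b _ => ?_
  cases b <;> rfl

end DeMorgan

/-! ### Simplified values of nodes under a restriction -/

namespace DeMorgan

section Scan

variable {α γ : Type} (F : List α → γ → α)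

/-- The same scan computes Boolean values, simplified values and abstract values of nodes, hence the
general `F`. -/
theorem length_scan (init : List α) (gs : List γ) :
    (gs.foldl (fun vs g => vs ++ [F vs g]) init).length = init.length + gs.length := by
  induction gs generalizing init with
  | nil => rfl
  | cons g gs ih => rw [List.foldl_cons, ih]; simp; omega

theorem scan_getD_of_lt (d : α) (init : List α) (gs : List γ) {i : ℕ} (hi : i < init.length) :
    (gs.foldl (fun vs g => vs ++ [F vs g]) init).getD i d = init.getD i d := by
  induction gs generalizing init with
  | nil => rfl
  | cons g gs ih =>
    rw [List.foldl_cons, ih _ (by simp; omega)]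
    exact List.getD_append _ _ _ _ hi

/-- The list of values that the gate `k` sees. -/
def scanTo (init : List α) (gs : List γ) (k : ℕ) : List α :=
  (gs.take k).foldl (fun vs g => vs ++ [F vs g]) init

theorem length_scanTo (init : List α) (gs : List γ) {k : ℕ} (hk : k ≤ gs.length) :
    (scanTo F init gs k).length = init.length + k := by
  rw [scanTo, length_scan, List.length_take, min_eq_left hk]

theorem scanTo_getD (d : α) (init : List α) (gs : List γ) {k i : ℕ} (hk : k ≤ gs.length)
    (hi : i < init.length + k) :
    (scanTo F init gs k).getD i d = (gs.foldl (fun vs g => vs ++ [F vs g]) init).getD i d := by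
  conv_rhs => rw [← List.take_append_drop k gs, List.foldl_append]
  exact (scan_getD_of_lt F d _ _ (by
    rw [length_scanTo F init gs hk]
    exact hi)).symm

theorem scan_getD_gate (d : α) (init : List α) (gs : List γ) {k : ℕ} (hk : k < gs.length) :
    (gs.foldl (fun vs g => vs ++ [F vs g]) init).getD (init.length + k) d =
      F (scanTo F init gs k) gs[k] := by
  rw [← scanTo_getD F d init gs (k := k + 1) hk (by omega), scanTo, List.take_add_one,
    List.getElem?_eq_getElem hk, List.foldl_append]
  have e : (gs.take k).foldl (fun vs g => vs ++ [F vs g]) init = scanTo F init gs k := rfl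
  have := length_scanTo F init gs hk.le
  simp only [Option.toList_some, List.foldl_cons, List.foldl_nil, e]
  rw [List.getD_append_right _ _ _ _ (by omega), this, Nat.sub_self]
  rfl

end Scan

/-- The value of a node under a restriction: a constant, or an input variable or a gate that is not
redundant, up to negation. -/
inductive RVal where
  | const (b : Bool) : RVal
  | lit (r : ℕ) (s : Bool) : RVal

namespace RVal

/-- Add a bit. -/
def flip : RVal → Bool → RVal
  | const b, t => const (b ^^ t)
  | lit r s, t => lit r (s ^^ t)

@[simp] theorem flip_const (b t : Bool) : (const b).flip t = const (b ^^ t) := rfl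

@[simp] theorem flip_lit (r : ℕ) (s t : Bool) : (lit r s).flip t = lit r (s ^^ t) := rfl

@[simp] theorem flip_false (u : RVal) : u.flip false = u := by cases u <;> simp

@[simp] theorem flip_flip (u : RVal) (s t : Bool) : (u.flip s).flip t = u.flip (s ^^ t) := by
  cases u <;> simp

/-- The conjunction, if it is not a proper one. Equal nodes are recognized if they are among the
first `n` ones. -/
def conj (n : ℕ) : RVal → RVal → Option RVal
  | const false, _ => some (const false)
  | const true, v => some v
  | lit _ _, const false => some (const false)
  | lit r s, const true => some (lit r s)
  -- Equal gates are deliberately not merged: an abstract value does not record which gate it stands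
  -- for, so the abstract evaluation could not follow.
  | lit r s, lit r' s' =>
    if r = r' ∧ r < n then some (if s = s' then lit r s else const false) else none

theorem conj_comm (n : ℕ) (u v : RVal) : conj n u v = conj n v u := by
  rcases u with ⟨_ | _⟩ | ⟨r, s⟩ <;> rcases v with ⟨_ | _⟩ | ⟨r', s'⟩ <;> try rfl
  by_cases h : r = r' ∧ r < n
  · obtain ⟨rfl, h⟩ := h
    by_cases hs : s = s'
    · subst hs; rfl
    · simp [conj, hs, Ne.symm hs]
  · have : ¬(r' = r ∧ r' < n) := fun h' => h ⟨h'.1.symm, h'.1 ▸ h'.2⟩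
    simp [conj, h, this]

end RVal

open RVal

/-- The value of the gate at position `k` under a restriction. -/
def Gate.res (n k : ℕ) (vs : List RVal) : Gate → RVal
  | .and i j => (conj n (vs.getD i (.const false)) (vs.getD j (.const false))).getD (lit k false)
  | .or i j => ((conj n ((vs.getD i (.const false)).flip true)
      ((vs.getD j (.const false)).flip true)).map (flip · true)).getD (lit k false)
  | .not i => (vs.getD i (.const false)).flip true

namespace Circuit

variable {n : ℕ} (C : Circuit n)

/-- The values of the input variables under the restriction `ρ`. -/
def inputRVal (ρ : ℕ → Option Bool) (i : ℕ) : RVal :=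
  match ρ i with
  | some b => const b
  | none => lit i false

/-- The value of the node `k` under the restriction `ρ`. -/
def res (ρ : ℕ → Option Bool) (k : ℕ) : RVal :=
  (C.gates.foldl (fun vs g => vs ++ [g.res n vs.length vs])
    ((List.range n).map (inputRVal ρ))).getD k (const false)

/-- The value of the node `k` on the input `x`. -/
def val (x : ℕ → Bool) (k : ℕ) : Bool := (C.values fun i => x i).getD k false

/-- The node `k` is the conjunction of `i` plus `si` and `j` plus `sj`, plus `so`. -/
def IsBin (k i : ℕ) (si : Bool) (j : ℕ) (sj so : Bool) : Prop :=
  n ≤ k ∧ ((C.gates[k - n]? = some (.and i j) ∨ C.gates[k - n]? = some (.and j i)) ∧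
      si = false ∧ sj = false ∧ so = false ∨
    (C.gates[k - n]? = some (.or i j) ∨ C.gates[k - n]? = some (.or j i)) ∧
      si = true ∧ sj = true ∧ so = true)

def IsNot (k i : ℕ) : Prop := n ≤ k ∧ C.gates[k - n]? = some (.not i)

variable {C}

theorem IsBin.symm {k i j : ℕ} {si sj so : Bool} (h : C.IsBin k i si j sj so) :
    C.IsBin k j sj i si so := by
  unfold IsBin at *
  tauto

theorem IsBin.unique {k i j i' j' : ℕ} {si sj so si' sj' so' : Bool} (h : C.IsBin k i si j sj so)
    (h' : C.IsBin k i' si' j' sj' so') :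
    si' = si ∧ sj' = sj ∧ si = sj ∧ so' = so ∧ (i' = i ∧ j' = j ∨ i' = j ∧ j' = i) := by
  obtain ⟨-, ⟨h | h, rfl, rfl, rfl⟩ | ⟨h | h, rfl, rfl, rfl⟩⟩ := h <;>
  obtain ⟨-, ⟨h' | h', rfl, rfl, rfl⟩ | ⟨h' | h', rfl, rfl, rfl⟩⟩ := h' <;>
  rw [h] at h' <;> simp only [Option.some.injEq, Gate.and.injEq, Gate.or.injEq, reduceCtorEq] at h'
    <;> simp [h'.1, h'.2]

theorem gate_readsBelow {k : ℕ} {g : Gate} (hk : n ≤ k) (h : C.gates[k - n]? = some g) :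
    g.ReadsBelow k := by
  obtain ⟨hlt, rfl⟩ := List.getElem?_eq_some_iff.1 h
  have := C.gates_wf _ hlt
  rwa [show n + (k - n) = k by omega] at this

theorem IsBin.lt {k i j : ℕ} {si sj so : Bool} (h : C.IsBin k i si j sj so) : i < k ∧ j < k := by
  obtain ⟨hk, ⟨h | h, -⟩ | ⟨h | h, -⟩⟩ := h
  · exact gate_readsBelow hk h
  · exact (gate_readsBelow hk h).symm
  · exact gate_readsBelow hk h
  · exact (gate_readsBelow hk h).symm

theorem IsNot.lt {k i : ℕ} (h : C.IsNot k i) : i < k := gate_readsBelow h.1 h.2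

variable (C) in
theorem node_cases (k : ℕ) : k < n ∨ n + C.gates.length ≤ k ∨
    (∃ i si j sj so, C.IsBin k i si j sj so) ∨ ∃ i, C.IsNot k i := by
  rcases Nat.lt_or_ge k n with h | h
  · exact .inl h
  rcases Nat.lt_or_ge k (n + C.gates.length) with h' | h'
  · have hg : C.gates[k - n]? = some C.gates[k - n] :=
      List.getElem?_eq_getElem (by omega)
    rcases hk : C.gates[k - n] with ⟨i, j⟩ | ⟨i, j⟩ | i <;> rw [hk] at hg
    · exact .inr (.inr (.inl ⟨i, _, j, _, _, h, .inl ⟨.inl hg, rfl, rfl, rfl⟩⟩))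
    · exact .inr (.inr (.inl ⟨i, _, j, _, _, h, .inr ⟨.inl hg, rfl, rfl, rfl⟩⟩))
    · exact .inr (.inr (.inr ⟨i, h, hg⟩))
  · exact .inr (.inl h')

theorem res_input {ρ : ℕ → Option Bool} {i : ℕ} (hi : i < n) : C.res ρ i = inputRVal ρ i := by
  rw [res, scan_getD_of_lt _ _ _ _ (by simpa using hi), List.getD_eq_getElem?_getD]
  simp [hi]

theorem res_of_ge {ρ : ℕ → Option Bool} {k : ℕ} (hk : n + C.gates.length ≤ k) :
    C.res ρ k = const false := by
  rw [res, List.getD_eq_default]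
  rw [length_scan]
  simpa using hk

theorem res_gate (ρ : ℕ → Option Bool) {k : ℕ} {g : Gate} (hk : n ≤ k)
    (h : C.gates[k - n]? = some g) : ∃ vs : List RVal, C.res ρ k = g.res n k vs ∧
      ∀ i < k, vs.getD i (const false) = C.res ρ i := by
  obtain ⟨hlt, rfl⟩ := List.getElem?_eq_some_iff.1 h
  refine ⟨scanTo (fun vs g => g.res n vs.length vs) ((List.range n).map (inputRVal ρ)) C.gates
    (k - n), ?_, fun i hi => ?_⟩
  · have := scan_getD_gate (fun vs g => Gate.res n vs.length vs g) (const false)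
      ((List.range n).map (inputRVal ρ)) C.gates hlt
    rw [length_scanTo _ _ _ hlt.le, List.length_map, List.length_range,
      show n + (k - n) = k by omega] at this
    exact this
  · exact scanTo_getD _ _ _ _ hlt.le (by simp; omega)

theorem IsBin.res {k i j : ℕ} {si sj so : Bool} (h : C.IsBin k i si j sj so)
    (ρ : ℕ → Option Bool) : C.res ρ k =
      ((conj n ((C.res ρ i).flip si) ((C.res ρ j).flip sj)).map (RVal.flip · so)).getD
        (lit k false) := by
  obtain ⟨hi, hj⟩ := h.lt
  obtain ⟨hk, ⟨h | h, rfl, rfl, rfl⟩ | ⟨h | h, rfl, rfl, rfl⟩⟩ := h <;>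
  · obtain ⟨vs, h₁, h₂⟩ := res_gate ρ hk h
    rw [h₁, Gate.res, h₂ i hi, h₂ j hj]
    all_goals first
      | (simp; done)
      | rw [conj_comm]
    all_goals simp

theorem IsNot.res {k i : ℕ} (h : C.IsNot k i) (ρ : ℕ → Option Bool) :
    C.res ρ k = (C.res ρ i).flip true := by
  obtain ⟨vs, h₁, h₂⟩ := res_gate ρ h.1 h.2
  rw [h₁, Gate.res, h₂ i h.lt]

theorem val_input {x : ℕ → Bool} {i : ℕ} (hi : i < n) : C.val x i = x i := by
  rw [val, values, scan_getD_of_lt _ _ _ _ (by simpa using hi), List.getD_eq_getElem?_getD]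
  simp [hi]

theorem val_of_ge {x : ℕ → Bool} {k : ℕ} (hk : n + C.gates.length ≤ k) :
    C.val x k = false := by
  rw [val, values, List.getD_eq_default]
  rw [length_scan]
  simpa using hk

theorem val_gate (x : ℕ → Bool) {k : ℕ} {g : Gate} (hk : n ≤ k)
    (h : C.gates[k - n]? = some g) : ∃ vs : List Bool, C.val x k = g.eval vs ∧
      ∀ i < k, vs.getD i false = C.val x i := by
  obtain ⟨hlt, rfl⟩ := List.getElem?_eq_some_iff.1 h
  refine ⟨scanTo (fun vs g => g.eval vs) (List.ofFn fun i : Fin n => x i) C.gates (k - n), ?_,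
    fun i hi => ?_⟩
  · have := scan_getD_gate (fun vs g => Gate.eval vs g) false
      (List.ofFn fun i : Fin n => x i) C.gates hlt
    rw [List.length_ofFn, show n + (k - n) = k by omega] at this
    exact this
  · exact scanTo_getD _ _ _ _ hlt.le (by simp; omega)

theorem IsBin.val {k i j : ℕ} {si sj so : Bool} (h : C.IsBin k i si j sj so) (x : ℕ → Bool) :
    C.val x k = (((C.val x i ^^ si) && (C.val x j ^^ sj)) ^^ so) := by
  obtain ⟨hi, hj⟩ := h.lt
  obtain ⟨hk, ⟨h | h, rfl, rfl, rfl⟩ | ⟨h | h, rfl, rfl, rfl⟩⟩ := h <;>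
  · obtain ⟨vs, h₁, h₂⟩ := val_gate x hk h
    rw [h₁, Gate.eval, h₂ i hi, h₂ j hj]
    cases C.val x i <;> cases C.val x j <;> rfl

theorem IsNot.val {k i : ℕ} (h : C.IsNot k i) (x : ℕ → Bool) : C.val x k = !C.val x i := by
  obtain ⟨vs, h₁, h₂⟩ := val_gate x h.1 h.2
  rw [h₁, Gate.eval, h₂ i h.lt]

/-- Under the restriction `ρ`, the gate `k` is a proper conjunction, of `r` plus `s` and `r'` plus
`s'`, plus `so`. -/
def Bin (C : Circuit n) (ρ : ℕ → Option Bool) (k r : ℕ) (s : Bool) (r' : ℕ) (s' so : Bool) :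
    Prop :=
  ∃ i si j sj, C.IsBin k i si j sj so ∧ (C.res ρ i).flip si = lit r s ∧
    (C.res ρ j).flip sj = lit r' s' ∧ ¬(r = r' ∧ r < n)

variable {ρ : ℕ → Option Bool}

theorem Bin.symm {k r r' : ℕ} {s s' so : Bool} (h : C.Bin ρ k r s r' s' so) :
    C.Bin ρ k r' s' r s so :=
  let ⟨i, si, j, sj, h, h₁, h₂, h₃⟩ := h
  ⟨j, sj, i, si, h.symm, h₂, h₁, fun h => h₃ ⟨h.1.symm, h.1 ▸ h.2⟩⟩

theorem Bin.unique {k r r' q q' : ℕ} {s s' so t t' u : Bool} (h : C.Bin ρ k r s r' s' so)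
    (h' : C.Bin ρ k q t q' t' u) : u = so ∧
      (q = r ∧ t = s ∧ q' = r' ∧ t' = s' ∨ q = r' ∧ t = s' ∧ q' = r ∧ t' = s) := by
  obtain ⟨i, si, j, sj, h, h₁, h₂, -⟩ := h
  obtain ⟨i', si', j', sj', h', h₁', h₂', -⟩ := h'
  obtain ⟨rfl, rfl, rfl, rfl, he⟩ := h.unique h'
  rcases he with ⟨rfl, rfl⟩ | ⟨rfl, rfl⟩
  · rw [h₁] at h₁'
    rw [h₂] at h₂'
    cases h₁'
    cases h₂'
    simp
  · rw [h₂] at h₁'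
    rw [h₁] at h₂'
    cases h₁'
    cases h₂'
    simp

theorem Bin.ge {k r r' : ℕ} {s s' so : Bool} (h : C.Bin ρ k r s r' s' so) : n ≤ k :=
  let ⟨_, _, _, _, h, _⟩ := h
  h.1

theorem Bin.lt_length {k r r' : ℕ} {s s' so : Bool} (h : C.Bin ρ k r s r' s' so) :
    k < n + C.gates.length := by
  obtain ⟨i, si, j, sj, ⟨hk, ⟨h | h, -⟩ | ⟨h | h, -⟩⟩, -⟩ := h <;>
  · have := (List.getElem?_eq_some_iff.1 h).1
    omega

theorem conj_eq_lit {u v : RVal} {q : ℕ} {t : Bool} (h : conj n u v = some (lit q t)) :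
    u = lit q t ∨ v = lit q t := by
  rcases u with ⟨_ | _⟩ | ⟨r, s⟩ <;> rcases v with ⟨_ | _⟩ | ⟨r', s'⟩ <;>
    simp only [conj, Option.some.injEq, reduceCtorEq] at h
  · exact .inr h
  · exact .inl h
  · split_ifs at h with h₁ h₂
    · exact .inl (Option.some.inj h)
    · simp at h

theorem conj_eq_none {u v : RVal} (h : conj n u v = none) :
    ∃ r s r' s', u = lit r s ∧ v = lit r' s' ∧ ¬(r = r' ∧ r < n) := by
  rcases u with ⟨_ | _⟩ | ⟨r, s⟩ <;> rcases v with ⟨_ | _⟩ | ⟨r', s'⟩ <;>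
    simp only [conj, reduceCtorEq] at h
  split_ifs at h with h₁
  exact ⟨r, s, r', s', rfl, rfl, h₁⟩

/-- A literal names a representative: simplification descends through the circuit and stops only at
a free variable or at a proper gate. -/
theorem res_lit {k r : ℕ} {s : Bool} (h : C.res ρ k = lit r s) :
    r ≤ k ∧ C.res ρ r = lit r false ∧ (r < n ∧ ρ r = none ∨
      ∃ q t q' t' so, C.Bin ρ r q t q' t' so) := by
  induction k using Nat.strong_induction_on generalizing r s with
  | _ k ih =>
    rcases C.node_cases k with hk | hk | ⟨i, si, j, sj, so, hk⟩ | ⟨i, hk⟩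
    · have h' := h
      rw [res_input hk, inputRVal] at h'
      rcases hρ : ρ k with _ | b <;> rw [hρ] at h'
      · cases h'
        exact ⟨le_rfl, h, .inl ⟨hk, hρ⟩⟩
      · cases h'
    · rw [res_of_ge hk] at h
      cases h
    · have hres := hk.res ρ
      rw [h] at hres
      rcases hc : conj n ((C.res ρ i).flip si) ((C.res ρ j).flip sj) with _ | w <;> rw [hc] at hres
      · cases hres
        obtain ⟨q, t, q', t', h₁, h₂, h₃⟩ := conj_eq_none hc
        exact ⟨le_rfl, h, .inr ⟨q, t, q', t', so, i, si, j, sj, hk, h₁, h₂, h₃⟩⟩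
      · have hw : w = lit r (s ^^ so) := by
          rcases w with b | ⟨q, t⟩
          · cases hres
          · cases hres
            simp
        rw [hw] at hc
        rcases conj_eq_lit hc with h₁ | h₁
        · rcases hi : C.res ρ i with b | ⟨q, t⟩ <;> rw [hi] at h₁ <;>
            simp only [flip_const, flip_lit, lit.injEq, reduceCtorEq] at h₁
          obtain ⟨rfl, -⟩ := h₁
          have := ih i hk.lt.1 hi
          exact ⟨this.1.trans hk.lt.1.le, this.2⟩
        · rcases hi : C.res ρ j with b | ⟨q, t⟩ <;> rw [hi] at h₁ <;>
            simp only [flip_const, flip_lit, lit.injEq, reduceCtorEq] at h₁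
          obtain ⟨rfl, -⟩ := h₁
          have := ih j hk.lt.2 hi
          exact ⟨this.1.trans hk.lt.2.le, this.2⟩
    · rw [hk.res] at h
      rcases hi : C.res ρ i with b | ⟨q, t⟩ <;> rw [hi] at h <;> cases h
      have := ih i hk.lt hi
      exact ⟨this.1.trans hk.lt.le, this.2⟩

theorem Bin.left {k r r' : ℕ} {s s' so : Bool} (h : C.Bin ρ k r s r' s' so) :
    r < k ∧ C.res ρ r = lit r false := by
  obtain ⟨i, si, j, sj, h, h₁, -⟩ := h
  rcases hi : C.res ρ i with b | ⟨q, t⟩ <;> rw [hi] at h₁ <;> cases h₁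
  have := res_lit hi
  exact ⟨this.1.trans_lt h.lt.1, this.2.1⟩

/-- The input agrees with the restriction. -/
def Agrees (n : ℕ) (ρ : ℕ → Option Bool) (x : ℕ → Bool) : Prop := ∀ i < n, ∀ b, ρ i = some b → x i = b

/-- The value on an input. -/
def evalRVal (C : Circuit n) (x : ℕ → Bool) : RVal → Bool
  | const b => b
  | lit r s => C.val x r ^^ s

theorem evalRVal_flip (x : ℕ → Bool) (u : RVal) (s : Bool) :
    C.evalRVal x (u.flip s) = (C.evalRVal x u ^^ s) := by
  cases u <;> simp [evalRVal]

theorem evalRVal_conj (x : ℕ → Bool) {u v w : RVal} (h : conj n u v = some w) :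
    C.evalRVal x w = (C.evalRVal x u && C.evalRVal x v) := by
  rcases u with ⟨_ | _⟩ | ⟨r, s⟩ <;> rcases v with ⟨_ | _⟩ | ⟨r', s'⟩ <;>
    simp only [conj, Option.some.injEq] at h
  any_goals subst h; simp [evalRVal]
  split_ifs at h with h₁ h₂
  · cases h
    simp [evalRVal, h₁, h₂]
  · cases h
    rw [h₁.1]
    simp only [evalRVal]
    cases C.val x r' <;> cases s <;> cases s' <;> simp at h₂ ⊢

theorem val_eq {x : ℕ → Bool} (hx : Agrees n ρ x) (k : ℕ) :
    C.val x k = C.evalRVal x (C.res ρ k) := by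
  induction k using Nat.strong_induction_on with
  | _ k ih =>
    rcases C.node_cases k with hk | hk | ⟨i, si, j, sj, so, hk⟩ | ⟨i, hk⟩
    · rw [res_input hk, inputRVal]
      rcases hρ : ρ k with _ | b
      · simp [evalRVal]
      · rw [val_input hk, hx k hk b hρ, evalRVal]
    · rw [res_of_ge hk, val_of_ge hk, evalRVal]
    · rw [hk.res ρ]
      rcases hc : conj n ((C.res ρ i).flip si) ((C.res ρ j).flip sj) with _ | w
      · simp [evalRVal]
      · rw [Option.map_some, Option.getD_some, evalRVal_flip, evalRVal_conj x hc, evalRVal_flip,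
          evalRVal_flip, hk.val, ih i hk.lt.1, ih j hk.lt.2]
    · rw [hk.res, hk.val, evalRVal_flip, ih i hk.lt, Bool.xor_true]

theorem Bin.val {x : ℕ → Bool} (hx : Agrees n ρ x) {k r r' : ℕ} {s s' so : Bool}
    (h : C.Bin ρ k r s r' s' so) :
    C.val x k = (((C.val x r ^^ s) && (C.val x r' ^^ s')) ^^ so) := by
  obtain ⟨i, si, j, sj, h, h₁, h₂, -⟩ := h
  rw [h.val, val_eq hx i, val_eq hx j, ← evalRVal_flip, ← evalRVal_flip, h₁, h₂]
  rfl

/-- The restriction `ρ'` extends `ρ`. -/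
def Extends (ρ' ρ : ℕ → Option Bool) : Prop := ∀ i b, ρ i = some b → ρ' i = some b

/-- Substitution of the values under a restriction. -/
def subst (C : Circuit n) (ρ' : ℕ → Option Bool) : RVal → RVal
  | const b => const b
  | lit r s => (C.res ρ' r).flip s

theorem subst_flip (ρ' : ℕ → Option Bool) (u : RVal) (s : Bool) :
    C.subst ρ' (u.flip s) = (C.subst ρ' u).flip s := by
  cases u <;> simp [subst]

/-- A simplification that has been made stays valid when more variables are fixed, because
equalities are recognized between variables only. This is what makes restricting in stages
consistent (`res_extends`). -/
theorem subst_conj (ρ' : ℕ → Option Bool) {u v w : RVal} (h : conj n u v = some w) :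
    conj n (C.subst ρ' u) (C.subst ρ' v) = some (C.subst ρ' w) := by
  rcases u with ⟨_ | _⟩ | ⟨r, s⟩ <;> rcases v with ⟨_ | _⟩ | ⟨r', s'⟩ <;>
    simp only [conj, Option.some.injEq] at h
  any_goals subst h; simp [subst, conj]
  · rcases C.res ρ' r with ⟨_ | _⟩ | ⟨q, t⟩ <;> cases s <;> rfl
  · rcases C.res ρ' r with ⟨_ | _⟩ | ⟨q, t⟩ <;> cases s <;> rfl
  by_cases h₁ : r = r' ∧ r < n
  · rw [if_pos h₁, Option.some.injEq] at h
    subst h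
    obtain ⟨rfl, h₁⟩ := h₁
    have hr : C.res ρ' r = inputRVal ρ' r := res_input h₁
    by_cases hs : s = s'
    · subst hs
      simp only [subst, hr, inputRVal, if_true]
      rcases ρ' r with _ | b
      · simp [conj, h₁]
      · cases s <;> cases b <;> rfl
    · simp only [subst, hr, inputRVal, if_neg hs]
      rcases ρ' r with _ | b
      · simp [conj, h₁, hs]
      · cases s <;> cases s' <;> cases b <;> simp at hs <;> rfl
  · simp [h₁] at h

theorem res_extends {ρ' : ℕ → Option Bool} (hρ : Extends ρ' ρ) (k : ℕ) :
    C.res ρ' k = C.subst ρ' (C.res ρ k) := by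
  induction k using Nat.strong_induction_on with
  | _ k ih =>
    rcases C.node_cases k with hk | hk | ⟨i, si, j, sj, so, hk⟩ | ⟨i, hk⟩
    · rw [res_input (ρ := ρ) hk, inputRVal]
      rcases h : ρ k with _ | b
      · simp [subst]
      · rw [res_input hk, inputRVal, hρ k b h, subst]
    · rw [res_of_ge hk, res_of_ge hk, subst]
    · rw [hk.res ρ]
      rcases hc : conj n ((C.res ρ i).flip si) ((C.res ρ j).flip sj) with _ | w
      · simp [subst]
      · have := subst_conj (C := C) ρ' hc
        rw [subst_flip, subst_flip, ← ih i hk.lt.1, ← ih j hk.lt.2] at this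
        rw [hk.res ρ', this, Option.map_some, Option.getD_some, Option.map_some, Option.getD_some,
          subst_flip]
    · rw [hk.res, hk.res, subst_flip, ih i hk.lt]

theorem Bin.res {ρ' : ℕ → Option Bool} (hρ : Extends ρ' ρ) {k r r' : ℕ} {s s' so : Bool}
    (h : C.Bin ρ k r s r' s' so) : C.res ρ' k =
      ((conj n ((C.res ρ' r).flip s) ((C.res ρ' r').flip s')).map (RVal.flip · so)).getD
        (lit k false) := by
  obtain ⟨i, si, j, sj, h, h₁, h₂, -⟩ := h
  rw [h.res, res_extends hρ i, res_extends hρ j, ← subst_flip, ← subst_flip, h₁, h₂]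
  rfl

end Circuit

end DeMorgan

/-! ### Live nodes and their readers -/

namespace DeMorgan

open RVal

open Function (update update_self update_of_ne update_eq_self iterate_succ_apply)

namespace Circuit

variable {n : ℕ} {C : Circuit n} {ρ ρ' : ℕ → Option Bool}

/-- The gate `k` is proper and reads `r`. -/
def Reads (C : Circuit n) (ρ : ℕ → Option Bool) (k r : ℕ) : Prop :=
  ∃ s r' s' so, C.Bin ρ k r s r' s' so

/-- The nodes that are reachable from the output, under the restriction `ρ`. -/
inductive Live (C : Circuit n) (ρ : ℕ → Option Bool) : ℕ → Prop
  | out {r s} : C.res ρ C.out = lit r s → Live C ρ r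
  | step {k r} : Live C ρ k → C.Reads ρ k r → Live C ρ r

theorem Live.res_self {r : ℕ} (h : C.Live ρ r) : C.res ρ r = lit r false := by
  rcases h with h | ⟨-, _, _, _, _, h⟩
  · exact (res_lit h).2.1
  · exact h.left.2

theorem Live.eq_out_or {r : ℕ} (h : C.Live ρ r) :
    (∃ s, C.res ρ C.out = lit r s) ∨ ∃ k, C.Live ρ k ∧ C.Reads ρ k r := by
  rcases h with h | ⟨h₁, h₂⟩
  · exact .inl ⟨_, h⟩
  · exact .inr ⟨_, h₁, h₂⟩

theorem Live.exists_bin {k : ℕ} (h : C.Live ρ k) (hk : n ≤ k) :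
    ∃ r s r' s' so, C.Bin ρ k r s r' s' so := by
  rcases (res_lit h.res_self).2.2 with ⟨h, -⟩ | h
  · omega
  · exact h

theorem eq_none_of_res_self {i : ℕ} (hi : i < n) (h : C.res ρ i = lit i false) : ρ i = none := by
  rw [res_input hi, inputRVal] at h
  rcases hρ : ρ i with _ | b
  · rfl
  · rw [hρ] at h
    cases h

theorem Reads.lt {k r : ℕ} (h : C.Reads ρ k r) : r < k :=
  let ⟨_, _, _, _, h⟩ := h
  h.left.1

theorem Reads.ge {k r : ℕ} (h : C.Reads ρ k r) : n ≤ k :=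
  let ⟨_, _, _, _, h⟩ := h
  h.ge

theorem Bin.reads {k r r' : ℕ} {s s' so : Bool} (h : C.Bin ρ k r s r' s' so) : C.Reads ρ k r :=
  ⟨_, _, _, _, h⟩

theorem Bin.eq_or_of_reads {k r r' q : ℕ} {s s' so : Bool} (h : C.Bin ρ k r s r' s' so)
    (hq : C.Reads ρ k q) : q = r ∨ q = r' := by
  obtain ⟨_, _, _, _, hq⟩ := hq
  rcases (h.unique hq).2 with h | h
  · exact .inl h.1
  · exact .inr h.1

theorem Reads.bin {k q q' : ℕ} (hq : C.Reads ρ k q) (hq' : C.Reads ρ k q') (hne : q ≠ q') :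
    ∃ s s' so, C.Bin ρ k q s q' s' so := by
  obtain ⟨s, r', s', so, h⟩ := hq
  rcases h.eq_or_of_reads hq' with rfl | rfl
  · exact absurd rfl hne
  · exact ⟨_, _, _, h⟩

/-! ### Extending a restriction -/

theorem Bin.of_extends (hρ : Extends ρ' ρ) {k q q' : ℕ} {t t' u : Bool}
    (h : C.Bin ρ' k q t q' t' u) : ∃ r s r' s', C.Bin ρ k r s r' s' u ∧
      (C.res ρ' r).flip s = lit q t ∧ (C.res ρ' r').flip s' = lit q' t' := by
  obtain ⟨i, si, j, sj, h, h₁, h₂, h₃⟩ := h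
  rw [res_extends hρ, ← subst_flip] at h₁ h₂
  rcases hi : (C.res ρ i).flip si with b | ⟨r, s⟩ <;> rw [hi] at h₁
  · cases h₁
  rcases hj : (C.res ρ j).flip sj with b | ⟨r', s'⟩ <;> rw [hj] at h₂
  · cases h₂
  refine ⟨r, s, r', s', ⟨i, si, j, sj, h, hi, hj, ?_⟩, h₁, h₂⟩
  rintro ⟨rfl, hr⟩
  rw [subst, res_input hr, inputRVal] at h₁ h₂
  rcases hρ : ρ' r with _ | b <;> rw [hρ] at h₁ h₂
  · simp only [flip_lit, lit.injEq] at h₁ h₂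
    exact h₃ ⟨h₁.1.symm.trans h₂.1, h₁.1 ▸ hr⟩
  · cases h₁

theorem exists_lit_of_flip {u : RVal} {q : ℕ} {s t : Bool} (h : u.flip s = lit q t) :
    u = lit q (t ^^ s) := by
  rcases u with b | ⟨r, t'⟩ <;> cases h
  simp

theorem Bin.res_lit (hρ : Extends ρ' ρ) {k r r' q : ℕ} {s s' so t : Bool}
    (h : C.Bin ρ k r s r' s' so) (hq : C.res ρ' k = lit q t) :
    q = k ∨ (∃ t', C.res ρ' r = lit q t') ∨ ∃ t', C.res ρ' r' = lit q t' := by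
  rw [h.res hρ] at hq
  rcases hc : conj n ((C.res ρ' r).flip s) ((C.res ρ' r').flip s') with _ | w <;> rw [hc] at hq
  · cases hq
    exact .inl rfl
  · have := exists_lit_of_flip (s := so) hq
    subst this
    rcases conj_eq_lit hc with h | h
    · exact .inr (.inl ⟨_, exists_lit_of_flip h⟩)
    · exact .inr (.inr ⟨_, exists_lit_of_flip h⟩)

/-- The sign `s` recorded by `Bin` is the value of `r` that makes the conjunction false; the
opposite value makes the gate transparent (`Bin.res_pass`). -/
theorem Bin.res_kill (hρ : Extends ρ' ρ) {k r r' : ℕ} {s s' so : Bool}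
    (h : C.Bin ρ k r s r' s' so) (hr : C.res ρ' r = const s) : C.res ρ' k = const so := by
  rw [h.res hρ, hr]
  cases s <;> simp [conj]

theorem Bin.res_pass (hρ : Extends ρ' ρ) {k r r' : ℕ} {s s' so : Bool}
    (h : C.Bin ρ k r s r' s' so) (hr : C.res ρ' r = const (!s)) :
    C.res ρ' k = (C.res ρ' r').flip (s' ^^ so) := by
  rw [h.res hρ, hr]
  cases s <;> simp [conj]

theorem Bin.res_const (hρ : Extends ρ' ρ) {k r r' : ℕ} {s s' so : Bool}
    (h : C.Bin ρ k r s r' s' so) {b b' : Bool} (hr : C.res ρ' r = const b)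
    (hr' : C.res ρ' r' = const b') : ∃ b, C.res ρ' k = const b := by
  by_cases hb : b = s
  · exact ⟨_, h.res_kill hρ (hb ▸ hr)⟩
  · have hb : b = !s := by cases b <;> cases s <;> simp at hb ⊢
    rw [h.res_pass hρ (hb ▸ hr), hr']
    exact ⟨_, rfl⟩

/-- With a constant input a gate becomes constant or a copy of its other input, whose representative
has a smaller index. It is then no longer its own representative, so it is eliminated. -/
theorem Bin.res_ne_self (hρ : Extends ρ' ρ) {k r r' : ℕ} {s s' so : Bool}
    (h : C.Bin ρ k r s r' s' so) {b : Bool} (hr : C.res ρ' r = const b) :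
    C.res ρ' k ≠ lit k false := by
  by_cases hb : b = s
  · rw [h.res_kill hρ (hb ▸ hr)]
    simp
  · have hb : b = !s := by cases b <;> cases s <;> simp at hb ⊢
    rw [h.res_pass hρ (hb ▸ hr)]
    intro hk
    have h₁ := Circuit.res_lit (exists_lit_of_flip hk)
    have h₂ := h.symm.left.1
    omega

/-- If `r` turns into a literal of another node `q`, some input of `r` carries the same literal.
Descending along such inputs ends at a gate that reads `q` itself and has become a copy of it. -/
theorem Live.pass (hρ : Extends ρ' ρ) {r q : ℕ} {t : Bool} (h : C.Live ρ r)
    (hq : C.res ρ' r = lit q t) :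
    r = q ∨ ∃ k ≤ r, C.Live ρ k ∧ C.Reads ρ k q ∧ ∃ t', C.res ρ' k = lit q t' := by
  induction r using Nat.strong_induction_on generalizing t with
  | _ r ih =>
    rcases Nat.lt_or_ge r n with hr | hr
    · rw [res_input hr, inputRVal] at hq
      rcases hρ : ρ' r with _ | b <;> rw [hρ] at hq <;> cases hq
      exact .inl rfl
    · obtain ⟨r₁, s₁, r₂, s₂, so, hb⟩ := h.exists_bin hr
      have key : ∀ r₁ s₁ r₂ s₂, C.Bin ρ r r₁ s₁ r₂ s₂ so → (∃ t', C.res ρ' r₁ = lit q t') →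
          ∃ k ≤ r, C.Live ρ k ∧ C.Reads ρ k q ∧ ∃ t', C.res ρ' k = lit q t' := by
        rintro r₁ s₁ r₂ s₂ hb ⟨t', ht'⟩
        rcases ih r₁ hb.left.1 (h.step hb.reads) ht' with rfl | ⟨k, hk, hk'⟩
        · exact ⟨r, le_rfl, h, hb.reads, t, hq⟩
        · exact ⟨k, hk.trans hb.left.1.le, hk'⟩
      rcases hb.res_lit hρ hq with rfl | hq' | hq'
      · exact .inl rfl
      · exact .inr (key _ _ _ _ hb hq')
      · exact .inr (key _ _ _ _ hb.symm hq')

theorem Live.of_res (hρ : Extends ρ' ρ) {r q : ℕ} {t : Bool} (h : C.Live ρ r)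
    (hq : C.res ρ' r = lit q t) : C.Live ρ q := by
  rcases h.pass hρ hq with rfl | ⟨k, -, hk, hr, -⟩
  · exact h
  · exact hk.step hr

/-- An edge of the more restricted circuit comes from an edge of the old one followed by a chain of
transparent gates. Live sets therefore only shrink, and counting eliminated gates makes sense. -/
theorem Live.mono (hρ : Extends ρ' ρ) {r : ℕ} (h : C.Live ρ' r) : C.Live ρ r := by
  induction h with
  | @out r s h =>
    rw [res_extends hρ] at h
    rcases ho : C.res ρ C.out with b | ⟨q, t⟩ <;> rw [ho] at h
    · cases h
    · exact (Live.out ho).of_res hρ (exists_lit_of_flip h)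
  | step hk hr ih =>
    obtain ⟨_, _, _, _, hr⟩ := hr
    obtain ⟨q, s, q', s', hb, h₁, -⟩ := hr.of_extends hρ
    exact (ih.step hb.reads).of_res hρ (exists_lit_of_flip h₁)

/-! ### The number of live gates -/

open Classical in
/-- The gates that are reachable from the output. -/
noncomputable def liveGates (C : Circuit n) (ρ : ℕ → Option Bool) : Finset ℕ :=
  (Finset.range (n + C.gates.length)).filter fun k => n ≤ k ∧ C.Live ρ k

theorem mem_liveGates {k : ℕ} : k ∈ C.liveGates ρ ↔ n ≤ k ∧ C.Live ρ k := by
  classical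
  rw [liveGates, Finset.mem_filter, Finset.mem_range, and_iff_right_iff_imp]
  rintro ⟨hk, h⟩
  obtain ⟨_, _, _, _, _, h⟩ := h.exists_bin hk
  exact h.lt_length

open Classical in
/-- The live gates that read `r`. -/
noncomputable def readers (C : Circuit n) (ρ : ℕ → Option Bool) (r : ℕ) : Finset ℕ :=
  (C.liveGates ρ).filter fun k => C.Reads ρ k r

theorem mem_readers {k r : ℕ} : k ∈ C.readers ρ r ↔ C.Live ρ k ∧ C.Reads ρ k r := by
  classical
  rw [readers, Finset.mem_filter, mem_liveGates]
  exact ⟨fun h => ⟨h.1.2, h.2⟩, fun h => ⟨⟨h.2.ge, h.1⟩, h.2⟩⟩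

theorem card_liveGates_add_le (hρ : Extends ρ' ρ) (S : Finset ℕ)
    (hS : ∀ k ∈ S, n ≤ k ∧ C.Live ρ k ∧ ¬C.Live ρ' k) :
    (C.liveGates ρ').card + S.card ≤ (C.liveGates ρ).card := by
  rw [← Finset.card_union_of_disjoint]
  · refine Finset.card_le_card fun k hk => ?_
    rw [Finset.mem_union, mem_liveGates] at hk
    rw [mem_liveGates]
    rcases hk with ⟨hk, h⟩ | hk
    · exact ⟨hk, h.mono hρ⟩
    · exact ⟨(hS k hk).1, (hS k hk).2.1⟩
  · rw [Finset.disjoint_left]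
    exact fun k hk hk' => (hS k hk').2.2 (mem_liveGates.1 hk).2

/-- Fix one variable. -/
def fix (ρ : ℕ → Option Bool) (i : ℕ) (c : Bool) : ℕ → Option Bool := update ρ i (some c)

theorem extends_fix {i : ℕ} (hi : ρ i = none) (c : Bool) : Extends (fix ρ i c) ρ := by
  intro j b hj
  rw [fix, update_of_ne (by rintro rfl; simp [hi] at hj)]
  exact hj

theorem res_fix {i : ℕ} (hi : i < n) (c : Bool) : C.res (fix ρ i c) i = const c := by
  rw [res_input hi, inputRVal, fix, update_self]

/-- The number of variables that are not fixed. -/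
def freeCount (n : ℕ) (ρ : ℕ → Option Bool) : ℕ :=
  ((Finset.range n).filter fun i => ρ i = none).card

theorem freeCount_fix {i : ℕ} (hi : i < n) (h : ρ i = none) (c : Bool) :
    freeCount n (fix ρ i c) + 1 = freeCount n ρ := by
  rw [freeCount, freeCount, ← Finset.card_erase_add_one (a := i)
    (s := (Finset.range n).filter fun i => ρ i = none) (by simp [hi, h])]
  congr 2
  ext j
  by_cases hj : j = i
  · subst hj
    rw [Finset.mem_filter]
    simp [fix]
  · rw [Finset.mem_filter, Finset.mem_erase, Finset.mem_filter]
    simp [fix, hj]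

theorem exists_free (h : 0 < freeCount n ρ) : ∃ j < n, ρ j = none := by
  obtain ⟨j, hj⟩ := Finset.card_pos.1 h
  exact ⟨j, by simpa using hj⟩

theorem exists_free_ne (h : 2 ≤ freeCount n ρ) (i : ℕ) : ∃ j < n, j ≠ i ∧ ρ j = none := by
  obtain ⟨j, hj, hji⟩ := Finset.exists_mem_ne h i
  simp only [Finset.mem_filter, Finset.mem_range] at hj
  exact ⟨j, hj.1, hji, hj.2⟩

/-! ### Test points -/

variable (C) in
/-- The circuit errs on the input `x`. -/
def Errs (b : Bool) (x : ℕ → Bool) : Prop :=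
  C.eval (fun i => x i) ≠ xorFn n b fun i => x i

def zeroFill (ρ : ℕ → Option Bool) (i : ℕ) : Bool := (ρ i).getD false

variable (C) in
/-- The circuit errs on some input that differs in at most three bits from the restriction,
completed by zeros. -/
def Good (b : Bool) (ρ : ℕ → Option Bool) : Prop :=
  ∃ i < n, ∃ c, ∃ i' < n, ∃ c', ∃ j < n, ∃ d,
    C.Errs b (update (update (update (zeroFill ρ) i c) i' c') j d)

theorem xorFn_update (b : Bool) (x : ℕ → Bool) {j : ℕ} (hj : j < n) :
    xorFn n b (fun i => update x j true i) = !xorFn n b fun i => update x j false i := by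
  have h : ∀ d, ∑ i : Fin n, (update x j d i).toNat =
      d.toNat + ∑ i ∈ Finset.univ.erase (⟨j, hj⟩ : Fin n), (x i).toNat := by
    intro d
    rw [← Finset.add_sum_erase _ _ (Finset.mem_univ (⟨j, hj⟩ : Fin n))]
    congr 1
    · simp
    · refine Finset.sum_congr rfl fun i hi => ?_
      rw [update_of_ne]
      intro h
      exact (Finset.ne_of_mem_erase hi) (Fin.ext h)
  simp only [xorFn, h]
  rw [Bool.eq_not_iff, Ne, Bool.eq_iff_iff]
  simp only [decide_eq_true_eq, Bool.toNat_true, Bool.toNat_false, Nat.odd_iff]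
  omega

variable {b : Bool}

/-- The input differs in at most two bits from the restriction. -/
def Near (n : ℕ) (ρ : ℕ → Option Bool) (x : ℕ → Bool) : Prop :=
  ∃ i < n, ∃ c, ∃ i' < n, ∃ c', x = update (update (zeroFill ρ) i c) i' c'

theorem near_two {i i' : ℕ} (hi : i < n) (hi' : i' < n) (c c' : Bool) :
    Near n ρ (update (update (zeroFill ρ) i c) i' c') := ⟨i, hi, c, i', hi', c', rfl⟩

theorem near_one {i : ℕ} (hi : i < n) (c : Bool) : Near n ρ (update (zeroFill ρ) i c) :=
  ⟨i, hi, c, i, hi, c, by simp⟩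

theorem near_zero {i : ℕ} (hi : i < n) : Near n ρ (zeroFill ρ) :=
  ⟨i, hi, _, i, hi, _, by rw [update_eq_self, update_eq_self]⟩

theorem good_of_errs {x : ℕ → Bool} (hx : Near n ρ x) {j : ℕ} (hj : j < n) {d : Bool}
    (h : C.Errs b (update x j d)) : C.Good b ρ := by
  obtain ⟨i, hi, c, i', hi', c', rfl⟩ := hx
  exact ⟨i, hi, c, i', hi', c', j, hj, d, h⟩

/-- The parity changes with the bit `j` while the output does not, so one of the two inputs is an
error. Every failure except that of `good_of_freeCount_eq_one` arises in this way. -/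
theorem good_of_eq {x : ℕ → Bool} (hx : Near n ρ x) {j : ℕ} (hj : j < n)
    (h : C.val (update x j true) C.out = C.val (update x j false) C.out) : C.Good b ρ := by
  by_contra hg
  have h₁ : ¬C.Errs b (update x j true) := fun h' => hg (good_of_errs hx hj h')
  have h₂ : ¬C.Errs b (update x j false) := fun h' => hg (good_of_errs hx hj h')
  rw [Errs, not_not] at h₁ h₂
  have h₃ := xorFn_update b x hj
  rw [← h₁, ← h₂] at h₃
  change C.val _ _ = !C.val _ _ at h₃
  rw [h] at h₃
  simp at h₃

theorem agrees_zeroFill : Agrees n ρ (zeroFill ρ) := by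
  intro i _ b hi
  rw [zeroFill, hi]
  rfl

theorem Agrees.update {x : ℕ → Bool} (hx : Agrees n ρ x) {i : ℕ} (hi : ρ i = none) (c : Bool) :
    Agrees n ρ (update x i c) := by
  intro j hj b hb
  rw [update_of_ne (by rintro rfl; simp [hi] at hb)]
  exact hx j hj b hb

theorem Agrees.fix {x : ℕ → Bool} (hx : Agrees n ρ x) {i : ℕ} {c : Bool} (hi : x i = c) :
    Agrees n (fix ρ i c) x := by
  intro j hj b hb
  by_cases h : j = i
  · subst h
    simp only [Circuit.fix, update_self, Option.some.injEq] at hb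
    rw [hi, hb]
  · rw [Circuit.fix, update_of_ne h] at hb
    exact hx j hj b hb

/-- Two inputs give the same output, if the nodes where the values differ are shielded. -/
theorem val_out_eq {x x' : ℕ → Bool} (hx : Agrees n ρ x) (hx' : Agrees n ρ x') (S : ℕ → Prop)
    (h₁ : ∀ v < n, ¬S v → x v = x' v)
    (h₂ : ∀ k r, C.Live ρ k → ¬S k → S r → C.Reads ρ k r → C.val x k = C.val x' k)
    (h₃ : ∀ r s, C.res ρ C.out = lit r s → ¬S r) : C.val x C.out = C.val x' C.out := by
  have key : ∀ k, C.Live ρ k → ¬S k → C.val x k = C.val x' k := by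
    intro k
    induction k using Nat.strong_induction_on with
    | _ k ih =>
      intro hk hS
      rcases Nat.lt_or_ge k n with hn | hn
      · rw [val_input hn, val_input hn]
        exact h₁ k hn hS
      · obtain ⟨r, s, r', s', so, hb⟩ := hk.exists_bin hn
        by_cases hr : S r
        · exact h₂ k r hk hS hr hb.reads
        by_cases hr' : S r'
        · exact h₂ k r' hk hS hr' hb.symm.reads
        rw [hb.val hx, hb.val hx', ih r hb.left.1 (hk.step hb.reads) hr,
          ih r' hb.symm.left.1 (hk.step hb.symm.reads) hr']
  rw [val_eq hx, val_eq hx']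
  rcases h : C.res ρ C.out with b | ⟨r, s⟩
  · rfl
  · rw [evalRVal, evalRVal, key r (.out h) (h₃ r s h)]

theorem val_of_res_const {x : ℕ → Bool} (hx : Agrees n ρ x) {k : ℕ} {c : Bool}
    (h : C.res ρ k = const c) : C.val x k = c := by
  rw [val_eq hx, h, evalRVal]

/-- A constant or a literal ignores some free variable as soon as two are free. -/
theorem good_or_gate (hm : 2 ≤ freeCount n ρ) :
    C.Good b ρ ∨ ∃ o s, C.res ρ C.out = lit o s ∧ n ≤ o := by
  rcases h : C.res ρ C.out with c | ⟨o, s⟩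
  · obtain ⟨j, hj, hj'⟩ := exists_free (n := n) (ρ := ρ) (by omega)
    refine .inl (good_of_eq (near_zero hj) hj ?_)
    rw [val_of_res_const (agrees_zeroFill.update hj' _) h,
      val_of_res_const (agrees_zeroFill.update hj' _) h]
  · rcases Nat.lt_or_ge o n with ho | ho
    · obtain ⟨j, hj, hjo, hj'⟩ := exists_free_ne hm o
      refine .inl (good_of_eq (near_zero hj) hj ?_)
      rw [val_eq (agrees_zeroFill.update hj' _), val_eq (agrees_zeroFill.update hj' _), h, evalRVal,
        evalRVal, val_input ho, val_input ho, update_of_ne hjo.symm, update_of_ne hjo.symm]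
    · exact .inr ⟨o, s, rfl, ho⟩

/-! ### Gates that read two variables -/

/-- A live gate that reads two variables, and becomes constant for `i` set to `c` and for `j` set to
`d`. -/
structure Top (C : Circuit n) (ρ : ℕ → Option Bool) (g i : ℕ) (c : Bool) (j : ℕ) (d so : Bool) :
    Prop where
  live : C.Live ρ g
  bin : C.Bin ρ g i c j d so
  left_lt : i < n
  right_lt : j < n

namespace Top

variable {g i j : ℕ} {c d so : Bool}

theorem symm (h : C.Top ρ g i c j d so) : C.Top ρ g j d i c so :=
  ⟨h.live, h.bin.symm, h.right_lt, h.left_lt⟩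

theorem left_free (h : C.Top ρ g i c j d so) : ρ i = none :=
  eq_none_of_res_self h.left_lt h.bin.left.2

theorem right_free (h : C.Top ρ g i c j d so) : ρ j = none := h.symm.left_free

theorem ne (h : C.Top ρ g i c j d so) : i ≠ j := by
  obtain ⟨_, _, _, _, -, -, -, h'⟩ := h.bin
  exact fun e => h' ⟨e, h.left_lt⟩

theorem mem_readers (h : C.Top ρ g i c j d so) : g ∈ C.readers ρ i :=
  Circuit.mem_readers.2 ⟨h.live, h.bin.reads⟩

/-- The variable `j` is still free and has lost its influence. -/
theorem good_of_const (h : C.Top ρ g i c j d so) {e a : Bool}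
    (ho : C.res (fix ρ i e) C.out = const a) : C.Good b ρ := by
  refine good_of_eq (near_one h.left_lt e) h.right_lt ?_
  have hx : ∀ t, Agrees n (fix ρ i e) (update (update (zeroFill ρ) i e) j t) := fun t =>
    ((agrees_zeroFill.update h.left_free e).update h.right_free t).fix (by simp [h.ne])
  rw [val_of_res_const (hx _) ho, val_of_res_const (hx _) ho]

/-- Setting `j` to `d` makes `g` constant, and `g` is the only way from `i` to the output. -/
theorem good_of_readers (h : C.Top ρ g i c j d so) {o : ℕ} {s : Bool}
    (ho : C.res ρ C.out = lit o s) (hon : n ≤ o) (hr : ∀ k, C.Live ρ k → C.Reads ρ k i → k = g) :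
    C.Good b ρ := by
  refine good_of_eq (near_one h.right_lt d) h.left_lt ?_
  have hx : ∀ t, Agrees n ρ (update (update (zeroFill ρ) j d) i t) := fun t =>
    (agrees_zeroFill.update h.right_free d).update h.left_free t
  refine val_out_eq (hx _) (hx _) (· = i) (fun v _ hv => ?_) (fun k r hk _ hr' hkr => ?_) ?_
  · rw [update_of_ne hv, update_of_ne hv]
  · subst hr'
    rw [hr k hk hkr, h.bin.val (hx _), h.bin.val (hx _), val_input h.right_lt,
      val_input h.right_lt]
    simp [h.ne.symm]
  · intro r s' hr' he
    have := h.left_lt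
    rw [ho] at hr'
    cases hr'
    omega

/-- Besides the readers of `i`, some gate is eliminated that reads a constant gate without becoming
constant itself. -/
theorem exists_passing (h : C.Top ρ g i c j d so) {e : Bool} {z : ℕ} (hz : C.Live ρ z)
    (hzn : n ≤ z) {a : Bool} (hza : C.res (fix ρ i e) z = const a)
    (ho : ∀ a, C.res (fix ρ i e) C.out ≠ const a) :
    ∃ p z', C.Live ρ p ∧ n ≤ z' ∧ C.Live ρ z' ∧ (∃ a, C.res (fix ρ i e) z' = const a) ∧
      C.Reads ρ p z' ∧ (∀ a, C.res (fix ρ i e) p ≠ const a) ∧ ¬C.Reads ρ p i := by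
  classical
  have hρ := extends_fix h.left_free e
  -- The last constant live gate is not the output, so it has a live reader. By maximality this
  -- reader is not constant; hence it does not read `i`, since two constant inputs would make it
  -- constant.
  let Z := (C.liveGates ρ).filter fun k => ∃ a, C.res (fix ρ i e) k = const a
  have hZ : Z.Nonempty := ⟨z, by simp only [Z, Finset.mem_filter, mem_liveGates]; exact ⟨⟨hzn, hz⟩, a, hza⟩⟩
  have hmax := Z.max'_mem hZ
  obtain ⟨z', hz'⟩ : ∃ z', z' = Z.max' hZ := ⟨_, rfl⟩
  rw [← hz'] at hmax
  simp only [Z, Finset.mem_filter, mem_liveGates] at hmax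
  obtain ⟨⟨hz'n, hz'l⟩, a', ha'⟩ := hmax
  rcases hz'l.eq_out_or with ⟨s, hs⟩ | ⟨p, hp, hpz⟩
  · refine absurd ?_ (ho (a' ^^ s))
    rw [res_extends hρ, hs, subst, ha', flip_const]
  · have hpc : ∀ a, C.res (fix ρ i e) p ≠ const a := by
      intro a ha
      have : p ≤ Z.max' hZ := Z.le_max' p (by
        simp only [Z, Finset.mem_filter, mem_liveGates]
        exact ⟨⟨hpz.ge, hp⟩, a, ha⟩)
      have := hpz.lt
      omega
    refine ⟨p, z', hp, hz'n, hz'l, ⟨a', ha'⟩, hpz, hpc, fun hpi => ?_⟩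
    have hne : z' ≠ i := by
      have := h.left_lt
      omega
    obtain ⟨_, _, _, hb⟩ := hpz.bin hpi hne
    obtain ⟨a, ha⟩ := hb.res_const hρ ha' (res_fix h.left_lt e)
    exact hpc a ha

theorem not_live_of_const (h : C.Top ρ g i c j d so) {e : Bool} {k r : ℕ} {a : Bool}
    (hk : C.Reads ρ k r) (hr : C.res (fix ρ i e) r = const a) : ¬C.Live (fix ρ i e) k := by
  obtain ⟨_, _, _, _, hb⟩ := hk
  exact fun hl => hb.res_ne_self (extends_fix h.left_free e) hr hl.res_self

/-- Fixing a variable eliminates its readers and one more gate. -/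
theorem drop (h : C.Top ρ g i c j d so) {e : Bool} {z : ℕ} (hz : C.Live ρ z)
    (hzn : n ≤ z) {a : Bool} (hza : C.res (fix ρ i e) z = const a)
    (ho : ∀ a, C.res (fix ρ i e) C.out ≠ const a) :
    (C.liveGates (fix ρ i e)).card + (C.readers ρ i).card + 1 ≤ (C.liveGates ρ).card := by
  obtain ⟨p, z', hp, -, -, ⟨a', ha'⟩, hpz, -, hpi⟩ := h.exists_passing hz hzn hza ho
  have hnot : p ∉ C.readers ρ i := fun hp' => hpi (Circuit.mem_readers.1 hp').2
  have := card_liveGates_add_le (C := C) (extends_fix h.left_free e) (insert p (C.readers ρ i))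
    (by
      intro k hk
      rcases Finset.mem_insert.1 hk with rfl | hk
      · exact ⟨hpz.ge, hp, h.not_live_of_const hpz ha'⟩
      · have := Circuit.mem_readers.1 hk
        exact ⟨this.2.ge, this.1, h.not_live_of_const this.2 (res_fix h.left_lt e)⟩)
  rw [Finset.card_insert_of_notMem hnot] at this
  omega

theorem res_kill (h : C.Top ρ g i c j d so) : C.res (fix ρ i c) g = const so :=
  h.bin.res_kill (extends_fix h.left_free c) (res_fix h.left_lt c)

theorem two_le_card_readers (h : C.Top ρ g i c j d so) {o : ℕ} {s : Bool}
    (ho : C.res ρ C.out = lit o s) (hon : n ≤ o) :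
    C.Good b ρ ∨ 2 ≤ (C.readers ρ i).card := by
  by_contra! hcon
  refine hcon.1 (h.good_of_readers ho hon fun k hk hki => ?_)
  have := Finset.card_le_one.1 (show (C.readers ρ i).card ≤ 1 by omega)
  exact this k (Circuit.mem_readers.2 ⟨hk, hki⟩) g h.mem_readers

end Top

/-! ### Circuits that are too small -/

/-- The function chooses a variable of a live gate that reads two variables, and makes this gate
constant. -/
def Chooses (C : Circuit n) (nxt : (ℕ → Option Bool) → ℕ → Option Bool) : Prop :=
  ∀ ρ o s, C.res ρ C.out = lit o s → n ≤ o →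
    ∃ g i c j d so, C.Top ρ g i c j d so ∧ nxt ρ = fix ρ i c

/-- A round without failure uses up one variable and at least three gates: two readers of `i` and a
gate that passes. The inequality is thus preserved, but it is impossible for `m ≤ 1`. -/
theorem exists_good_of_card_lt {nxt : (ℕ → Option Bool) → ℕ → Option Bool} (hc : C.Chooses nxt)
    (m : ℕ) : ∀ ρ, freeCount n ρ = m → (C.liveGates ρ).card + 4 ≤ 3 * m →
      ∃ k ≤ m, C.Good b (nxt^[k] ρ) := by
  induction m with
  | zero => intro ρ _ h; omega
  | succ m ih =>
    intro ρ hm h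
    rcases good_or_gate (C := C) (b := b) (ρ := ρ) (by omega) with hg | ⟨o, s, ho, hon⟩
    · exact ⟨0, by omega, hg⟩
    obtain ⟨g, i, c, j, d, so, ht, hnxt⟩ := hc ρ o s ho hon
    rcases ht.two_le_card_readers (b := b) ho hon with hg | h2
    · exact ⟨0, by omega, hg⟩
    by_cases hconst : ∃ a, C.res (fix ρ i c) C.out = const a
    · obtain ⟨a, ha⟩ := hconst
      exact ⟨0, by omega, ht.good_of_const ha⟩
    push Not at hconst
    have hd := ht.drop ht.live ht.bin.ge ht.res_kill hconst
    have hf := freeCount_fix ht.left_lt ht.left_free c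
    obtain ⟨k, hk, hg⟩ := ih (fix ρ i c) (by omega) (by omega)
    exact ⟨k + 1, by omega, by rwa [iterate_succ_apply, hnxt]⟩

end Circuit

end DeMorgan

/-! ### Eliminations of exactly three gates -/

namespace DeMorgan

open RVal

open Function (update update_self update_of_ne update_eq_self iterate_succ_apply)

namespace Circuit

variable {n : ℕ} {C : Circuit n} {ρ ρ' : ℕ → Option Bool} {b : Bool}

/-- If the nodes whose values depend on the variable `i` are shielded from the output, then the
circuit errs. -/
theorem good_of_shield {x : ℕ → Bool} (hx : Near n ρ x) (hxa : Agrees n ρ x) {i : ℕ} (hi : i < n)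
    (hρ : ρ i = none) (S : ℕ → Prop) (hS : S i)
    (h : ∀ k r, C.Live ρ k → ¬S k → S r → C.Reads ρ k r →
      C.val (update x i true) k = C.val (update x i false) k)
    (ho : ∀ r s, C.res ρ C.out = lit r s → ¬S r) : C.Good b ρ := by
  refine good_of_eq hx hi (val_out_eq (hxa.update hρ _) (hxa.update hρ _) S (fun v _ hv => ?_) h ho)
  have : v ≠ i := by
    rintro rfl
    exact hv hS
  rw [update_of_ne this, update_of_ne this]

/-- A restriction leaves at most one reader to the node `j`. -/
def Single (C : Circuit n) (ρ : ℕ → Option Bool) (j : ℕ) : Prop :=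
  ∀ k k', C.Live ρ k → C.Live ρ k' → C.Reads ρ k j → C.Reads ρ k' j → k = k'

/-- A new reader of `j` can arise only if an old reader turns into a copy of `j` and hands it to its
own readers. -/
theorem Single.extends_or {j : ℕ} (h : C.Single ρ j) (hρ : Extends ρ' ρ) :
    C.Single ρ' j ∨ ∃ r t, C.Live ρ r ∧ C.Reads ρ r j ∧ C.res ρ' r = lit j t := by
  rw [or_iff_not_imp_right]
  intro hr k k' hk hk' hkj hkj'
  have key : ∀ k, C.Live ρ' k → C.Reads ρ' k j → C.Live ρ k ∧ C.Reads ρ k j := by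
    rintro k hk ⟨_, _, _, _, hb⟩
    obtain ⟨q, s, q', s', hb', h₁, -⟩ := hb.of_extends hρ
    refine ⟨hk.mono hρ, ?_⟩
    rcases ((hk.mono hρ).step hb'.reads).pass hρ (exists_lit_of_flip h₁) with rfl |
      ⟨r, -, hr', hrj, t, ht⟩
    · exact hb'.reads
    · exact absurd ⟨r, t, hr', hrj, ht⟩ hr
  exact h _ _ (key k hk hkj).1 (key k' hk' hkj').1 (key k hk hkj).2 (key k' hk' hkj').2

theorem freeCount_pos {i : ℕ} (hi : i < n) (h : ρ i = none) : 0 < freeCount n ρ :=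
  Finset.card_pos.2 ⟨i, by simp [hi, h]⟩

/-- Fixing the variable `i` eliminates its two readers and one more gate only. -/
structure Tight (C : Circuit n) (ρ : ℕ → Option Bool) (g i : ℕ) (e : Bool) (h p z : ℕ) : Prop where
  live_second : C.Live ρ h
  reads_second : C.Reads ρ h i
  second_ne : h ≠ g
  eq_of_reads : ∀ k, C.Live ρ k → C.Reads ρ k i → k = g ∨ k = h
  live_third : C.Live ρ p
  third_not_const : ∀ a, C.res (fix ρ i e) p ≠ const a
  third_reads : C.Reads ρ p z
  eq_or : z = g ∨ z = h
  const : ∃ a, C.res (fix ρ i e) z = const a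
  killed : ∀ k, n ≤ k → C.Live ρ k → ¬C.Live (fix ρ i e) k → k = g ∨ k = h ∨ k = p

namespace Top

variable {g i j : ℕ} {c d so : Bool}

/-- The elimination argument always exhibits three distinct victims: `g`, another reader of `i`, and
a gate `p` reading a constant gate `z'`. If no more than three gates disappear, these are all. As
`z'` disappears too and cannot be its own reader `p`, it is one of the first two. -/
theorem exists_tight (h : C.Top ρ g i c j d so) {e : Bool} {z : ℕ} (hz : C.Live ρ z)
    (hzn : n ≤ z) {a : Bool} (hza : C.res (fix ρ i e) z = const a)
    (ho : ∀ a, C.res (fix ρ i e) C.out ≠ const a)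
    (hcard : (C.liveGates ρ).card ≤ (C.liveGates (fix ρ i e)).card + 3)
    (h2 : 2 ≤ (C.readers ρ i).card) : ∃ h p z, C.Tight ρ g i e h p z := by
  classical
  have hρ := extends_fix h.left_free e
  obtain ⟨p, z', hp, hz'n, hz', ⟨a', ha'⟩, hpz, hpc, hpi⟩ := h.exists_passing hz hzn hza ho
  obtain ⟨f, hf, hfg⟩ := Finset.exists_mem_ne h2 g
  obtain ⟨hfl, hfi⟩ := Circuit.mem_readers.1 hf
  have hsub : C.liveGates (fix ρ i e) ⊆ C.liveGates ρ := by
    intro k hk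
    rw [mem_liveGates] at hk ⊢
    exact ⟨hk.1, hk.2.mono hρ⟩
  have hT : (C.liveGates ρ \ C.liveGates (fix ρ i e)).card ≤ 3 := by
    rw [Finset.card_sdiff_of_subset hsub]
    omega
  have hmem : ∀ k, n ≤ k → C.Live ρ k → ¬C.Live (fix ρ i e) k →
      k ∈ C.liveGates ρ \ C.liveGates (fix ρ i e) := by
    intro k hn hk hk'
    rw [Finset.mem_sdiff, mem_liveGates, mem_liveGates]
    tauto
  have hpg : p ≠ g := by
    rintro rfl
    exact hpi h.bin.reads
  have hpf : p ≠ f := by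
    rintro rfl
    exact hpi hfi
  have hreads : ∀ k, C.Live ρ k → C.Reads ρ k i → ¬C.Live (fix ρ i e) k := fun k _ hki =>
    h.not_live_of_const hki (res_fix h.left_lt e)
  have heq : ({g, f, p} : Finset ℕ) = C.liveGates ρ \ C.liveGates (fix ρ i e) := by
    refine Finset.eq_of_subset_of_card_le (fun k hk => ?_) ?_
    · simp only [Finset.mem_insert, Finset.mem_singleton] at hk
      rcases hk with rfl | rfl | rfl
      · exact hmem _ h.bin.ge h.live (hreads _ h.live h.bin.reads)
      · exact hmem _ hfi.ge hfl (hreads _ hfl hfi)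
      · exact hmem _ hpz.ge hp (h.not_live_of_const hpz ha')
    · rwa [Finset.card_eq_three.2 ⟨g, f, p, hfg.symm, hpg.symm, hpf.symm, rfl⟩]
  have hkilled : ∀ k, n ≤ k → C.Live ρ k → ¬C.Live (fix ρ i e) k → k = g ∨ k = f ∨ k = p := by
    intro k hn hk hk'
    have := hmem k hn hk hk'
    rw [← heq] at this
    simpa using this
  refine ⟨f, p, z', hfl, hfi, hfg, fun k hk hki => ?_, hp, hpc, hpz, ?_, ⟨a', ha'⟩, hkilled⟩
  · rcases hkilled k hki.ge hk (hreads k hk hki) with h | h | rfl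
    · exact .inl h
    · exact .inr h
    · exact absurd hki hpi
  · rcases hkilled z' hz'n hz' (fun hl => by simp [hl.res_self] at ha') with h | h | rfl
    · exact .inl h
    · exact .inr h
    · exact absurd hpz.lt (lt_irrefl _)

/-- The reader of a constant node is eliminated, and only three gates are. -/
theorem eq_of_reads_const (h : C.Top ρ g i c j d so) {e : Bool} {f p z : ℕ}
    (ht : C.Tight ρ g i e f p z) {k r : ℕ} {a : Bool} (hr : C.res (fix ρ i e) r = const a)
    (hk : C.Live ρ k) (hkr : C.Reads ρ k r) : k = g ∨ k = f ∨ k = p :=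
  ht.killed k hkr.ge hk (h.not_live_of_const hkr hr)

theorem not_reads_gate (h : C.Top ρ g i c j d so) {r : ℕ} (hr : n ≤ r) : ¬C.Reads ρ g r := by
  intro hg
  have := h.left_lt
  have := h.right_lt
  rcases h.bin.eq_or_of_reads hg with rfl | rfl <;> omega

theorem val (h : C.Top ρ g i c j d so) {x : ℕ → Bool} (hx : Agrees n ρ x) :
    C.val x g = (((x i ^^ c) && (x j ^^ d)) ^^ so) := by
  rw [h.bin.val hx, val_input h.left_lt, val_input h.right_lt]

end Top

end Circuit

end DeMorgan

/-! ### A variable with a single reader -/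

namespace DeMorgan

open RVal

open Function (update update_self update_of_ne update_eq_self iterate_succ_apply)

namespace Circuit

variable {n : ℕ} {C : Circuit n} {ρ ρ' : ℕ → Option Bool} {b : Bool}

/-- The value `su` of `u` freezes the only reader of `j₀`, so `j₀` loses its influence once `i` and
`j` force this value. The case `i = j` covers a value forced by one variable; there the later
assignment `f` overrides `e`. -/
theorem Single.good_of_kill {j₀ r u i j o : ℕ} {s₀ su w e f t : Bool} (hs : C.Single ρ j₀)
    (hr : C.Live ρ r) (hb : C.Bin ρ r j₀ s₀ u su w) (hj₀ : j₀ < n) (hf : ρ j₀ = none)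
    (ho : C.res ρ C.out = lit o t) (hon : n ≤ o) (hi : i < n) (hj : j < n) (hif : ρ i = none)
    (hjf : ρ j = none) (hi₀ : i ≠ j₀) (hj₀' : j ≠ j₀)
    (hk : ∀ x, Agrees n ρ x → x i = (if i = j then f else e) → x j = f → C.val x u = su) :
    C.Good b ρ := by
  have hx : Agrees n ρ (update (update (zeroFill ρ) i e) j f) :=
    (agrees_zeroFill.update hif _).update hjf _
  refine good_of_shield (near_two hi hj e f) hx hj₀ hf (· = j₀) rfl (fun k r' hkl _ hr' hkr => ?_)
    (fun r' s hr' h => ?_)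
  · subst hr'
    obtain rfl := hs k r hkl hr hkr hb.reads
    have key : ∀ t, C.val (update (update (update (zeroFill ρ) i e) j f) r' t) u = su := by
      intro t
      refine hk _ (hx.update hf t) ?_ ?_
      · rw [update_of_ne hi₀]
        split_ifs with h
        · rw [h, update_self]
        · rw [update_of_ne h, update_self]
      · rw [update_of_ne hj₀', update_self]
    rw [hb.val (hx.update hf _), hb.val (hx.update hf _), key, key]
    simp
  · rw [ho] at hr'
    cases hr'
    omega

/-- If the single reader survives the greedy step, the induction goes on. Otherwise the reader `r`
of `j₀` has become a copy of `j₀`, so its other input `u` is now constant with the passing value.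
Tightness leaves for `u` only `i`, `g` or the second reader of `i`, each a function of the variables
`i` and `j`. Either this function also takes the killing value, which shields `j₀`, or it is
constant, which shields `i`. -/
theorem exists_good_of_single {nxt : (ℕ → Option Bool) → ℕ → Option Bool} (hc : C.Chooses nxt)
    {j₀ : ℕ} (hj₀ : j₀ < n) (m : ℕ) : ∀ ρ, freeCount n ρ = m → 2 ≤ m →
      (C.liveGates ρ).card + 3 ≤ 3 * m → ρ j₀ = none → C.Single ρ j₀ →
      ∃ k ≤ m, C.Good b (nxt^[k] ρ) := by
  induction m with
  | zero => intro ρ _ h; omega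
  | succ m ih =>
    intro ρ hm h2m hcard hf₀ hs
    rcases good_or_gate (C := C) (b := b) (ρ := ρ) (by omega) with hg | ⟨o, s, ho, hon⟩
    · exact ⟨0, by omega, hg⟩
    obtain ⟨g, i, c, j, d, so, ht, hnxt⟩ := hc ρ o s ho hon
    by_cases hi₀ : i = j₀
    · subst hi₀
      exact ⟨0, by omega, ht.good_of_readers ho hon fun k hk hki =>
        hs k g hk ht.live hki ht.bin.reads⟩
    by_cases hj₀' : j = j₀
    · subst hj₀'
      exact ⟨0, by omega, ht.symm.good_of_readers ho hon fun k hk hki =>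
        hs k g hk ht.live hki ht.bin.symm.reads⟩
    rcases ht.two_le_card_readers (b := b) ho hon with hg | h2
    · exact ⟨0, by omega, hg⟩
    by_cases hconst : ∃ a, C.res (fix ρ i c) C.out = const a
    · obtain ⟨a, ha⟩ := hconst
      exact ⟨0, by omega, ht.good_of_const ha⟩
    push Not at hconst
    have hρ := extends_fix ht.left_free c
    have hd := ht.drop ht.live ht.bin.ge ht.res_kill hconst
    have hfc := freeCount_fix ht.left_lt ht.left_free c
    have hrec : (∃ k ≤ m, C.Good b (nxt^[k] (fix ρ i c))) → ∃ k ≤ m + 1, C.Good b (nxt^[k] ρ) := by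
      rintro ⟨k, hk, hg⟩
      exact ⟨k + 1, by omega, by rwa [iterate_succ_apply, hnxt]⟩
    by_cases hlt : (C.liveGates (fix ρ i c)).card + 4 ≤ (C.liveGates ρ).card
    · exact hrec (exists_good_of_card_lt hc m _ (by omega) (by omega))
    have hf₀' : fix ρ i c j₀ = none := by rw [fix, update_of_ne (Ne.symm hi₀), hf₀]
    have hjf : fix ρ i c j = none := by rw [fix, update_of_ne ht.ne.symm, ht.right_free]
    rcases hs.extends_or hρ with hs' | ⟨r, t, hr, hrj, hrt⟩
    · refine hrec (ih _ (by omega) ?_ (by omega) hf₀' hs')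
      have h₁ := freeCount_fix ht.right_lt hjf false
      have : 0 < freeCount n (fix (fix ρ i c) j false) :=
        freeCount_pos hj₀ (by rw [fix, update_of_ne (Ne.symm hj₀'), hf₀'])
      omega
    refine ⟨0, by omega, ?_⟩
    change C.Good b ρ
    obtain ⟨h, p, z, hti⟩ := ht.exists_tight ht.live ht.bin.ge ht.res_kill hconst (by omega) h2
    obtain ⟨s₀, u, su, w, hb⟩ := hrj
    have huj : u ≠ j₀ := by
      obtain ⟨_, _, _, _, -, -, -, h'⟩ := hb
      exact fun e => h' ⟨e.symm, hj₀⟩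
    have hul := hr.step hb.symm.reads
    have hj₀r : C.res (fix ρ i c) j₀ = lit j₀ false := by rw [res_input hj₀, inputRVal, hf₀']
    -- The input `u` cannot itself carry `j₀`: that would require a reader of `j₀` no later than
    -- `u`, whereas the only reader `r` comes after `u`. So `r` copies `j₀` directly, and `u` lets
    -- it pass.
    have hu : C.res (fix ρ i c) u = const (!su) := by
      have := hb.res hρ
      rw [hrt, hj₀r] at this
      rcases hu : C.res (fix ρ i c) u with a | ⟨q, a⟩
      · rw [hu] at this
        cases a <;> cases su <;> simp [conj] at this ⊢
      · rw [hu] at this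
        have hq : q = j₀ := by
          simp only [flip_lit, conj] at this
          split_ifs at this with h₁ h₂
          · exact h₁.1.symm
          · simp at this
          · simp only [Option.map_none, Option.getD_none, lit.injEq] at this
            have := hb.ge
            omega
        subst hq
        rcases hul.pass hρ hu with h' | ⟨k, hku, hk, hkj, -⟩
        · exact absurd h' huj
        · have := hs k r hk hr hkj hb.reads
          have := hb.symm.left.1
          omega
    by_cases hun : u < n
    · have hui : u = i := by
        by_contra hui
        have := eq_none_of_res_self hun hb.symm.left.2
        rw [res_input hun, inputRVal, fix, update_of_ne hui, this] at hu
        cases hu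
      subst hui
      refine hs.good_of_kill hr hb hj₀ hf₀ ho hon hun hun ht.left_free ht.left_free hi₀ hi₀
        (e := su) (f := su) fun x hx h₁ h₂ => ?_
      rwa [val_input hun]
    · rw [not_lt] at hun
      have hug : u = g ∨ u = h := by
        rcases hti.killed u hun hul (fun hl => by simp [hl.res_self] at hu) with h | h | rfl
        · exact .inl h
        · exact .inr h
        · exact absurd hu (hti.third_not_const _)
      have hri : ¬C.Reads ρ r i := by
        intro hri
        have := ht.left_lt
        rcases hb.eq_or_of_reads hri with h | h
        · exact hi₀ h
        · omega
      have hrp : r = p := by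
        rcases ht.eq_of_reads_const hti hu hr hb.symm.reads with rfl | rfl | h
        · exact absurd ht.bin.reads hri
        · exact absurd hti.reads_second hri
        · exact h
      subst hrp
      rcases hug with rfl | rfl
      · obtain ⟨e, f, hef⟩ : ∃ e f, (((e ^^ c) && (f ^^ d)) ^^ so) = su := by
          have : ∀ c d so su : Bool, ∃ e f, (((e ^^ c) && (f ^^ d)) ^^ so) = su := by decide
          exact this _ _ _ _
        refine hs.good_of_kill hr hb hj₀ hf₀ ho hon ht.left_lt ht.right_lt ht.left_free
          ht.right_free hi₀ hj₀' (e := e) (f := f) fun x hx h₁ h₂ => ?_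
        rw [if_neg ht.ne] at h₁
        rw [ht.val hx, h₁, h₂, hef]
      -- Here `u` is the second reader of `i`. The gate `g` is not the output and is read by `u`
      -- only, so `u` reads `i` and `g` and depends on the variables `i` and `j` alone.
      · have hog : ∀ r s, C.res ρ C.out = lit r s → r ≠ g := by
          rintro r s hr rfl
          have := ht.res_kill
          exact hconst _ (by rw [res_extends hρ, hr, subst, this, flip_const])
        have hou : ∀ r s, C.res ρ C.out = lit r s → r ≠ u := by
          rintro r s hr rfl
          exact hconst _ (by rw [res_extends hρ, hr, subst, hu, flip_const])
        have hgu : ∀ k, C.Live ρ k → C.Reads ρ k g → k = u := by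
          intro k hk hkg
          rcases ht.eq_of_reads_const hti ht.res_kill hk hkg with rfl | h | rfl
          · exact absurd hkg.lt (lt_irrefl _)
          · exact h
          · have := ht.bin.ge
            rcases hb.eq_or_of_reads hkg with h | h
            · omega
            · exact absurd h.symm hti.second_ne
        obtain ⟨k, hk, hkg⟩ : ∃ k, C.Live ρ k ∧ C.Reads ρ k g := by
          rcases ht.live.eq_out_or with ⟨s, hs⟩ | h
          · exact absurd rfl (hog _ _ hs)
          · exact h
        obtain rfl := hgu k hk hkg
        have hig : i ≠ g := by
          have := ht.left_lt
          have := ht.bin.ge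
          omega
        obtain ⟨s₁, s₂, w', hb'⟩ := hti.reads_second.bin hkg hig
        have hval : ∀ x, Agrees n ρ x →
            C.val x k = (((x i ^^ s₁) && ((((x i ^^ c) && (x j ^^ d)) ^^ so) ^^ s₂)) ^^ w') := by
          intro x hx
          rw [hb'.val hx, ht.val hx, val_input ht.left_lt]
        by_cases hef : ∃ e f, (((e ^^ s₁) && ((((e ^^ c) && (f ^^ d)) ^^ so) ^^ s₂)) ^^ w') = su
        · obtain ⟨e, f, hef⟩ := hef
          refine hs.good_of_kill hr hb hj₀ hf₀ ho hon ht.left_lt ht.right_lt ht.left_free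
            ht.right_free hi₀ hj₀' (e := e) (f := f) fun x hx h₁ h₂ => ?_
          rw [if_neg ht.ne] at h₁
          rw [hval x hx, h₁, h₂, hef]
        -- The gate never takes the killing value, hence is constant on the whole subcube. Since `i`
        -- reaches the output only through it and `g`, the variable `i` has no influence.
        · push Not at hef
          have hval' : ∀ x, Agrees n ρ x → C.val x k = !su := by
            intro x hx
            rw [hval x hx]
            exact Bool.eq_not_of_ne (hef _ _)
          have hx : ∀ t, Agrees n ρ (update (zeroFill ρ) i t) := fun t =>
            agrees_zeroFill.update ht.left_free t
          refine good_of_shield (near_zero ht.left_lt) agrees_zeroFill ht.left_lt ht.left_free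
            (fun v => v = i ∨ v = g ∨ v = k) (.inl rfl) (fun q v hq hqS hv hqv => ?_)
            (fun q s hq hqS => ?_)
          · have hqr : q = r := by
              rcases hv with rfl | rfl | rfl
              · rcases hti.eq_of_reads q hq hqv with rfl | rfl <;> simp at hqS
              · obtain rfl := hgu q hq hqv
                simp at hqS
              · rcases ht.eq_of_reads_const hti hu hq hqv with rfl | rfl | h
                · simp at hqS
                · simp at hqS
                · exact h
            subst hqr
            rw [hb.val (hx _), hb.val (hx _), hval' _ (hx _), hval' _ (hx _), val_input hj₀,
              val_input hj₀, update_of_ne (Ne.symm hi₀), update_of_ne (Ne.symm hi₀)]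
          · rcases hqS with rfl | rfl | rfl
            · have := ht.left_lt
              rw [ho] at hq
              cases hq
              omega
            · exact hog _ _ hq rfl
            · exact hou _ _ hq rfl

end Circuit

end DeMorgan

/-! ### Failures near a gate that reads two variables -/

namespace DeMorgan

open RVal

open Function (update update_self update_of_ne update_eq_self iterate_succ_apply)

namespace Circuit

variable {n : ℕ} {C : Circuit n} {ρ ρ' : ℕ → Option Bool} {b : Bool}

theorem Errs.congr {x y : ℕ → Bool} (hx : C.Errs b x) (h : ∀ i < n, x i = y i) : C.Errs b y := by
  have : (fun i : Fin n => x i) = fun i : Fin n => y i := funext fun i => h i i.2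
  rwa [Errs, this] at hx

/-- With one free variable, every compatible input is the completion by zeros up to that single bit.
-/
theorem good_of_freeCount_eq_one (hm : freeCount n ρ = 1) {x : ℕ → Bool} (hx : Agrees n ρ x)
    (h : C.Errs b x) : C.Good b ρ := by
  obtain ⟨j, hj⟩ := Finset.card_eq_one.1 hm
  have hjn : j < n ∧ ρ j = none := by
    have : j ∈ ({j} : Finset ℕ) := Finset.mem_singleton_self j
    rw [← hj, Finset.mem_filter, Finset.mem_range] at this
    exact this
  refine good_of_errs (near_zero hjn.1) hjn.1 (d := x j) (h.congr fun i hi => ?_)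
  by_cases hij : i = j
  · rw [hij, update_self]
  · rw [update_of_ne hij, zeroFill]
    rcases hi' : ρ i with _ | a
    · have : i ∈ (Finset.range n).filter fun i => ρ i = none := by simp [hi, hi']
      rw [hj, Finset.mem_singleton] at this
      exact absurd this hij
    · rw [hx i hi a hi', Option.getD_some]

theorem xorFn_flip (b : Bool) (x : ℕ → Bool) {j : ℕ} (hj : j < n) :
    xorFn n b (fun i => update x j (!x j) i) = !xorFn n b fun i => x i := by
  have h := xorFn_update b x hj
  have h' : update x j (x j) = x := update_eq_self j x
  rcases hx : x j with _ | _ <;> rw [hx] at h'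
  · rw [h'] at h
    exact h
  · rw [h'] at h
    rw [h]
    simp

theorem not_eq_of_res_const (hρ : Extends ρ' ρ) {k : ℕ} {a : Bool} (hk : C.res ρ' k = const a)
    (ho : ∀ a, C.res ρ' C.out ≠ const a) : ∀ r s, C.res ρ C.out = lit r s → r ≠ k := by
  rintro r s hr rfl
  exact ho _ (by rw [res_extends hρ, hr, subst, hk, flip_const])

theorem eq_of_res_lit {k q : ℕ} {t : Bool} (hk : k < n) (h : C.res ρ k = lit q t) : k = q := by
  rw [res_input hk, inputRVal] at h
  rcases hρ : ρ k with _ | b <;> rw [hρ] at h <;> cases h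
  rfl

theorem not_live_of_res_lit {k q : ℕ} {t : Bool} (h : C.res ρ k = lit q t) (hq : q ≠ k) :
    ¬C.Live ρ k := by
  intro hl
  rw [hl.res_self] at h
  cases h
  exact hq rfl

namespace Top

variable {g i j : ℕ} {c d so : Bool}

/-- The readers of `i` influence the output through a single gate, that can be killed by `j`. -/
theorem good_of_funnel (h : C.Top ρ g i c j d so) {f p : ℕ} {t a : Bool}
    (hi : ∀ k, C.Live ρ k → C.Reads ρ k i → k = g ∨ k = f)
    (hg : ∀ k, C.Live ρ k → C.Reads ρ k g → k = f ∨ k = p)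
    (hf : ∀ k, C.Live ρ k → C.Reads ρ k f → k = p)
    (hp : ∀ x, Agrees n ρ x → x j = a → C.val x p = t)
    (ho : ∀ r s, C.res ρ C.out = lit r s → n ≤ r ∧ r ≠ g ∧ r ≠ f) : C.Good b ρ := by
  have hx : Agrees n ρ (update (zeroFill ρ) j a) := agrees_zeroFill.update h.right_free a
  refine good_of_shield (near_one h.right_lt a) hx h.left_lt h.left_free
    (fun v => v = i ∨ v = g ∨ v = f) (.inl rfl) (fun q v hq hqS hv hqv => ?_) (fun r s hr hS => ?_)
  · have hqp : q = p := by
      rcases hv with rfl | rfl | rfl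
      · rcases hi q hq hqv with rfl | rfl <;> simp at hqS
      · rcases hg q hq hqv with rfl | h
        · simp at hqS
        · exact h
      · exact hf q hq hqv
    subst hqp
    have key : ∀ e, C.val (update (update (zeroFill ρ) j a) i e) q = t := fun e =>
      hp _ (hx.update h.left_free e) (by rw [update_of_ne h.ne.symm, update_self])
    rw [key, key]
  · obtain ⟨h₁, h₂, h₃⟩ := ho r s hr
    rcases hS with rfl | hS | hS
    · exact absurd h.left_lt (by omega)
    · exact h₂ hS
    · exact h₃ hS

/-- The gate `g` feeds only `h` and possibly `h'`, and `h` feeds only `h'`. As `h'` also reads `j`,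
a suitable value of `j` freezes `h'` and cuts `i` off from the output. -/
theorem good_of_chain (ht : C.Top ρ g i c j d so) {h h' z o : ℕ} {s : Bool}
    (ho : C.res ρ C.out = lit o s) (hon : n ≤ o)
    (hconst : ∀ a, C.res (fix ρ i c) C.out ≠ const a) (hti : C.Tight ρ g i c h h' z)
    (hj : C.Reads ρ h' j) (hg : C.Reads ρ h g) : C.Good b ρ := by
  have hρ := extends_fix ht.left_free c
  have hig : i ≠ g := by
    have := ht.left_lt
    have := ht.bin.ge
    omega
  obtain ⟨_, _, _, hb⟩ := hti.reads_second.bin hg hig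
  obtain ⟨a, ha⟩ := hb.res_const hρ (res_fix ht.left_lt c) ht.res_kill
  have hoh := not_eq_of_res_const hρ ha hconst
  have hog := not_eq_of_res_const hρ ht.res_kill hconst
  have hhr : ∀ k, C.Live ρ k → C.Reads ρ k h → k = h' := by
    intro k hk hkh
    rcases ht.eq_of_reads_const hti ha hk hkh with rfl | rfl | h
    · exact absurd hkh (ht.not_reads_gate hg.ge)
    · exact absurd hkh.lt (lt_irrefl _)
    · exact h
  obtain ⟨k, hk, hkh⟩ : ∃ k, C.Live ρ k ∧ C.Reads ρ k h := by
    rcases hti.live_second.eq_out_or with ⟨s, hs⟩ | h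
    · exact absurd rfl (hoh _ _ hs)
    · exact h
  obtain rfl := hhr k hk hkh
  have hjh : j ≠ h := by
    have := ht.right_lt
    have := hg.ge
    omega
  obtain ⟨s₁, s₂, w, hb'⟩ := hj.bin hkh hjh
  refine ht.good_of_funnel (a := s₁) (t := w) hti.eq_of_reads (fun q hq hqg => ?_) hhr
    (fun x hx hxj => ?_) (fun r s' hr => ?_)
  · rcases ht.eq_of_reads_const hti ht.res_kill hq hqg with rfl | rfl | h
    · exact absurd hqg.lt (lt_irrefl _)
    · exact .inl rfl
    · exact .inr h
  · rw [hb'.val hx, val_input ht.right_lt, hxj]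
    simp
  · refine ⟨?_, hog _ _ hr, hoh _ _ hr⟩
    rw [ho] at hr
    cases hr
    exact hon

/-- The same value of `i` kills both readers of `j`, so `j` loses its influence. -/
theorem good_of_kill_both (ht : C.Top ρ g i c j d so) {h o : ℕ} {s d' so' : Bool}
    (hh : C.Top ρ h i c j d' so') (ho : C.res ρ C.out = lit o s) (hon : n ≤ o)
    (hj : ∀ k, C.Live ρ k → C.Reads ρ k j → k = g ∨ k = h) : C.Good b ρ := by
  have hx : ∀ t, Agrees n ρ (update (update (zeroFill ρ) i c) j t) := fun t =>
    (agrees_zeroFill.update ht.left_free c).update ht.right_free t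
  refine good_of_shield (near_one ht.left_lt c) (agrees_zeroFill.update ht.left_free c) ht.right_lt
    ht.right_free (· = j) rfl (fun q v hq _ hv hqv => ?_) (fun r s hr hS => ?_)
  · subst hv
    rcases hj q hq hqv with rfl | rfl
    · rw [ht.val (hx _), ht.val (hx _)]
      simp [ht.ne]
    · rw [hh.val (hx _), hh.val (hx _)]
      simp [ht.ne]
  · rw [ho] at hr
    cases hr
    have := ht.right_lt
    omega

/-- Of the two readers of `j`, the gate `g` becomes constant, while `h` survives as its own
representative and so does not hand `j` on to other gates. -/
theorem single_of_live (ht : C.Top ρ g i c j d so) {h : ℕ}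
    (hj : ∀ k, C.Live ρ k → C.Reads ρ k j → k = g ∨ k = h) (hh : C.Live (fix ρ i c) h)
    (hn : n ≤ h) : C.Single (fix ρ i c) j := by
  have hρ := extends_fix ht.left_free c
  have key : ∀ k, C.Live (fix ρ i c) k → C.Reads (fix ρ i c) k j → k = h := by
    rintro k hk ⟨_, _, _, _, hb⟩
    obtain ⟨q, s, q', s', hb', h₁, -⟩ := hb.of_extends hρ
    rcases ((hk.mono hρ).step hb'.reads).pass hρ (exists_lit_of_flip h₁) with rfl |
      ⟨r, -, hr, hrj, t, ht'⟩
    · rcases hj k (hk.mono hρ) hb'.reads with rfl | h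
      · have := hk.res_self
        rw [ht.res_kill] at this
        cases this
      · exact h
    · rcases hj r hr hrj with rfl | rfl
      · rw [ht.res_kill] at ht'
        cases ht'
      · rw [hh.res_self] at ht'
        cases ht'
        have := ht.right_lt
        omega
  exact fun k k' hk hk' hkj hkj' => (key k hk hkj).trans (key k' hk' hkj').symm

theorem res_pass (ht : C.Top ρ g i (!c) j d so) :
    C.res (fix ρ i c) g = lit j (d ^^ so) := by
  have hj : C.res (fix ρ i c) j = lit j false := by
    rw [res_input ht.right_lt, inputRVal, fix, update_of_ne ht.ne.symm, ht.right_free]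
  rw [ht.bin.res_pass (extends_fix ht.left_free c) (by rw [res_fix ht.left_lt, Bool.not_not]), hj]
  simp

end Top

end Circuit

end DeMorgan

/-! ### Two gates that read the same two variables -/

namespace DeMorgan

open RVal

open Function (update update_self update_of_ne update_eq_self iterate_succ_apply)

namespace Circuit

variable {n : ℕ} {C : Circuit n} {ρ ρ' : ℕ → Option Bool} {b : Bool}

namespace Top

variable {g h i j : ℕ} {c d so so' : Bool}

/-- Fixing `i = c` makes `g` constant and turns `h` into a literal of `j`, so the only reader `q` of
`h` inherits `j`. The gate `p` just passes its other input, and that is not a literal of `j`,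
because `p` reads neither `j` nor `h`. -/
theorem single_of_ne (ht : C.Top ρ g i c j d so) (hh : C.Top ρ h i (!c) j (!d) so') {p z q : ℕ}
    (hti : C.Tight ρ g i c h p z)
    (hj : ∀ k, C.Live ρ k → C.Reads ρ k j → k = g ∨ k = h) (hpg : C.Reads ρ p g)
    (hq : ∀ k, C.Live ρ k → C.Reads ρ k h → k = q) (hpq : p ≠ q) : C.Single (fix ρ i c) j := by
  have hρ := extends_fix ht.left_free c
  have hjn := ht.right_lt
  have key : ∀ r t, C.Live ρ r → C.res (fix ρ i c) r = lit j t → r ≠ p → r = j ∨ r = h := by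
    intro r t hr hrt hrp
    rcases Nat.lt_or_ge r n with hrn | hrn
    · exact .inl (eq_of_res_lit hrn hrt)
    · rcases hti.killed r hrn hr (not_live_of_res_lit hrt (by omega)) with rfl | h | h
      · rw [ht.res_kill] at hrt
        cases hrt
      · exact .inr h
      · exact absurd h hrp
  have hp : ∀ t, C.res (fix ρ i c) p ≠ lit j t := by
    intro t hpt
    obtain ⟨s, v, sv, w, hb⟩ := hpg
    have hs : so = !s := by
      refine Bool.eq_not_of_ne ?_
      rintro rfl
      exact hti.third_not_const _ (hb.res_kill hρ ht.res_kill)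
    rw [hb.res_pass hρ (hs ▸ ht.res_kill)] at hpt
    have hv := hti.live_third.step hb.symm.reads
    rcases key v _ hv (exists_lit_of_flip hpt) hb.symm.left.1.ne with rfl | rfl
    · rcases hj p hti.live_third hb.symm.reads with rfl | rfl
      · exact ht.not_reads_gate ht.bin.ge hb.reads
      · exact hh.not_reads_gate ht.bin.ge hb.reads
    · exact hpq (hq _ hti.live_third hb.symm.reads)
  have key' : ∀ k, C.Live (fix ρ i c) k → C.Reads (fix ρ i c) k j → k = q := by
    rintro k hk ⟨_, _, _, _, hb⟩
    obtain ⟨r, s, r', s', hb', h₁, -⟩ := hb.of_extends hρ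
    have hk' := hk.mono hρ
    rcases key r _ (hk'.step hb'.reads) (exists_lit_of_flip h₁)
      (by rintro rfl; exact hp _ (exists_lit_of_flip h₁)) with rfl | rfl
    · have hres := hk.res_self
      rcases hj k hk' hb'.reads with rfl | rfl
      · rw [ht.res_kill] at hres
        cases hres
      · rw [hh.res_pass, lit.injEq] at hres
        have := hh.bin.ge
        omega
    · exact hq k hk' hb'.reads
  exact fun k k' hk hk' hkj hkj' => (key' k hk hkj).trans (key' k' hk' hkj').symm

/-- The variables `i` and `j` reach the output only through `p`, whose value is a function of these
two bits. Since `g` and `h` have opposite killing values, a finite check shows that either some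
value of `j` makes this function independent of `i`, or it is invariant under flipping both bits. -/
theorem good_or_val_flip (ht : C.Top ρ g i c j d so) (hh : C.Top ρ h i (!c) j (!d) so') {p : ℕ}
    (hi : ∀ k, C.Live ρ k → C.Reads ρ k i → k = g ∨ k = h)
    (hj : ∀ k, C.Live ρ k → C.Reads ρ k j → k = g ∨ k = h)
    (hg : ∀ k, C.Live ρ k → C.Reads ρ k g → k = p)
    (hhp : ∀ k, C.Live ρ k → C.Reads ρ k h → k = p) (hpg : C.Reads ρ p g) (hph : C.Reads ρ p h)
    (hgh : g ≠ h)
    (ho : ∀ r s, C.res ρ C.out = lit r s → n ≤ r ∧ r ≠ g ∧ r ≠ h) :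
    C.Good b ρ ∨ ∀ x, Agrees n ρ x →
      C.val (update (update x i (!x i)) j (!x j)) C.out = C.val x C.out := by
  obtain ⟨s, t, w, hb⟩ := hpg.bin hph hgh
  have hval : ∀ x, Agrees n ρ x → C.val x p =
      ((((((x i ^^ c) && (x j ^^ d)) ^^ so) ^^ s) &&
        ((((x i ^^ !c) && (x j ^^ !d)) ^^ so') ^^ t)) ^^ w) := by
    intro x hx
    rw [hb.val hx, ht.val hx, hh.val hx]
  have hcases : ∀ c d so so' s t w : Bool,
      (∃ a u, ∀ e, ((((((e ^^ c) && (a ^^ d)) ^^ so) ^^ s) &&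
        ((((e ^^ !c) && (a ^^ !d)) ^^ so') ^^ t)) ^^ w) = u) ∨
      ∀ e a, ((((((!e ^^ c) && (!a ^^ d)) ^^ so) ^^ s) &&
        ((((!e ^^ !c) && (!a ^^ !d)) ^^ so') ^^ t)) ^^ w) =
        ((((((e ^^ c) && (a ^^ d)) ^^ so) ^^ s) &&
        ((((e ^^ !c) && (a ^^ !d)) ^^ so') ^^ t)) ^^ w) := by
    decide
  rcases hcases c d so so' s t w with ⟨a, u, hau⟩ | hflip
  · exact .inl (ht.good_of_funnel (a := a) (t := u) hi (fun k hk hkg => .inr (hg k hk hkg)) hhp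
      (fun x hx hxa => by rw [hval x hx, hxa, hau]) ho)
  · refine .inr fun x hx => ?_
    have hx' : Agrees n ρ (update (update x i (!x i)) j (!x j)) :=
      (hx.update ht.left_free _).update ht.right_free _
    refine val_out_eq hx' hx (fun v => v = i ∨ v = j ∨ v = g ∨ v = h) (fun v _ hv => ?_)
      (fun q v hq hqS hv hqv => ?_) (fun r s hr hS => ?_)
    · simp only [not_or] at hv
      rw [update_of_ne hv.2.1, update_of_ne hv.1]
    · have hqp : q = p := by
        rcases hv with rfl | rfl | rfl | rfl
        · rcases hi q hq hqv with rfl | rfl <;> simp at hqS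
        · rcases hj q hq hqv with rfl | rfl <;> simp at hqS
        · exact hg q hq hqv
        · exact hhp q hq hqv
      subst hqp
      rw [hval _ hx', hval _ hx, update_self, update_of_ne ht.ne, update_self, hflip]
    · obtain ⟨h₁, h₂, h₃⟩ := ho r s hr
      rcases hS with rfl | rfl | hS | hS
      · exact absurd ht.left_lt (by omega)
      · exact absurd ht.right_lt (by omega)
      · exact h₂ hS
      · exact h₃ hS

/-- Flipping both `i` and `j` preserves output and parity, so an error with the wrong value of `i`
yields one with the right value. This carries the existence of an error to the smaller cube. -/
theorem exists_errs_fix (ht : C.Top ρ g i c j d so)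
    (hflip : ∀ x, Agrees n ρ x →
      C.val (update (update x i (!x i)) j (!x j)) C.out = C.val x C.out)
    {x : ℕ → Bool} (hx : Agrees n ρ x) (he : C.Errs b x) :
    ∃ y, Agrees n (fix ρ i c) y ∧ C.Errs b y := by
  by_cases hc : x i = c
  · exact ⟨x, hx.fix hc, he⟩
  · have hc : (!x i) = c := by
      rw [Bool.not_eq_eq_eq_not]
      exact Bool.eq_not_of_ne hc
    refine ⟨_, ((hx.update ht.left_free (!x i)).update ht.right_free (!x j)).fix ?_, ?_⟩
    · rw [update_of_ne ht.ne, update_self, hc]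
    · have h₁ := xorFn_flip b x ht.left_lt
      have h₂ := xorFn_flip b (update x i (!x i)) ht.right_lt
      rw [update_of_ne ht.ne.symm, h₁, Bool.not_not] at h₂
      rw [Errs, h₂]
      have := hflip x hx
      change C.val _ _ ≠ _
      rw [this]
      exact he

end Top

/-! ### Circuits of the critical size -/

/-- A failure is found by at most one deviation from the path that the function `nxt` describes. -/
def Found (C : Circuit n) (b : Bool) (nxt : (ℕ → Option Bool) → ℕ → Option Bool) (m : ℕ)
    (ρ : ℕ → Option Bool) : Prop :=
  ∃ k ≤ m, C.Good b (nxt^[k] ρ) ∨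
    ∃ i < n, ∃ c, ∃ k' ≤ m, C.Good b (nxt^[k'] (fix (nxt^[k] ρ) i c))

variable {nxt : (ℕ → Option Bool) → ℕ → Option Bool} {m : ℕ}

theorem Good.found (h : C.Good b ρ) : C.Found b nxt m ρ := ⟨0, by omega, .inl h⟩

theorem found_of_fix {i : ℕ} (hi : i < n) {c : Bool}
    (h : ∃ k ≤ m, C.Good b (nxt^[k] (fix ρ i c))) : C.Found b nxt (m + 1) ρ := by
  obtain ⟨k, hk, h⟩ := h
  exact ⟨0, by omega, .inr ⟨i, hi, c, k, by omega, h⟩⟩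

theorem Found.succ (h : C.Found b nxt m (nxt ρ)) : C.Found b nxt (m + 1) ρ := by
  obtain ⟨k, hk, h | ⟨i, hi, c, k', hk', h⟩⟩ := h
  · exact ⟨k + 1, by omega, .inl (by rwa [iterate_succ_apply])⟩
  · exact ⟨k + 1, by omega, .inr ⟨i, hi, c, k', by omega, by rwa [iterate_succ_apply]⟩⟩

/-- If fixing a variable does not eliminate exactly three gates, then a failure is found. -/
theorem Top.found_or_tight (hc : C.Chooses nxt) {g i j o : ℕ} {s c d so : Bool}
    (ht : C.Top ρ g i c j d so) (ho : C.res ρ C.out = lit o s) (hon : n ≤ o)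
    (hm : freeCount n ρ = m + 1) (hcard : (C.liveGates ρ).card + 3 ≤ 3 * (m + 1)) :
    C.Found b nxt (m + 1) ρ ∨
      (∃ h p z, C.Tight ρ g i c h p z) ∧ (∀ a, C.res (fix ρ i c) C.out ≠ const a) ∧
        freeCount n (fix ρ i c) = m ∧ (C.liveGates (fix ρ i c)).card + 3 ≤ 3 * m := by
  have hfc := freeCount_fix ht.left_lt ht.left_free c
  rcases ht.two_le_card_readers (b := b) ho hon with hg | h2
  · exact .inl hg.found
  by_cases hconst : ∃ a, C.res (fix ρ i c) C.out = const a
  · obtain ⟨a, ha⟩ := hconst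
    exact .inl (ht.good_of_const ha).found
  push Not at hconst
  have hd := ht.drop ht.live ht.bin.ge ht.res_kill hconst
  by_cases hlt : (C.liveGates (fix ρ i c)).card + 4 ≤ (C.liveGates ρ).card
  · exact .inl (found_of_fix ht.left_lt (exists_good_of_card_lt hc m (fix ρ i c) (by omega) (by omega)))
  · exact .inr ⟨ht.exists_tight ht.live ht.bin.ge ht.res_kill hconst (by omega) h2, hconst,
      by omega, by omega⟩

theorem found_of_single (hc : C.Chooses nxt) {i j l : ℕ} {c : Bool} (hi : i < n) (hj : j < n)
    (hij : j ≠ i) (hjf : ρ j = none) (hm : freeCount n (fix ρ i c) = m)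
    (hcard : (C.liveGates (fix ρ i c)).card + 3 ≤ 3 * m) (hl : C.Live (fix ρ i c) l) (hln : n ≤ l)
    (hs : C.Single (fix ρ i c) j) : C.Found b nxt (m + 1) ρ := by
  -- A live gate gives `4 ≤ 3 * m`, so at least two variables are free, as `exists_good_of_single`
  -- requires.
  have := Finset.card_pos.2 ⟨l, mem_liveGates.2 ⟨hln, hl⟩⟩
  exact found_of_fix hi (exists_good_of_single hc hj m _ hm (by omega) hcard
    (by rw [fix, update_of_ne hij, hjf]) hs)

/-- The eliminations at `i` and at `j` may be assumed tight; let `h` and `h'` be the second readers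
of `i` and `j`. If `h = h'`, an equal killing value of one variable is a failure. With opposite
values, distinct gates above `g` and `h` leave `j` a single reader, while a common one gives
invariance under flipping. If `h ≠ h'`, either one of them survives the elimination at the other
variable, which leaves a single reader, or each is the third victim of the other elimination, which
gives a chain. -/
theorem found_of_errs (hc : C.Chooses nxt) (m : ℕ) : ∀ ρ, freeCount n ρ = m →
    (C.liveGates ρ).card + 3 ≤ 3 * m → (∃ x, Agrees n ρ x ∧ C.Errs b x) →
    C.Found b nxt m ρ := by
  induction m with
  | zero => intro ρ _ h; omega
  | succ m ih =>
    rintro ρ hm hcard ⟨x, hx, he⟩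
    by_cases hm0 : m = 0
    · subst hm0
      exact (good_of_freeCount_eq_one hm hx he).found
    rcases good_or_gate (C := C) (b := b) (ρ := ρ) (by omega) with hg | ⟨o, s, ho, hon⟩
    · exact hg.found
    obtain ⟨g, i, c, j, d, so, ht, hnxt⟩ := hc ρ o s ho hon
    rcases ht.found_or_tight hc (b := b) ho hon hm hcard with
      hf | ⟨⟨h, p, z, hti⟩, hci, hmi, hcardi⟩
    · exact hf
    rcases ht.symm.found_or_tight hc (b := b) ho hon hm hcard with
      hf | ⟨⟨h', p', z', htj⟩, hcj, hmj, hcardj⟩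
    · exact hf
    have hon' : ∀ r s, C.res ρ C.out = lit r s → n ≤ r := by
      intro r s hr
      rw [ho] at hr
      cases hr
      exact hon
    by_cases hh : h = h'
    · subst hh
      obtain ⟨c', d', so', hb⟩ := hti.reads_second.bin htj.reads_second ht.ne
      have hth : C.Top ρ h i c' j d' so' := ⟨hti.live_second, hb, ht.left_lt, ht.right_lt⟩
      by_cases hc' : c' = c
      · subst hc'
        exact (ht.good_of_kill_both hth ho hon htj.eq_of_reads).found
      by_cases hd' : d' = d
      · subst hd'
        exact (ht.symm.good_of_kill_both hth.symm ho hon hti.eq_of_reads).found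
      obtain rfl := Bool.eq_not_of_ne hc'
      obtain rfl := Bool.eq_not_of_ne hd'
      -- The elimination with the opposite value of `i`, which kills `h` instead of `g`, identifies
      -- the reader `q` of `h`.
      rcases hth.found_or_tight hc (b := b) ho hon hm hcard with
        hf | ⟨⟨g', q, z₂, hth'⟩, hch, -, -⟩
      · exact hf
      have hg' : g' = g := by
        rcases hth'.eq_of_reads g ht.live ht.bin.reads with h | h
        · exact absurd h.symm hti.second_ne
        · exact h.symm
      subst hg'
      have hresh : C.res (fix ρ i c) h = lit j ((!d) ^^ so') := hth.res_pass
      have hresg : C.res (fix ρ i (!c)) g' = lit j (d ^^ so) :=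
        Top.res_pass (c := !c) (by rwa [Bool.not_not])
      have hpg : C.Reads ρ p g' := by
        rcases hti.eq_or with h | h
        · exact h ▸ hti.third_reads
        · obtain ⟨a, ha⟩ := hti.const
          rw [h, hresh] at ha
          cases ha
      have hqh : C.Reads ρ q h := by
        rcases hth'.eq_or with h | h
        · exact h ▸ hth'.third_reads
        · obtain ⟨a, ha⟩ := hth'.const
          rw [h, hresg] at ha
          cases ha
      have hgr : ∀ k, C.Live ρ k → C.Reads ρ k g' → k = p := by
        intro k hk hkg
        rcases ht.eq_of_reads_const hti ht.res_kill hk hkg with rfl | rfl | h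
        · exact absurd hkg.lt (lt_irrefl _)
        · exact absurd hkg (hth.not_reads_gate ht.bin.ge)
        · exact h
      have hhr : ∀ k, C.Live ρ k → C.Reads ρ k h → k = q := by
        intro k hk hkh
        rcases hth.eq_of_reads_const hth' hth.res_kill hk hkh with rfl | rfl | h
        · exact absurd hkh.lt (lt_irrefl _)
        · exact absurd hkh (ht.not_reads_gate hth.bin.ge)
        · exact h
      by_cases hpq : p = q
      · subst hpq
        rcases ht.good_or_val_flip (b := b) hth hti.eq_of_reads htj.eq_of_reads hgr hhr hpg hqh
          hti.second_ne.symm (fun r s hr => ⟨hon' r s hr,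
            not_eq_of_res_const (extends_fix ht.left_free _) ht.res_kill hci r s hr,
            not_eq_of_res_const (extends_fix ht.left_free _) hth.res_kill hch r s hr⟩) with
          hg | hflip
        · exact hg.found
        -- The restriction is the one chosen by `nxt`, so the induction continues along the path and
        -- the one allowed deviation remains available.
        · have := ih (fix ρ i c) hmi hcardi (ht.exists_errs_fix hflip hx he)
          rw [← hnxt] at this
          exact this.succ
      · have hql : C.Live (fix ρ i c) q := by
          by_contra hql
          rcases hti.killed q hqh.ge hth'.live_third hql with rfl | rfl | h
          · exact ht.not_reads_gate hth.bin.ge hqh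
          · exact hqh.lt.ne rfl
          · exact hpq h.symm
        exact found_of_single hc ht.left_lt ht.right_lt ht.ne.symm ht.right_free hmi hcardi hql
          hqh.ge (ht.single_of_ne hth hti htj.eq_of_reads hpg hhr hpq)
    · by_cases hl' : C.Live (fix ρ i c) h'
      · exact found_of_single hc ht.left_lt ht.right_lt ht.ne.symm ht.right_free hmi hcardi hl'
          htj.reads_second.ge (ht.single_of_live htj.eq_of_reads hl' htj.reads_second.ge)
      by_cases hl : C.Live (fix ρ j d) h
      · exact found_of_single hc ht.right_lt ht.left_lt ht.ne ht.left_free hmj hcardj hl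
          hti.reads_second.ge (ht.symm.single_of_live hti.eq_of_reads hl hti.reads_second.ge)
      obtain rfl : h' = p := by
        rcases hti.killed h' htj.reads_second.ge htj.live_second hl' with h₁ | h₁ | h₁
        · exact absurd h₁ htj.second_ne
        · exact absurd h₁.symm hh
        · exact h₁
      obtain rfl : h = p' := by
        rcases htj.killed h hti.reads_second.ge hti.live_second hl with h₁ | h₁ | h₁
        · exact absurd h₁ hti.second_ne
        · exact absurd h₁ hh
        · exact h₁
      have hr := hti.third_reads
      have hr' := htj.third_reads
      rcases hti.eq_or with rfl | rfl
      · exact (ht.symm.good_of_chain ho hon hcj htj hti.reads_second hr).found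
      · rcases htj.eq_or with rfl | rfl
        · exact (ht.good_of_chain ho hon hci hti htj.reads_second hr').found
        -- The two gates cannot read each other.
        · exact absurd (hr.lt.trans hr'.lt) (lt_irrefl _)

end Circuit

end DeMorgan

namespace DeMorgan

open RVal

open Function (update update_self update_of_ne update_eq_self iterate_succ_apply)

/-! ### Correctness of the abstract evaluation -/

namespace Gate

def token : Gate → Checker.Token
  | .and i j => (.and, [i, j])
  | .or i j => (.or, [i, j])
  | .not i => (.not, [i])

def absVal (vs : List AbsVal) : Gate → AbsVal
  | .and i j => AbsVal.and (vs.getD i AbsVal.false) (vs.getD j AbsVal.false)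
  | .or i j => AbsVal.neg (AbsVal.and (AbsVal.neg (vs.getD i AbsVal.false))
      (AbsVal.neg (vs.getD j AbsVal.false)))
  | .not i => AbsVal.neg (vs.getD i AbsVal.false)

theorem evalStep_token (vs : List AbsVal) (g : Gate) :
    Checker.evalStep vs g.token = vs ++ [g.absVal vs] := by
  cases g <;> rfl

end Gate

namespace Circuit

variable {n : ℕ} {C : Circuit n} {ρ ρ' : ℕ → Option Bool} {b : Bool}

/-- A restriction as a list. -/
def absInputs (n : ℕ) (ρ : ℕ → Option Bool) : List AbsVal :=
  (List.range n).map fun i => (i, (ρ i).isSome, false, (ρ i).getD false)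

variable (C) in
def absRes (ρ : ℕ → Option Bool) (k : ℕ) : AbsVal :=
  (C.gates.foldl (fun vs g => vs ++ [g.absVal vs]) (absInputs n ρ)).getD k AbsVal.false

variable (C) in
def tokens : List Checker.Token := C.gates.map Gate.token ++ [(.out, [C.out])]

theorem absEval_tokens : Checker.absEval (C.tokens, absInputs n ρ) = C.absRes ρ C.out := by
  simp only [Checker.absEval, tokens, List.foldl_append, List.foldl_map, Gate.evalStep_token,
    List.foldl_cons, List.foldl_nil]
  simp only [Checker.evalStep, List.reverse_append, List.reverse_singleton, List.singleton_append,
    List.headD_cons]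
  rfl

variable (C) in
/-- The abstract value describes the value of a node. -/
inductive Rep (ρ : ℕ → Option Bool) : AbsVal → RVal → Prop
  | const (i : ℕ) (b : Bool) : Rep ρ (i, true, false, b) (const b)
  | input {i : ℕ} (hi : i < n) (s : Bool) : Rep ρ (i, false, false, s) (lit i s)
  | gate {r i : ℕ} (hr : n ≤ r) (s c : Bool)
      (h : C.Live ρ r → ∃ g j d so, C.Top ρ g i c j d so) : Rep ρ (i, false, true, c) (lit r s)

theorem Rep.neg {a : AbsVal} {u : RVal} (h : C.Rep ρ a u) : C.Rep ρ a.neg (u.flip true) := by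
  cases h with
  | const i b => rw [flip_const, Bool.xor_true]; exact .const _ _
  | input hi s => rw [flip_lit, Bool.xor_true]; exact .input hi _
  | gate hr s c h => exact .gate hr _ _ h

theorem Rep.and {a a' : AbsVal} {u u' : RVal} (h : C.Rep ρ a u) (h' : C.Rep ρ a' u')
    {w : RVal} (hw : conj n u u' = some w) : C.Rep ρ (a.and a') w := by
  have hf : C.Rep ρ AbsVal.false (RVal.const false) := .const _ _
  cases h with
  | const i b =>
    cases b <;> cases hw
    · exact hf
    · exact h'
  | input hi s =>
    cases h' with
    | const i' b =>
      cases b <;> cases hw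
      · exact hf
      · exact .input hi s
    | @input i' hi' s' =>
      simp only [conj] at hw
      split_ifs at hw with h₁ h₂
      · cases hw
        obtain ⟨rfl, -⟩ := h₁
        subst h₂
        simpa [AbsVal.and] using Rep.input hi s
      · cases hw
        obtain ⟨rfl, -⟩ := h₁
        have h₃ : (s ^^ s') = true := by cases s <;> cases s' <;> simp_all
        simpa [AbsVal.and, h₃] using hf
    | gate hr' s' c' h' =>
      simp only [conj] at hw
      rw [if_neg (by omega)] at hw
      cases hw
  | gate hr s c h =>
    cases h' with
    | const i' b =>
      cases b <;> cases hw
      · exact hf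
      · exact .gate hr s c h
    | input hi' s' =>
      simp only [conj] at hw
      rw [if_neg (by omega)] at hw
      cases hw
    | gate hr' s' c' h' =>
      simp only [conj] at hw
      rw [if_neg (by omega)] at hw
      cases hw

/-- A live gate that reads two variables is itself the gate proposed. Otherwise one of its inputs is
a gate, live whenever `k` is, and its proposal is inherited. -/
theorem Rep.and_gate {a a' : AbsVal} {k r r' : ℕ} {s s' so : Bool} (h : C.Rep ρ a (lit r s))
    (h' : C.Rep ρ a' (lit r' s')) (hb : C.Bin ρ k r s r' s' so) (t : Bool) :
    C.Rep ρ (a.and a') (lit k t) := by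
  cases h with
  | input hi s =>
    cases h' with
    | input hi' s' =>
      have hne : r ≠ r' := by
        obtain ⟨_, _, _, _, -, -, -, h'⟩ := hb
        exact fun e => h' ⟨e, hi⟩
      have : AbsVal.and (r, false, false, s) (r', false, false, s') = (r, false, true, s) := by
        simp [AbsVal.and, beq_eq_false_iff_ne.2 hne]
      rw [this]
      exact .gate hb.ge _ _ fun hl => ⟨k, r', s', so, hl, hb, hi, hi'⟩
    | gate hr' s' c' h' => exact .gate hb.ge _ _ fun hl => h' (hl.step hb.symm.reads)
  | gate hr s c h =>
    cases h' with
    | input hi' s' => exact .gate hb.ge _ _ fun hl => h (hl.step hb.reads)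
    | gate hr' s' c' h' => exact .gate hb.ge _ _ fun hl => h (hl.step hb.reads)

/-- Here `u` is the conjunction before the sign `so` is added; the implication treats AND (`so =
false`) and OR (`so = true`) at once. -/
theorem Rep.isBin {k i j : ℕ} {si sj so : Bool} (hk : C.IsBin k i si j sj so) {a a' : AbsVal}
    (h : C.Rep ρ a ((C.res ρ i).flip si)) (h' : C.Rep ρ a' ((C.res ρ j).flip sj)) :
    ∃ u, C.Rep ρ (a.and a') u ∧ ∀ a, (so = false ∧ C.Rep ρ a u ∨
      so = true ∧ C.Rep ρ a (u.flip true)) → C.Rep ρ a (C.res ρ k) := by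
  rw [hk.res ρ]
  rcases hc : conj n ((C.res ρ i).flip si) ((C.res ρ j).flip sj) with _ | w
  · obtain ⟨r, s, r', s', h₁, h₂, h₃⟩ := conj_eq_none hc
    rw [h₁] at h
    rw [h₂] at h'
    refine ⟨lit k so, h.and_gate h' (so := so) ⟨i, si, j, sj, hk, h₁, h₂, h₃⟩ _, ?_⟩
    rintro a (⟨rfl, h⟩ | ⟨rfl, h⟩) <;> exact h
  · refine ⟨w, h.and h' hc, ?_⟩
    rintro a (⟨rfl, h⟩ | ⟨rfl, h⟩)
    · simpa using h
    · exact h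

theorem length_absInputs : (absInputs n ρ).length = n := by
  rw [absInputs, List.length_map, List.length_range]

theorem rep_absRes (k : ℕ) : C.Rep ρ (C.absRes ρ k) (C.res ρ k) := by
  induction k using Nat.strong_induction_on with
  | _ k ih =>
    rcases Nat.lt_or_ge k n with hk | hk
    · rw [res_input hk, inputRVal, absRes,
        scan_getD_of_lt _ _ _ _ (by rwa [length_absInputs]), absInputs, List.getD_eq_getElem?_getD,
        List.getElem?_map, List.getElem?_range hk]
      rcases hρ : ρ k with _ | b
      · simpa [hρ] using Rep.input hk _
      · simpa [hρ] using Rep.const _ _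
    rcases Nat.lt_or_ge k (n + C.gates.length) with h' | h'
    · have hlt : k - n < C.gates.length := by omega
      have hg : C.gates[k - n]? = some C.gates[k - n] := List.getElem?_eq_getElem hlt
      have habs := scan_getD_gate (fun vs g => Gate.absVal vs g) AbsVal.false (absInputs n ρ)
        C.gates hlt
      have hvs : ∀ i < k, C.Rep ρ ((scanTo (fun vs g => Gate.absVal vs g) (absInputs n ρ) C.gates
          (k - n)).getD i AbsVal.false) (C.res ρ i) := by
        intro i hi
        rw [scanTo_getD _ _ _ _ hlt.le (by rw [length_absInputs]; omega)]
        exact ih i hi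
      rw [length_absInputs, show n + (k - n) = k by omega] at habs
      rw [absRes, habs]
      have hr := gate_readsBelow hk hg
      rcases hgk : C.gates[k - n] with ⟨i, j⟩ | ⟨i, j⟩ | i <;> rw [hgk] at hg hr
      · have hb : C.IsBin k i false j false false := ⟨hk, .inl ⟨.inl hg, rfl, rfl, rfl⟩⟩
        obtain ⟨u, hu, h⟩ := Rep.isBin (ρ := ρ) hb (by rw [flip_false]; exact hvs i hr.1)
          (by rw [flip_false]; exact hvs j hr.2)
        exact h _ (.inl ⟨rfl, hu⟩)
      · have hb : C.IsBin k i true j true true := ⟨hk, .inr ⟨.inl hg, rfl, rfl, rfl⟩⟩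
        obtain ⟨u, hu, h⟩ := Rep.isBin (ρ := ρ) hb (hvs i hr.1).neg (hvs j hr.2).neg
        exact h _ (.inr ⟨rfl, hu.neg⟩)
      · rw [IsNot.res ⟨hk, hg⟩]
        exact (hvs i hr).neg
    · rw [res_of_ge h', absRes, List.getD_eq_default]
      · exact .const _ _
      · rw [length_scan, length_absInputs]
        exact h'

variable (C) in
/-- The next restriction. -/
def nextRestriction (ρ : ℕ → Option Bool) : ℕ → Option Bool :=
  cond ((C.absRes ρ C.out).2.2.1 && !(C.absRes ρ C.out).2.1)
    (fix ρ (C.absRes ρ C.out).1 (C.absRes ρ C.out).2.2.2) ρ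

/-- The representative of the output is live, so the proposal in its abstract value belongs to a
genuine gate reading two variables. -/
theorem chooses_nextRestriction : C.Chooses C.nextRestriction := by
  intro ρ o s ho hon
  have h := C.rep_absRes (ρ := ρ) C.out
  rw [ho] at h
  rw [nextRestriction]
  generalize C.absRes ρ C.out = a at h
  cases h with
  | input hi s => omega
  | gate hr s c h =>
    obtain ⟨g, j, d, so, ht⟩ := h (.out ho)
    exact ⟨g, _, c, j, d, so, ht, rfl⟩

/-- A smallest node that represents itself would be a free variable, since a proper gate reads a
smaller node of this kind. -/
theorem exists_res_eq_const (h : ∀ i < n, ρ i ≠ none) (k : ℕ) : ∃ a, C.res ρ k = const a := by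
  have key : ∀ r, C.res ρ r ≠ lit r false := by
    intro r
    induction r using Nat.strong_induction_on with
    | _ r ih =>
      intro hr
      rcases (res_lit hr).2.2 with h' | ⟨q, t, q', t', so, hb⟩
      · exact h r h'.1 h'.2
      · exact ih q hb.left.1 hb.left.2
  rcases hk : C.res ρ k with a | ⟨r, s⟩
  · exact ⟨a, rfl⟩
  · exact absurd (res_lit hk).2.1 (key r)

/-- On total assignments the abstract evaluation is ordinary evaluation, so the same routine also
tests the candidates. -/
theorem absRes_total (x : ℕ → Bool) :
    (C.absRes (fun i => some (x i)) C.out).2.2.2 = C.eval fun i => x i := by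
  obtain ⟨a, ha⟩ := C.exists_res_eq_const (ρ := fun i => some (x i)) (by simp) C.out
  have h := C.rep_absRes (ρ := fun i => some (x i)) C.out
  have hv : C.val x C.out = a := val_of_res_const (fun i _ b hb => Option.some.inj hb) ha
  rw [ha] at h
  change _ = C.val x C.out
  rw [hv]
  generalize C.absRes _ C.out = e at h
  cases h
  rfl

end Circuit

end DeMorgan

namespace DeMorgan

open RVal

open Function (update update_self update_of_ne update_eq_self iterate_succ_apply)

namespace Circuit

variable {n : ℕ} {C : Circuit n} {ρ ρ' : ℕ → Option Bool} {b : Bool}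

/-! ### Correctness of the search -/

theorem setVar_absInputs (i : ℕ) (c : Bool) :
    Checker.setVar (absInputs n ρ) i c = absInputs n (fix ρ i c) := by
  rw [Checker.setVar, absInputs, absInputs, List.map_map]
  refine List.map_congr_left fun j _ => ?_
  by_cases hj : j = i
  · subst hj
    simp [fix]
  · simp [fix, hj, beq_eq_false_iff_ne.2 hj]

theorem free_eq_absInputs : Checker.free n = absInputs n fun _ => none := rfl

theorem fill_absInputs :
    Checker.fill (absInputs n ρ) = absInputs n fun i => some (zeroFill ρ i) := by
  rw [Checker.fill, absInputs, absInputs, List.map_map]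
  refine List.map_congr_left fun j _ => ?_
  rcases h : ρ j with _ | _ <;> simp [Checker.bit, zeroFill, h]

theorem map_bit_absInputs :
    (absInputs n ρ).map Checker.bit = List.ofFn fun i : Fin n => zeroFill ρ i := by
  rw [absInputs, List.map_map, List.ofFn_eq_map, ← List.map_coe_finRange_eq_range, List.map_map]
  refine List.map_congr_left fun i _ => ?_
  rcases h : ρ i with _ | _ <;> simp [Checker.bit, zeroFill, h]

theorem foldl_xor (x : ℕ → Bool) (b : Bool) (n : ℕ) :
    (List.range n).foldl (fun p i => p ^^ x i) b = xorFn n b fun i => x i := by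
  induction n with
  | zero => cases b <;> simp [xorFn]
  | succ n ih =>
    rw [List.range_succ, List.foldl_append, ih, List.foldl_cons, List.foldl_nil, xorFn, xorFn,
      Fin.sum_univ_castSucc]
    simp only [Fin.val_castSucc, Fin.val_last]
    rw [Bool.eq_iff_iff]
    cases x n
    · simp
    · simp only [Bool.xor_true, Bool.not_eq_true', decide_eq_false_iff_not, decide_eq_true_eq,
        Bool.toNat_true, Nat.odd_iff]
      omega

theorem parity_absInputs :
    Checker.parity b (absInputs n ρ) = xorFn n b fun i => zeroFill ρ i := by
  rw [Checker.parity, absInputs, List.foldl_map, ← foldl_xor]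
  congr 1
  funext p i
  rcases h : ρ i with _ | _ <;> simp [Checker.bit, zeroFill, h]

theorem fails_absInputs :
    Checker.fails b C.tokens (absInputs n ρ) = true ↔ C.Errs b (zeroFill ρ) := by
  rw [Checker.fails, fill_absInputs, absEval_tokens, absRes_total, parity_absInputs, Errs]
  exact bne_iff_ne

theorem next_absInputs :
    Checker.next C.tokens (absInputs n ρ) = absInputs n (C.nextRestriction ρ) := by
  rw [Checker.next, absEval_tokens, setVar_absInputs, nextRestriction]
  cases (C.absRes ρ C.out).2.2.1 && !(C.absRes ρ C.out).2.1 <;> rfl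

theorem next_iterate_absInputs (k : ℕ) :
    (Checker.next C.tokens)^[k] (absInputs n ρ) = absInputs n (C.nextRestriction^[k] ρ) := by
  induction k generalizing ρ with
  | zero => rfl
  | succ k ih => rw [iterate_succ_apply, iterate_succ_apply, next_absInputs, ih]

theorem path_absInputs : Checker.path C.tokens (absInputs n ρ) =
    (List.range (n + 1)).map fun k => absInputs n (C.nextRestriction^[k] ρ) := by
  rw [Checker.path, List.range_succ_eq_map, List.map_cons]
  congr 1
  rw [absInputs, List.map_map, List.map_map]
  exact List.map_congr_left fun k _ => next_iterate_absInputs (k + 1)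

theorem mods_absInputs : Checker.mods (absInputs n ρ) =
    absInputs n ρ :: (List.range n).flatMap fun i =>
      [absInputs n (fix ρ i false), absInputs n (fix ρ i true)] := by
  rw [Checker.mods]
  congr 1
  simp only [setVar_absInputs]
  conv_lhs => rw [absInputs]
  rw [List.flatMap_map]

theorem mem_path {k : ℕ} (hk : k ≤ n) :
    absInputs n (C.nextRestriction^[k] ρ) ∈ Checker.path C.tokens (absInputs n ρ) := by
  rw [path_absInputs, List.mem_map]
  exact ⟨k, List.mem_range.2 (by omega), rfl⟩

theorem mem_mods_self : absInputs n ρ ∈ Checker.mods (absInputs n ρ) := List.mem_cons_self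

theorem mem_mods {i : ℕ} (hi : i < n) (c : Bool) :
    absInputs n (fix ρ i c) ∈ Checker.mods (absInputs n ρ) := by
  rw [mods_absInputs]
  refine List.mem_cons_of_mem _ (List.mem_flatMap.2 ⟨i, List.mem_range.2 hi, ?_⟩)
  cases c <;> simp

/-- The list consists of restrictions. -/
def AllInputs (n : ℕ) (l : List (List AbsVal)) : Prop := ∀ τ ∈ l, ∃ ρ, τ = absInputs n ρ

theorem AllInputs.flatMap {l : List (List AbsVal)} {f : List AbsVal → List (List AbsVal)}
    (hl : AllInputs n l) (hf : ∀ ρ, AllInputs n (f (absInputs n ρ))) :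
    AllInputs n (l.flatMap f) := by
  intro τ hτ
  obtain ⟨σ, hσ, hτ⟩ := List.mem_flatMap.1 hτ
  obtain ⟨ρ, rfl⟩ := hl σ hσ
  exact hf ρ τ hτ

theorem allInputs_path : AllInputs n (Checker.path C.tokens (absInputs n ρ)) := by
  intro τ hτ
  rw [path_absInputs, List.mem_map] at hτ
  obtain ⟨k, -, rfl⟩ := hτ
  exact ⟨_, rfl⟩

theorem allInputs_mods : AllInputs n (Checker.mods (absInputs n ρ)) := by
  intro τ hτ
  rw [mods_absInputs, List.mem_cons, List.mem_flatMap] at hτ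
  rcases hτ with rfl | ⟨i, -, hτ⟩
  · exact ⟨_, rfl⟩
  · simp only [List.mem_cons, List.not_mem_nil, or_false] at hτ
    rcases hτ with rfl | rfl <;> exact ⟨_, rfl⟩

/-- The search outputs the first failing candidate, which need not be the one whose existence is
proved; so every candidate must be a genuine restriction. -/
theorem allInputs_candidates :
    AllInputs n (Checker.candidates C.tokens (absInputs n ρ)) :=
  ((((allInputs_path.flatMap fun _ => allInputs_mods).flatMap fun _ => allInputs_path).flatMap
    fun _ => allInputs_mods).flatMap fun _ => allInputs_mods).flatMap fun _ => allInputs_mods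

theorem zeroFill_fix (i : ℕ) (c : Bool) : zeroFill (fix ρ i c) = update (zeroFill ρ) i c := by
  funext j
  by_cases hj : j = i
  · subst hj
    simp [zeroFill, fix]
  · simp [zeroFill, fix, hj]

theorem Found.exists_mem_candidates (h : C.Found b C.nextRestriction n ρ) :
    ∃ ρ', absInputs n ρ' ∈ Checker.candidates C.tokens (absInputs n ρ) ∧
      C.Errs b (zeroFill ρ') := by
  have key : ∀ σ, C.Good b σ →
      absInputs n σ ∈ ((Checker.path C.tokens (absInputs n ρ)).flatMap Checker.mods).flatMap
        (Checker.path C.tokens) →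
      ∃ ρ', absInputs n ρ' ∈ Checker.candidates C.tokens (absInputs n ρ) ∧
        C.Errs b (zeroFill ρ') := by
    rintro σ ⟨i, hi, c, i', hi', c', j, hj, d, he⟩ hσ
    rw [← zeroFill_fix, ← zeroFill_fix, ← zeroFill_fix] at he
    exact ⟨_, List.mem_flatMap.2 ⟨_, List.mem_flatMap.2 ⟨_, List.mem_flatMap.2
      ⟨_, hσ, mem_mods hi c⟩, mem_mods hi' c'⟩, mem_mods hj d⟩, he⟩
  obtain ⟨k, hk, h | ⟨i, hi, c, k', hk', h⟩⟩ := h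
  -- Without a deviation the second stretch of the path is empty.
  · exact key _ h (List.mem_flatMap.2 ⟨_, List.mem_flatMap.2 ⟨_, mem_path hk, mem_mods_self⟩,
      mem_path (k := 0) (Nat.zero_le n)⟩)
  · exact key _ h (List.mem_flatMap.2 ⟨_, List.mem_flatMap.2 ⟨_, mem_path hk, mem_mods hi c⟩,
      mem_path hk'⟩)

theorem Found.search (h : C.Found b C.nextRestriction n ρ) :
    ∃ x : Fin n → Bool, Checker.search b C.tokens (absInputs n ρ) = List.ofFn x ∧
      C.eval x ≠ xorFn n b x := by
  obtain ⟨ρ', hmem, he⟩ := h.exists_mem_candidates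
  rw [Checker.search]
  rcases hl : (Checker.candidates C.tokens (absInputs n ρ)).flatMap (fun τ =>
      cond (Checker.fails b C.tokens τ) [τ.map Checker.bit] []) with _ | ⟨w, l⟩
  · rw [List.flatMap_eq_nil_iff] at hl
    have := hl _ hmem
    rw [fails_absInputs.2 he] at this
    cases this
  · have hw : w ∈ (Checker.candidates C.tokens (absInputs n ρ)).flatMap (fun τ =>
        cond (Checker.fails b C.tokens τ) [τ.map Checker.bit] []) := by
      rw [hl]
      exact List.mem_cons_self
    obtain ⟨τ, hτ, hw⟩ := List.mem_flatMap.1 hw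
    obtain ⟨σ, rfl⟩ := allInputs_candidates τ hτ
    rcases hf : Checker.fails b C.tokens (absInputs n σ) with _ | _ <;> rw [hf] at hw
    · cases hw
    · rw [cond_true, List.mem_singleton, map_bit_absInputs] at hw
      exact ⟨_, hw, fails_absInputs.1 hf⟩

/-! ### The number of gates -/

theorem card_le_countP {α : Type} (p : α → Bool) (l : List α) (T : Finset ℕ)
    (h : ∀ k ∈ T, ∃ a, l[k]? = some a ∧ p a = true) : T.card ≤ l.countP p := by
  induction l using List.reverseRecOn generalizing T with
  | nil =>
    have : T = ∅ := Finset.eq_empty_of_forall_notMem fun k hk => by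
      obtain ⟨a, ha, -⟩ := h k hk
      simp at ha
    simp [this]
  | append_singleton l a ih =>
    have h₁ := ih (T.erase l.length) fun k hk => by
      obtain ⟨hne, hk⟩ := Finset.mem_erase.1 hk
      obtain ⟨a', ha', hp⟩ := h k hk
      have hlt := (List.getElem?_eq_some_iff.1 ha').1
      rw [List.length_append, List.length_singleton] at hlt
      rw [List.getElem?_append_left (by omega)] at ha'
      exact ⟨a', ha', hp⟩
    rw [List.countP_append]
    by_cases hT : l.length ∈ T
    · obtain ⟨a', ha', hp⟩ := h _ hT
      rw [List.getElem?_concat_length] at ha'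
      cases ha'
      have := Finset.card_erase_add_one hT
      simp only [List.countP_singleton, hp, if_true]
      omega
    · rw [Finset.erase_eq_of_notMem hT] at h₁
      omega

/-- Live gates are proper conjunctions up to signs, hence binary; NOT gates are absorbed into the
signs of literals. -/
theorem card_liveGates_le_size : (C.liveGates ρ).card ≤ C.size := by
  have hge : ∀ k ∈ C.liveGates ρ, n ≤ k := fun k hk => (mem_liveGates.1 hk).1
  rw [← Finset.card_image_of_injOn (f := fun k => k - n) (s := C.liveGates ρ)]
  · refine card_le_countP _ _ _ fun k hk => ?_
    obtain ⟨k', hk', rfl⟩ := Finset.mem_image.1 hk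
    obtain ⟨hn, hl⟩ := mem_liveGates.1 hk'
    obtain ⟨_, _, _, _, _, _, _, _, _, ⟨-, ⟨h | h, -⟩ | ⟨h | h, -⟩⟩, -⟩ := hl.exists_bin hn <;>
      exact ⟨_, h, rfl⟩
  · intro k hk k' hk' h
    have := hge k hk
    have := hge k' hk'
    simp only at h
    omega

theorem exists_search_eq (hsize : C.size + 3 = 3 * n) (hC : ¬C.Computes (xorFn n b)) :
    ∃ x : Fin n → Bool, Checker.search b C.tokens (Checker.free n) = List.ofFn x ∧
      C.eval x ≠ xorFn n b x := by
  rw [free_eq_absInputs]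
  refine Found.search (found_of_errs chooses_nextRestriction n _ ?_ ?_ ?_)
  · simp [freeCount]
  · have := C.card_liveGates_le_size (ρ := fun _ => none)
    omega
  · rw [Computes] at hC
    push Not at hC
    obtain ⟨x, hx⟩ := hC
    refine ⟨fun i => if h : i < n then x ⟨i, h⟩ else false, fun i _ b h => by simp at h, ?_⟩
    simpa [Errs] using hx

/-! ### Reading the description -/

theorem foldr_encodeNum (m : ℕ) (l : List ℕ) (ts : List Checker.Token) :
    (encodeNum m).foldr (fun s t => Checker.parseStep t s) (l, ts) = (m :: l, ts) := by
  rw [encodeNum, List.foldr_append]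
  induction m with
  | zero => rfl
  | succ m ih =>
    rw [List.replicate_succ, List.foldr_cons, ih]
    rfl

theorem foldr_gate (g : Gate) (ts : List Checker.Token) :
    g.encode.foldr (fun s t => Checker.parseStep t s) ([], ts) = ([], g.token :: ts) := by
  cases g <;> simp only [Gate.encode, List.foldr_cons, List.foldr_append, foldr_encodeNum] <;> rfl

theorem foldr_gates (gs : List Gate) (ts : List Checker.Token) :
    (gs.flatMap Gate.encode).foldr (fun s t => Checker.parseStep t s) ([], ts) =
      ([], gs.map Gate.token ++ ts) := by
  induction gs with
  | nil => rfl
  | cons g gs ih => rw [List.flatMap_cons, List.foldr_append, ih, foldr_gate]; rfl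

theorem parse_encode : Checker.parse C.encode = ([n], C.tokens) := by
  have h : Checker.parseStep ([C.out], []) .out = ([], [(Symbol.out, [C.out])]) := rfl
  rw [Checker.parse, List.foldl_reverse, encode, List.foldr_append, List.foldr_append,
    List.foldr_cons, foldr_encodeNum C.out, h, foldr_gates, foldr_encodeNum, tokens]

theorem length_encode_le (hsize : C.size + 3 = 3 * n) :
    C.encode.length ≤ 24 * (n + C.notCount) ^ 2 + 8 * (n + C.notCount) + 3 := by
  have hlen : C.gates.length = C.size + C.notCount := by
    rw [size, notCount, List.length_eq_countP_add_countP Gate.isBinary]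
    congr 2
    funext g
    cases g.isBinary <;> rfl
  have hnum : ∀ m, (encodeNum m).length = m + 1 := fun m => by simp [encodeNum]
  have hg : ∀ l ∈ C.gates.map (fun g => g.encode.length), l ≤ 1 + 2 * (n + C.gates.length) := by
    intro l hl
    obtain ⟨g, hg, rfl⟩ := List.mem_map.1 hl
    obtain ⟨k, hk, rfl⟩ := List.mem_iff_getElem.1 hg
    have := C.gates_wf k hk
    rcases h : C.gates[k] with ⟨i, j⟩ | ⟨i, j⟩ | i <;> rw [h] at this <;>
      simp only [Gate.ReadsBelow] at this <;>
      simp only [Gate.encode, List.length_cons, List.length_append, hnum] <;> omega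
  have hsum := List.sum_le_card_nsmul _ _ hg
  rw [List.length_map, smul_eq_mul] at hsum
  have hout := C.out_lt
  rw [encode, List.length_append, List.length_append, List.length_cons, hnum, hnum,
    List.length_flatMap]
  -- There are `3n - 3 + N` gates, where `N` counts the NOT gates. So there are at most `4(n + N)`
  -- nodes, and a gate takes its letter and at most two node numbers.
  have h₁ : C.gates.length ≤ 3 * (n + C.notCount) := by omega
  have h₂ : 1 + 2 * (n + C.gates.length) ≤ 1 + 8 * (n + C.notCount) := by omega
  have h₃ := hsum.trans (Nat.mul_le_mul h₁ h₂)
  have h₄ : 3 * (n + C.notCount) * (1 + 8 * (n + C.notCount)) =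
    24 * (n + C.notCount) ^ 2 + 3 * (n + C.notCount) := by ring
  omega

end Circuit

end DeMorgan

theorem DeMorgan.OutputsInTime.mono {Γ₀ Γ₁ : Type} {M : Turing.TM2ComputableAux Γ₀ Γ₁}
    {l : List Γ₀} {l' : List Γ₁} {t t' : ℕ} (h : DeMorgan.OutputsInTime M l l' t) (ht : t ≤ t') :
    DeMorgan.OutputsInTime M l l' t' :=
  let ⟨h⟩ := h
  ⟨⟨h.toEvalsTo, h.steps_le_m.trans ht⟩⟩

theorem mainTheorem1 (b : Bool) :
    ∃ (M : Turing.TM2ComputableAux DeMorgan.Symbol Bool) (p : Polynomial ℕ),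
      ∀ (n : ℕ) (C : DeMorgan.Circuit n),
        C.size + 3 = 3 * n →
        ¬ C.Computes (DeMorgan.xorFn n b) →
        ∃ x : Fin n → Bool,
          DeMorgan.OutputsInTime M C.encode (List.ofFn x) (p.eval (n + C.notCount)) ∧
          C.eval x ≠ DeMorgan.xorFn n b x := by
  obtain ⟨M, P, hM⟩ := (DeMorgan.Checker.polyTime_answer b).exists_machine
  refine ⟨M, P.comp (24 * .X ^ 2 + 8 * .X + 3), fun n C hsize hC => ?_⟩
  obtain ⟨x, hx, hne⟩ := DeMorgan.Circuit.exists_search_eq hsize hC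
  refine ⟨x, ?_, hne⟩
  have h : DeMorgan.Checker.answer b C.encode = List.ofFn x := by
    rw [DeMorgan.Checker.answer, DeMorgan.Circuit.parse_encode]
    exact hx
  have hw := hM C.encode
  rw [h] at hw
  refine hw.mono ?_
  rw [Polynomial.eval_comp]
  refine DeMorgan.polynomial_eval_mono P ?_
  simpa using DeMorgan.Circuit.length_encode_le hsize
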